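/- All posets are finite. For a vertex $a$ of a poset $P$ let $D_a=\{x\in P: x<a\}$ and $U_a=\{x\in P: x>a\}$. The poset $P$ is *$(3+1)$-free* if there are no $a<b<c$ and $d$ in $P$ with $d$ incomparable to each of $a,b,c$. Let $P$ be $(3+1)$-free. **Tangles and clone sets.** A *top of a tangle* is a connected component, with at least two vertices, of the graph on $P$ in which $a,b$ are adjacent when $D_a$ and $D_b$ are incomparable under inclusion; a *bottom of a tangle* is a connected component, with at least two vertices, of the graph in which $a,b$ are adjacent when $U_a$ and $U_b$ are incomparable under inclusion. A *tangle* of $P$ is a pair $(A,B)$ of a top $A$ and a bottom $B$ of a tangle for which there are $a,b\in A$ and $c,d\in B$ such that $c<a$ and $d<b$ are the only comparabilities among the four (distinct) vertices $a,b,c,d$. A *clone set* is an equivalence class of the relation "$D_a=D_b$ and $U_a=U_b$" on the set of vertices that lie in no tangle. The *parts* of $P$ are its clone sets and its tangles. **Skeleta.** The *level* $\ell(a)$ of a vertex is defined by: the minimal vertices of $P$ have level $0$, the minimal vertices among the remaining ones have level $1$, and so on. A *compatible listing* of $P$ is a listing $(X_1,\dots,X_k)$ of all its parts, without repetition, such that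 for $a\in X_i$, $b\in X_j$ with $i\ne j$ we have $a<b$ exactly when $\ell(a)\le \ell(b)-2$, or $\ell(a)=\ell(b)-1$ and $i<j$. Replace each clone set on level $i$ by the letter $c_i$, and each tangle with bottom on level $i$ and top on level $i+1$ by the letter $t_i$. The *skeleton* of $P$ is the class of the resulting word in the free partially commuting monoid on the letters $c_i,t_i$ ($i\ge 0$) with the commutation relations $c_ic_j=c_jc_i$ for $|i-j|\ge 2$; $c_it_j=t_jc_i$ for $i\le j-2$ or $i\ge j+3$; $t_it_j=t_jt_i$ for $|i-j|\ge 3$. Let $$S(c,t)=\sum_{r,s\ge 0}\bigl(\#\text{ of distinct skeleta of }(3+1)\text{-free posets with } r \text{ clone sets and } s \text{ tangles}\bigr)\,c^r t^s\in\mathbb{Q}[[c,t]].$$ **Unlabelled tangles and bicoloured graphs.** A *bicoloured graph* is a bipartite graph with a specified ordered bipartition; isomorphisms preserve the two colour classes. A tangle $(A,B)$ of a $(3+1)$-free poset is seen as a bicoloured graph with colour classes $B$ and $A$ and edges the comparable pairs. Let $T_{\mathrm{unl}}(x,y)$ (respectively $B_{\mathrm{unl}}(x,y)$) in $\mathbb{Q}[[x,y]]$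 be the ordinary generating function for the isomorphism classes of tangles of $(3+1)$-free posets (respectively of bicoloured graphs), where $x$ and $y$ mark the vertices of the first and second colour class, and let $B_{\mathrm{unl}}(x)=B_{\mathrm{unl}}(x,x)$. Let $p_{\mathrm{unl}}(n)$ be the number of isomorphism classes of $(3+1)$-free posets with $n$ vertices. **Statement.** The coefficients of $S$ are finite, the series $x/(1-x)$, $T_{\mathrm{unl}}(x,x)$ and $1-2x-B_{\mathrm{unl}}(x)^{-1}$ have constant term $0$ (so the substitutions below are defined), and $$\sum_{n\ge 0}p_{\mathrm{unl}}(n)\,x^n = S\Bigl(\frac{x}{1-x},\,T_{\mathrm{unl}}(x,x)\Bigr) = S\Bigl(\frac{x}{1-x},\,1-2x-B_{\mathrm{unl}}(x)^{-1}\Bigr).$$ -/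

import Mathlib

noncomputable section

namespace ThreePlusOne

/-! ### Posets: views, tangles, clone sets -/

section Poset

variable (P : Type*) [PartialOrder P]

/-- `P` is (3+1)-free: there are no `a < b < c` and `d` with `d` incomparable to `a`, `b`, `c`. -/
def IsFree31 : Prop :=
  ¬ ∃ a b c d : P, a < b ∧ b < c ∧
    IncompRel (· ≤ ·) d a ∧ IncompRel (· ≤ ·) d b ∧ IncompRel (· ≤ ·) d c

variable {P}

/-- The view of `a`: the strict downset of `a` and the complement of the strict upset of `a`. -/
def view (a : P) : Set P × Set P := (Set.Iio a, (Set.Ioi a)ᶜ)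

variable (P)

/-- The graph joining `a` and `b` when their strict downsets are incomparable under inclusion. -/
def topGraph : SimpleGraph P where
  Adj a b := ¬ Set.Iio a ⊆ Set.Iio b ∧ ¬ Set.Iio b ⊆ Set.Iio a
  symm := ⟨fun _ _ h => ⟨h.2, h.1⟩⟩
  loopless := ⟨fun _ h => h.1 (Set.Subset.refl _)⟩

/-- The graph joining `a` and `b` when their strict upsets are incomparable under inclusion. -/
def botGraph : SimpleGraph P where
  Adj a b := ¬ Set.Ioi a ⊆ Set.Ioi b ∧ ¬ Set.Ioi b ⊆ Set.Ioi a
  symm := ⟨fun _ _ h => ⟨h.2, h.1⟩⟩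
  loopless := ⟨fun _ h => h.1 (Set.Subset.refl _)⟩

variable {P}

/-- `A` is the top of a tangle: a connected component of `topGraph P` with at least two vertices. -/
def IsTangleTop (A : Set P) : Prop :=
  A.Nontrivial ∧ ∃ C : (topGraph P).ConnectedComponent, C.supp = A

/-- `B` is the bottom of a tangle: a connected component of `botGraph P` with at least two
vertices. -/
def IsTangleBot (B : Set P) : Prop :=
  B.Nontrivial ∧ ∃ C : (botGraph P).ConnectedComponent, C.supp = B

/-- There is an induced (2+2) subposet `c < a`, `d < b` with `a, b ∈ A` and `c, d ∈ B`. -/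
def Matched (A B : Set P) : Prop :=
  ∃ a ∈ A, ∃ b ∈ A, ∃ c ∈ B, ∃ d ∈ B, c < a ∧ d < b ∧
    IncompRel (· ≤ ·) a b ∧ IncompRel (· ≤ ·) c d ∧
    IncompRel (· ≤ ·) c b ∧ IncompRel (· ≤ ·) d a

/-- A tangle `(A, B)`: a matched pair of a top of a tangle and a bottom of a tangle. -/
def IsTangle (T : Set P × Set P) : Prop :=
  IsTangleTop T.1 ∧ IsTangleBot T.2 ∧ Matched T.1 T.2

/-- The vertices that lie in no tangle. -/
def outsideTangles (P : Type*) [PartialOrder P] : Set P :=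
  {x | ∀ T : Set P × Set P, IsTangle T → x ∉ T.1 ∪ T.2}

/-- A clone set: a class of the relation "same view" on the vertices outside all tangles. -/
def IsCloneSet (C : Set P) : Prop :=
  ∃ x ∈ outsideTangles P, C = {y ∈ outsideTangles P | view y = view x}

/-! ### Levels, compatible listings -/

/-- The level of a vertex (the minimal vertices have level `0`, the minimal ones among the others
have level `1`, and so on); see `level_eq_iff`. -/
def level (a : P) : ℕ := (Order.height a).toNat

theorem level_lt_level [Finite P] {a b : P} (h : a < b) : level a < level b := by
  have fin : ∀ x : P, Order.height x < ⊤ := fun x => by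
    have : Fintype P := Fintype.ofFinite P
    have h : Order.height x ≤ (Fintype.card P : ℕ∞) :=
      Order.height_le fun p _ => by exact_mod_cast p.length_lt_card.le
    exact lt_of_le_of_lt h (ENat.natCast_lt_top _)
  have h3 := Order.height_strictMono h (fin a)
  rw [← ENat.natCast_toNat (fin a).ne, ← ENat.natCast_toNat (fin b).ne] at h3
  exact_mod_cast h3

theorem exists_level_eq [Finite P] {a : P} {k : ℕ} (h : k < level a) :
    ∃ b < a, level b = k := by
  have ha : (k : ℕ∞) < Order.height a := by
    rcases eq_or_ne (Order.height a) ⊤ with h' | h'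
    · rw [h']; exact ENat.natCast_lt_top k
    · rw [← ENat.natCast_toNat h']; exact_mod_cast h
  have fin : Order.height a < ⊤ := by
    by_contra h'
    have : level a = 0 := by simp [level, not_lt_top_iff.1 h']
    omega
  obtain ⟨y, hy, hk⟩ := (Order.coe_lt_height_iff fin).1 ha
  exact ⟨y, hy, by simp [level, hk]⟩

/-- Level `k` is the set of minimal vertices among those that are on no smaller level. -/
theorem level_eq_iff [Finite P] (a : P) (k : ℕ) :
    level a = k ↔ Minimal (fun b => k ≤ level b) a := by
  constructor
  · rintro rfl
    refine ⟨le_rfl, fun b hb hba => ?_⟩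
    rcases hba.eq_or_lt with rfl | h
    · exact le_rfl
    · exact absurd (level_lt_level h) (not_lt.2 hb)
  · rintro ⟨h1, h2⟩
    rcases h1.eq_or_lt with h | h
    · exact h.symm
    · obtain ⟨b, hb, hk⟩ := exists_level_eq h
      exact absurd (h2 hk.ge hb.le) (not_le_of_gt hb)

/-- The parts of `P`: its clone sets and its tangles. -/
def PosetPart (P : Type*) [PartialOrder P] : Type _ :=
  {C : Set P // IsCloneSet C} ⊕ {T : Set P × Set P // IsTangle T}

/-- The set of vertices of a part. -/
def PosetPart.verts : PosetPart P → Set P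
  | .inl C => C.1
  | .inr T => T.1.1 ∪ T.1.2

/-- A listing of all the parts of `P`, each exactly once, that is compatible: for vertices `a`, `b`
in the parts at distinct positions `i`, `j`, we have `a < b` exactly when `b` is at least two levels
above `a`, or `b` is one level above `a` and `i < j`. -/
structure IsCompatibleListing (L : List (PosetPart P)) : Prop where
  nodup : L.Nodup
  complete : ∀ X : PosetPart P, X ∈ L
  compatible : ∀ i j : Fin L.length, i ≠ j → ∀ a ∈ (L.get i).verts, ∀ b ∈ (L.get j).verts,
    (a < b ↔ level a + 2 ≤ level b ∨ (level a + 1 = level b ∧ i < j))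

end Poset

/-! ### Skeleta -/

/-- The alphabet: `c i` stands for a clone set on level `i`, and `t i` for a tangle on the levels
`i` and `i + 1`.  Levels are numbered from `0`. -/
inductive Letter : Type
  | c (i : ℕ)
  | t (i : ℕ)

open FreeMonoid in
/-- The commutation relations: two letters commute when the levels that they stand for are neither
equal nor adjacent. -/
inductive LetterComm : FreeMonoid Letter → FreeMonoid Letter → Prop
  | cc (i j : ℕ) (h : i + 2 ≤ j ∨ j + 2 ≤ i) :
      LetterComm (of (Letter.c i) * of (Letter.c j)) (of (Letter.c j) * of (Letter.c i))
  | ct (i j : ℕ) (h : i + 2 ≤ j ∨ j + 3 ≤ i) :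
      LetterComm (of (Letter.c i) * of (Letter.t j)) (of (Letter.t j) * of (Letter.c i))
  | tt (i j : ℕ) (h : i + 3 ≤ j ∨ j + 3 ≤ i) :
      LetterComm (of (Letter.t i) * of (Letter.t j)) (of (Letter.t j) * of (Letter.t i))

/-- The free partially commuting monoid on the alphabet. -/
abbrev TraceMonoid : Type := PresentedMonoid LetterComm

section Skeleton

variable {P : Type*} [PartialOrder P]

/-- The letter of a clone set on level `i` is `c i`; the letter of a tangle with bottom on level `i`
and top on level `i + 1` is `t i`. -/
inductive HasLetter : PosetPart P → Letter → Prop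
  | c (C : {C : Set P // IsCloneSet C}) (i : ℕ) (h : ∀ a ∈ C.1, level a = i) :
      HasLetter (.inl C) (.c i)
  | t (T : {T : Set P × Set P // IsTangle T}) (i : ℕ) (hA : ∀ a ∈ T.1.1, level a = i + 1)
      (hB : ∀ b ∈ T.1.2, level b = i) :
      HasLetter (.inr T) (.t i)

/-- `m` is the skeleton of `P`: the class of the word of a compatible listing of `P`. -/
def IsSkeletonOf (P : Type*) [PartialOrder P] (m : TraceMonoid) : Prop :=
  ∃ (L : List (PosetPart P)) (w : List Letter), IsCompatibleListing L ∧ List.Forall₂ HasLetter L w ∧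
    m = PresentedMonoid.mk LetterComm (FreeMonoid.ofList w)

end Skeleton

/-- The skeleta of finite (3+1)-free posets with `r` clone sets and `s` tangles. -/
def skeleta (r s : ℕ) : Set TraceMonoid :=
  {m | ∃ (P : Type) (_ : Finite P) (_ : PartialOrder P), IsFree31 P ∧ IsSkeletonOf P m ∧
    Nat.card {C : Set P // IsCloneSet C} = r ∧ Nat.card {T : Set P × Set P // IsTangle T} = s}

/-- The generating function `S(c, t)` of skeleta; the variables `0`, `1` are `c`, `t`. -/
def skeletonSeries : MvPowerSeries (Fin 2) ℚ :=
  fun d => ((skeleta (d 0) (d 1)).ncard : ℚ)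

/-! ### Unlabelled posets, bicoloured graphs and tangles -/

/-- Isomorphism of (3+1)-free partial orders on `Fin n`. -/
def posetSetoid (n : ℕ) : Setoid {p : PartialOrder (Fin n) // @IsFree31 (Fin n) p} where
  r p q := ∃ σ : Equiv.Perm (Fin n), ∀ a b, p.1.le a b ↔ q.1.le (σ a) (σ b)
  iseqv :=
    { refl := fun _ => ⟨1, fun _ _ => Iff.rfl⟩
      symm := fun ⟨σ, h⟩ => ⟨σ⁻¹, fun a b => by rw [h]; simp⟩
      trans := fun ⟨σ, h⟩ ⟨τ, k⟩ => ⟨τ * σ, fun a b => by rw [h, k]; simp⟩ }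

/-- The number of unlabelled (3+1)-free posets with `n` vertices. -/
def pUnl (n : ℕ) : ℕ := Nat.card (Quotient (posetSetoid n))

/-- Bicoloured graphs with `i` vertices of the first colour (bottom) and `j` vertices of the second
colour (top), given by their adjacency relation between the two colour classes. -/
abbrev Bicoloured (i j : ℕ) : Type := Fin i → Fin j → Prop

/-- Colour-preserving isomorphism of bicoloured graphs. -/
def bicolouredSetoid (i j : ℕ) : Setoid (Bicoloured i j) where
  r R R' := ∃ (σ : Equiv.Perm (Fin i)) (τ : Equiv.Perm (Fin j)), ∀ b a, R b a ↔ R' (σ b) (τ a)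
  iseqv :=
    { refl := fun _ => ⟨1, 1, fun _ _ => Iff.rfl⟩
      symm := fun ⟨σ, τ, h⟩ => ⟨σ⁻¹, τ⁻¹, fun b a => by rw [h]; simp⟩
      trans := fun ⟨σ, τ, h⟩ ⟨σ', τ', k⟩ => ⟨σ' * σ, τ' * τ, fun b a => by rw [h, k]; simp⟩ }

/-- The bicoloured graph `R` is, up to isomorphism, a tangle `(A, B)` of some finite (3+1)-free
poset: colour classes `B` (bottom) and `A` (top), adjacency being comparability. -/
def IsTangleGraph {i j : ℕ} (R : Bicoloured i j) : Prop :=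
  ∃ (P : Type) (_ : Finite P) (_ : PartialOrder P), IsFree31 P ∧
    ∃ T : Set P × Set P, IsTangle T ∧
      ∃ (β : Fin i ≃ T.2) (α : Fin j ≃ T.1), ∀ b a, R b a ↔ (β b : P) < α a

/-- The generating function `B_unl(x, y)` of unlabelled bicoloured graphs; the variables `0`, `1`
mark the vertices of the first and of the second colour. -/
def bicolouredSeries : MvPowerSeries (Fin 2) ℚ :=
  fun d => (Nat.card (Quotient (bicolouredSetoid (d 0) (d 1))) : ℚ)

/-- The generating function `T_unl(x, y)` of unlabelled tangles; the variables `0`, `1`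
mark the vertices in the bottom and in the top. -/
def tangleSeries : MvPowerSeries (Fin 2) ℚ :=
  fun d => (Nat.card (Quotient
    ((bicolouredSetoid (d 0) (d 1)).comap
      (Subtype.val : {R : Bicoloured (d 0) (d 1) // IsTangleGraph R} → _))) : ℚ)

/-- Substitution of two univariate series for the two variables: `F(f, g)`. -/
def subst₂ (F : MvPowerSeries (Fin 2) ℚ) (f g : PowerSeries ℚ) : PowerSeries ℚ :=
  MvPowerSeries.subst (![f, g] : Fin 2 → MvPowerSeries Unit ℚ) F

/-- The univariate series `F(x, x)`. -/
def diag (F : MvPowerSeries (Fin 2) ℚ) : PowerSeries ℚ :=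
  subst₂ F PowerSeries.X PowerSeries.X

/-- The series `f` and `g` may be substituted in any series in two variables, because they have
constant term zero. -/
def CanSubst₂ (f g : PowerSeries ℚ) : Prop :=
  PowerSeries.constantCoeff f = 0 ∧ PowerSeries.constantCoeff g = 0

end ThreePlusOne

end

noncomputable section
namespace ThreePlusOne

/-! ### Components -/

section Components

variable {α β : Type*}

/-! A finite (3+1)-free poset amounts to a skeleton together with a block for each of its letters.
Write D and U for strict downsets and upsets. If D_a and D_b are incomparable then U_a = U_b
(`IsFree31.colAdj_up`), and a < b as soon as b is at least two levels above a
(`IsFree31.lt_of_level`). Hence tangles are disjoint and occupy two adjacent levels, a vertex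
outside a part is related in the same way to all vertices of the part on one level
(`PosetPart.uniform`), and vertices of different parts have comparable views
(`PosetPart.prec_total`). A minimality argument on views then finds a part that may be listed first
(`exists_source`), so a compatible listing exists.

Two parts that occur in opposite orders in two compatible listings have commuting letters
(`IsFree31.not_dep_of_swap`), so the skeleton is well defined. Neighbours with commuting letters may
be exchanged, so every word of the skeleton comes from a listing; parts with equal letters are never
exchanged, so it comes from only one. Fix one word per skeleton. Its listing turns the poset into a
list of blocks, which determines the poset up to isomorphism: no symmetry factors occur. Conversely,
the words of skeleta satisfy `IsSkeletonWord`, a condition that involves neither the sizes of clone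
sets nor the shapes of tangles, and any list of blocks over such a word is realized by the poset
`Word` (`Word.realizes`). So each skeleton with r clone sets and s tangles contributes (x/(1-x))^r
T(x,x)^s.

For the second formula, every bicoloured graph is in a unique way an ordered sum of atoms, namely
single vertices and tangles: a first atom exists (`exists_isPrefix_isAtom`) and can be cancelled
(`IsAtom.cancel`). Hence B = 1 + (x + y + T) B, where T counts the bicoloured graphs that are
tangled as a whole (`isTangleGraph_iff`), and x = y gives T(x,x) = 1 - 2x - B(x)⁻¹. -/

/-- Every partition of `A` into two nonempty sets is crossed by an adjacent pair. -/
def CutConnected (adj : α → α → Prop) (A : Set α) : Prop :=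
  ∀ U ⊆ A, U.Nonempty → (A \ U).Nonempty → ∃ a ∈ U, ∃ b ∈ A \ U, adj a b

/-- `A` is a connected component with at least two elements. -/
structure IsBigComponent (adj : α → α → Prop) (A : Set α) : Prop where
  nontrivial : A.Nontrivial
  closed : ∀ a ∈ A, ∀ b, adj a b → b ∈ A
  cut : CutConnected adj A

/-- The cut formed by the elements with `p` would be crossed by an adjacent pair, which `step`
forbids. -/
theorem CutConnected.induction {adj : α → α → Prop} {A : Set α} (h : CutConnected adj A)
    (p : α → Prop) {a : α} (ha : a ∈ A) (hp : p a)
    (step : ∀ x ∈ A, ∀ y ∈ A, adj x y → p x → p y) : ∀ y ∈ A, p y := by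
  by_contra! hc
  obtain ⟨y, hy, hpy⟩ := hc
  obtain ⟨x, hx, z, hz, hxz⟩ := h {x ∈ A | p x} (fun x hx => hx.1) ⟨a, ha, hp⟩
    ⟨y, hy, fun h => hpy h.2⟩
  exact hz.2 ⟨hz.1, step x hx.1 z hz.1 hxz hx.2⟩

theorem CutConnected.const {adj : α → α → Prop} {A : Set α} (h : CutConnected adj A)
    {f : α → β} (hf : ∀ x y, adj x y → f x = f y) {a b : α} (ha : a ∈ A) (hb : b ∈ A) :
    f a = f b :=
  (h.induction (fun x => f a = f x) ha rfl fun _ _ _ _ hxy hx => hx.trans (hf _ _ hxy)) b hb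

theorem IsBigComponent.exists_adj {adj : α → α → Prop} {A : Set α} (h : IsBigComponent adj A)
    {a : α} (ha : a ∈ A) : ∃ b ∈ A, adj a b := by
  obtain ⟨b, hb, hne⟩ := h.nontrivial.exists_ne a
  obtain ⟨x, hx, y, hy, hxy⟩ := h.cut {a} (by simpa using ha) ⟨a, rfl⟩ ⟨b, hb, by simpa using hne⟩
  rw [Set.mem_singleton_iff] at hx
  exact ⟨y, hy.1, hx ▸ hxy⟩

theorem IsBigComponent.eq {adj : α → α → Prop} {A B : Set α} (hA : IsBigComponent adj A)
    (hB : IsBigComponent adj B) {x : α} (hxA : x ∈ A) (hxB : x ∈ B) : A = B :=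
  Set.Subset.antisymm
    (hA.cut.induction (· ∈ B) hxA hxB fun x _ y _ h hx => hB.closed x hx y h)
    (hB.cut.induction (· ∈ A) hxB hxA fun x _ y _ h hx => hA.closed x hx y h)

/-- Replaces walks by closure and cuts; in this form components pass easily to restrictions, images
and isomorphic relations. -/
theorem isBigComponent_iff (G : SimpleGraph α) (A : Set α) :
    (A.Nontrivial ∧ ∃ C : G.ConnectedComponent, C.supp = A) ↔ IsBigComponent G.Adj A := by
  constructor
  · rintro ⟨hn, C, rfl⟩
    refine ⟨hn, fun a ha b hab => C.mem_supp_of_adj_mem_supp ha hab, fun U hU hne hne' => ?_⟩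
    by_contra! hc
    obtain ⟨a, ha⟩ := hne
    obtain ⟨b, hb, hbU⟩ := hne'
    have hr : G.Reachable a b := SimpleGraph.ConnectedComponent.exact ((hU ha).trans hb.symm)
    obtain ⟨w⟩ := hr
    have key : ∀ {x y : α} (w : G.Walk x y), x ∈ U → y ∈ U := by
      intro x y w
      induction w with
      | nil => exact id
      | @cons u v z h _ ih =>
        intro hu
        refine ih (by_contra fun hv => hc u hu v ⟨C.mem_supp_of_adj_mem_supp (hU hu) h, hv⟩ h)
    exact hbU (key w ha)
  · intro h
    refine ⟨h.nontrivial, ?_⟩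
    obtain ⟨a, ha⟩ := h.nontrivial.nonempty
    refine ⟨G.connectedComponentMk a, Set.Subset.antisymm ?_ ?_⟩
    · intro x hx
      have hr : G.Reachable a x := (SimpleGraph.ConnectedComponent.exact hx).symm
      obtain ⟨w⟩ := hr
      have key : ∀ {x y : α} (w : G.Walk x y), x ∈ A → y ∈ A := by
        intro x y w
        induction w with
        | nil => exact id
        | @cons u v z e _ ih => exact fun hu => ih (h.closed u hu v e)
      exact key w ha
    · refine h.cut.induction _ ha rfl fun x _ y _ hxy hx => ?_
      exact SimpleGraph.ConnectedComponent.mem_supp_of_adj_mem_supp _ hx hxy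

theorem exists_isBigComponent (G : SimpleGraph α) {a b : α} (h : G.Adj a b) :
    ∃ A, IsBigComponent G.Adj A ∧ a ∈ A :=
  ⟨(G.connectedComponentMk a).supp, (isBigComponent_iff G _).1
    ⟨⟨a, rfl, b, SimpleGraph.ConnectedComponent.mem_supp_of_adj_mem_supp _ rfl h, h.ne⟩, _, rfl⟩,
    rfl⟩

end Components

/-! ### Tangles of a relation -/

section Relation

variable {V W V' W' : Type*}

/-- The columns `a` and `b` of the relation `R` are incomparable under inclusion. -/
def ColAdj (R : V → W → Prop) (a b : W) : Prop :=
  (∃ c, R c a ∧ ¬ R c b) ∧ ∃ c, R c b ∧ ¬ R c a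

theorem ColAdj.symm {R : V → W → Prop} {a b : W} (h : ColAdj R a b) : ColAdj R b a := ⟨h.2, h.1⟩

/-- The graph of incomparability of columns. -/
def colGraph (R : V → W → Prop) : SimpleGraph W where
  Adj := ColAdj R
  symm := ⟨fun _ _ h => h.symm⟩
  loopless := ⟨fun _ ⟨⟨_, h, h'⟩, _⟩ => h' h⟩

/-- Two columns of `A` and two rows of `B` induce a perfect matching. -/
def IsMatch (R : V → W → Prop) (A : Set W) (B : Set V) : Prop :=
  ∃ a ∈ A, ∃ b ∈ A, ∃ c ∈ B, ∃ d ∈ B, R c a ∧ R d b ∧ ¬ R c b ∧ ¬ R d a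

/-- `A` and `B` are matched components of the graphs of incomparability of columns and rows. -/
structure IsTangleOf (R : V → W → Prop) (A : Set W) (B : Set V) : Prop where
  col : IsBigComponent (ColAdj R) A
  row : IsBigComponent (ColAdj (flip R)) B
  isMatch : IsMatch R A B

/-- Rows and columns are interchangeable, so statements on columns have row versions by `flip`. For
the relation `<` of a poset, columns are strict downsets and rows are strict upsets. -/
theorem IsTangleOf.flip {R : V → W → Prop} {A : Set W} {B : Set V} (h : IsTangleOf R A B) :
    IsTangleOf (flip R) B A := by
  obtain ⟨a, ha, b, hb, c, hc, d, hd, h1, h2, h3, h4⟩ := h.isMatch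
  exact ⟨h.row, h.col, c, hc, d, hd, a, ha, b, hb, h1, h2, h4, h3⟩

/-- An outside column is comparable with each column of `A`. If the direction changed along an edge,
it would lie between two incomparable columns. -/
theorem IsBigComponent.comparable {R : V → W → Prop} {A : Set W} (h : IsBigComponent (ColAdj R) A)
    {c : W} (hc : c ∉ A) : (∀ a ∈ A, ∀ z, R z c → R z a) ∨ (∀ a ∈ A, ∀ z, R z a → R z c) := by
  have cmp : ∀ a ∈ A, (∀ z, R z c → R z a) ∨ (∀ z, R z a → R z c) := by
    intro a ha
    by_contra! hh
    obtain ⟨⟨x, hx, hx'⟩, y, hy, hy'⟩ := hh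
    exact hc (h.closed a ha c ⟨⟨y, hy, hy'⟩, x, hx, hx'⟩)
  obtain ⟨a, ha⟩ := h.nontrivial.nonempty
  rcases cmp a ha with h1 | h1
  · refine .inl (h.cut.induction _ ha h1 fun x hx y hy hxy hcx => ?_)
    rcases cmp y hy with h2 | h2
    · exact h2
    · obtain ⟨z, hz, hz'⟩ := hxy.2
      exact absurd (hcx z (h2 z hz)) hz'
  · refine .inr (h.cut.induction _ ha h1 fun x hx y hy hxy hcx => ?_)
    rcases cmp y hy with h2 | h2
    · obtain ⟨z, hz, hz'⟩ := hxy.1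
      exact absurd (h2 z (hcx z hz)) hz'
    · exact h2

/-- A row that splits the top of a tangle belongs to its bottom. -/
theorem IsTangleOf.mem_row {R : V → W → Prop} {A : Set W} {B : Set V} (h : IsTangleOf R A B)
    {c : V} {a a' : W} (ha : a ∈ A) (ha' : a' ∈ A) (h1 : R c a) (h2 : ¬ R c a') : c ∈ B := by
  by_contra hc
  rcases h.row.comparable hc with hh | hh
  -- The row of `c` lies in every row of `B`, so the column `a` contains `B`. This spreads along
  -- edges: if `x` contains `B` and its neighbour `y` misses `b`, then a row `z` in `y` but not in
  -- `x` is adjacent to `b`, hence in `B`, which is absurd. But the matching has a column of `A`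
  -- that misses a row of `B`.
  · have hp : ∀ x ∈ A, ∀ b ∈ B, R b x := by
      refine h.col.cut.induction _ ha (fun b hb => hh b hb a h1) fun x hx y hy hxy hBx b hb => ?_
      by_contra hby
      obtain ⟨z, hz, hz'⟩ := hxy.2
      exact hz' (hBx z (h.row.closed b hb z ⟨⟨x, hBx b hb, hz'⟩, y, hz, hby⟩))
    obtain ⟨_, _, b, hb, c, hc, _, _, _, _, h3, _⟩ := h.isMatch
    exact h3 (hp b hb c hc)
  -- Every row of `B` lies in the row of `c`. Meeting `B` spreads along edges in the same way, so
  -- `a'` meets `B` and would lie in the row of `c`.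
  · have hp : ∀ x ∈ A, ∃ b ∈ B, R b x := by
      obtain ⟨x, hx, _, _, c, hc, _, _, h3, _⟩ := h.isMatch
      refine h.col.cut.induction _ hx ⟨c, hc, h3⟩ fun x hx y hy hxy ⟨b, hb, hbx⟩ => ?_
      by_contra! hBy
      obtain ⟨z, hz, hz'⟩ := hxy.2
      exact hBy z (h.row.closed b hb z ⟨⟨x, hbx, hz'⟩, y, hz, hBy b hb⟩) hz
    obtain ⟨b, hb, hba⟩ := hp a' ha'
    exact h2 (hh b hb a' hba)

theorem IsTangleOf.mem_col {R : V → W → Prop} {A : Set W} {B : Set V} (h : IsTangleOf R A B)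
    {a : W} {c c' : V} (hc : c ∈ B) (hc' : c' ∈ B) (h1 : R c a) (h2 : ¬ R c' a) : a ∈ A :=
  h.flip.mem_row hc hc' h1 h2

/-- The rows that witness the incomparability of two columns are themselves adjacent; their
component is the partner of `A`. -/
theorem IsBigComponent.exists_isTangleOf {R : V → W → Prop} {A : Set W}
    (h : IsBigComponent (ColAdj R) A) : ∃ B, IsTangleOf R A B := by
  obtain ⟨a, ha⟩ := h.nontrivial.nonempty
  obtain ⟨b, hb, hab⟩ := h.exists_adj ha
  obtain ⟨⟨c, hca, hcb⟩, d, hdb, hda⟩ := hab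
  have hcd : ColAdj (_root_.flip R) c d := ⟨⟨a, hca, hda⟩, b, hdb, hcb⟩
  obtain ⟨B, hB, hcB⟩ := exists_isBigComponent (colGraph (_root_.flip R)) hcd
  exact ⟨B, h, hB, a, ha, b, hb, c, hcB, d, hB.closed c hcB d hcd, hca, hdb, hcb, hda⟩

/-- A row of the matching splits `A`, so `IsTangleOf.mem_row` puts it in both bottoms. -/
theorem IsTangleOf.row_unique {R : V → W → Prop} {A : Set W} {B B' : Set V}
    (h : IsTangleOf R A B) (h' : IsTangleOf R A B') : B = B' := by
  obtain ⟨a, ha, b, hb, c, hc, d, hd, h1, h2, h3, h4⟩ := h.isMatch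
  exact h.row.eq h'.row hc (h'.mem_row ha hb h1 h3)

theorem IsTangleOf.col_unique {R : V → W → Prop} {A A' : Set W} {B : Set V}
    (h : IsTangleOf R A B) (h' : IsTangleOf R A' B) : A = A' :=
  h.flip.row_unique h'.flip

theorem IsTangleOf.exists_rel {R : V → W → Prop} {A : Set W} {B : Set V} (h : IsTangleOf R A B)
    {a : W} (ha : a ∈ A) : ∃ c ∈ B, R c a := by
  obtain ⟨b, hb, ⟨c, h1, h2⟩, _⟩ := h.col.exists_adj ha
  exact ⟨c, h.mem_row ha hb h1 h2, h1⟩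

theorem IsTangleOf.exists_not_rel {R : V → W → Prop} {A : Set W} {B : Set V}
    (h : IsTangleOf R A B) {a : W} (ha : a ∈ A) : ∃ c ∈ B, ¬ R c a := by
  obtain ⟨b, hb, _, c, h1, h2⟩ := h.col.exists_adj ha
  exact ⟨c, h.mem_row hb ha h1 h2, h2⟩

theorem IsTangleOf.exists_rel' {R : V → W → Prop} {A : Set W} {B : Set V} (h : IsTangleOf R A B)
    {c : V} (hc : c ∈ B) : ∃ a ∈ A, R c a := h.flip.exists_rel hc

theorem IsTangleOf.exists_not_rel' {R : V → W → Prop} {A : Set W} {B : Set V}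
    (h : IsTangleOf R A B) {c : V} (hc : c ∈ B) : ∃ a ∈ A, ¬ R c a := h.flip.exists_not_rel hc

/-- The whole relation is a tangle. -/
def Tangled (R : V → W → Prop) : Prop := IsTangleOf R Set.univ Set.univ

/-- Witnesses of incomparability split `A`, hence lie in `B`: no adjacency is lost by restricting to
the tangle. -/
theorem IsTangleOf.colAdj_restrict {R : V → W → Prop} {A : Set W} {B : Set V}
    (h : IsTangleOf R A B) (a b : A) :
    ColAdj (fun (c : B) (a : A) => R c a) a b ↔ ColAdj R a b := by
  constructor
  · rintro ⟨⟨c, h1, h2⟩, d, h3, h4⟩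
    exact ⟨⟨c, h1, h2⟩, d, h3, h4⟩
  · rintro ⟨⟨c, h1, h2⟩, d, h3, h4⟩
    exact ⟨⟨⟨c, h.mem_row a.2 b.2 h1 h2⟩, h1, h2⟩, ⟨d, h.mem_row b.2 a.2 h3 h4⟩, h3, h4⟩

theorem IsTangleOf.isBigComponent_restrict {R : V → W → Prop} {A : Set W} {B : Set V}
    (h : IsTangleOf R A B) :
    IsBigComponent (ColAdj (fun (c : B) (a : A) => R c a)) Set.univ := by
  refine ⟨?_, fun _ _ _ _ => trivial, fun U _ hU hU' => ?_⟩
  · obtain ⟨a, ha, b, hb, hab⟩ := h.col.nontrivial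
    exact ⟨⟨a, ha⟩, trivial, ⟨b, hb⟩, trivial, fun h => hab (congrArg Subtype.val h)⟩
  · obtain ⟨x, hx⟩ := hU
    obtain ⟨y, -, hy⟩ := hU'
    obtain ⟨a, ⟨a', ha', rfl⟩, b, ⟨hb, hb'⟩, hab⟩ := h.col.cut (Subtype.val '' U)
      (by rintro _ ⟨x, -, rfl⟩; exact x.2) ⟨x, x, hx, rfl⟩
      ⟨y, y.2, by rintro ⟨z, hz, hzy⟩; exact hy (Subtype.ext hzy ▸ hz)⟩
    exact ⟨a', ha', ⟨b, hb⟩, ⟨trivial, fun hh => hb' ⟨_, hh, rfl⟩⟩,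
      (h.colAdj_restrict a' ⟨b, hb⟩).2 hab⟩

theorem IsTangleOf.tangled {R : V → W → Prop} {A : Set W} {B : Set V} (h : IsTangleOf R A B) :
    Tangled (fun (c : B) (a : A) => R c a) := by
  refine ⟨h.isBigComponent_restrict, h.flip.isBigComponent_restrict, ?_⟩
  obtain ⟨a, ha, b, hb, c, hc, d, hd, h1⟩ := h.isMatch
  exact ⟨⟨a, ha⟩, trivial, ⟨b, hb⟩, trivial, ⟨c, hc⟩, trivial, ⟨d, hd⟩, trivial, h1⟩

/-- Isomorphism of bicoloured graphs on arbitrary vertex sets. -/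
def BIso (R : V → W → Prop) (R' : V' → W' → Prop) : Prop :=
  ∃ (σ : V ≃ V') (τ : W ≃ W'), ∀ b a, R b a ↔ R' (σ b) (τ a)

theorem BIso.symm {R : V → W → Prop} {R' : V' → W' → Prop} : BIso R R' → BIso R' R :=
  fun ⟨σ, τ, h⟩ => ⟨σ.symm, τ.symm, fun b a => by simp [h]⟩

theorem BIso.trans {V'' W'' : Type*} {R : V → W → Prop} {R' : V' → W' → Prop}
    {R'' : V'' → W'' → Prop} : BIso R R' → BIso R' R'' → BIso R R'' :=
  fun ⟨σ, τ, h⟩ ⟨σ', τ', h'⟩ => ⟨σ.trans σ', τ.trans τ', fun b a => by simp [h, h']⟩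

theorem BIso.flip {R : V → W → Prop} {R' : V' → W' → Prop} : BIso R R' → BIso (flip R) (flip R') :=
  fun ⟨σ, τ, h⟩ => ⟨τ, σ, fun a b => h b a⟩

theorem colAdj_equiv {R : V → W → Prop} {R' : V' → W' → Prop} (σ : V ≃ V') (τ : W ≃ W')
    (h : ∀ b a, R b a ↔ R' (σ b) (τ a)) (a b : W) : ColAdj R a b ↔ ColAdj R' (τ a) (τ b) := by
  simp only [ColAdj, h]
  exact and_congr (σ.surjective.exists (p := fun c => R' c (τ a) ∧ ¬ R' c (τ b))).symm
    (σ.surjective.exists (p := fun c => R' c (τ b) ∧ ¬ R' c (τ a))).symm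

theorem BIso.isBigComponent_univ {R : V → W → Prop} {R' : V' → W' → Prop} (h : BIso R R')
    (hR : IsBigComponent (ColAdj R) Set.univ) : IsBigComponent (ColAdj R') Set.univ := by
  obtain ⟨σ, τ, h⟩ := h
  refine ⟨?_, fun _ _ _ _ => trivial, fun U _ hU hU' => ?_⟩
  · obtain ⟨a, -, b, -, hab⟩ := hR.nontrivial
    exact ⟨τ a, trivial, τ b, trivial, fun e => hab (τ.injective e)⟩
  · obtain ⟨x, hx⟩ := hU
    obtain ⟨y, -, hy⟩ := hU'
    obtain ⟨a, ha, b, hb, hab⟩ := hR.cut (τ ⁻¹' U) (Set.subset_univ _) ⟨τ.symm x, by simpa⟩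
      ⟨τ.symm y, trivial, by simpa⟩
    exact ⟨τ a, ha, τ b, ⟨trivial, hb.2⟩, (colAdj_equiv σ τ h a b).1 hab⟩

theorem BIso.tangled {R : V → W → Prop} {R' : V' → W' → Prop} (h : BIso R R') (hR : Tangled R) :
    Tangled R' := by
  refine ⟨h.isBigComponent_univ hR.col, h.flip.isBigComponent_univ hR.row, ?_⟩
  obtain ⟨a, -, b, -, c, -, d, -, h1⟩ := hR.isMatch
  obtain ⟨σ, τ, h⟩ := h
  simp only [h] at h1
  exact ⟨τ a, trivial, τ b, trivial, σ c, trivial, σ d, trivial, h1⟩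

end Relation

end ThreePlusOne
end
noncomputable section
namespace ThreePlusOne

/-! ### Structure of (3+1)-free posets -/

section Structure

variable {P : Type*} [PartialOrder P]

theorem isTangleTop_iff (A : Set P) :
    IsTangleTop A ↔ IsBigComponent (ColAdj (LT.lt : P → P → Prop)) A := by
  have h : (topGraph P).Adj = ColAdj (LT.lt : P → P → Prop) := by
    ext a b
    simp [topGraph, ColAdj, Set.not_subset]
  rw [← h, ← isBigComponent_iff]
  rfl

theorem isTangleBot_iff (A : Set P) :
    IsTangleBot A ↔ IsBigComponent (ColAdj (flip (LT.lt : P → P → Prop))) A := by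
  have h : (botGraph P).Adj = ColAdj (flip (LT.lt : P → P → Prop)) := by
    ext a b
    simp [botGraph, ColAdj, Set.not_subset, flip]
  rw [← h, ← isBigComponent_iff]
  rfl

/-- All four incomparabilities in `Matched` follow from the two absences `¬ c < b` and `¬ d < a`. -/
theorem matched_iff (A B : Set P) : Matched A B ↔ IsMatch LT.lt A B := by
  constructor
  · rintro ⟨a, ha, b, hb, c, hc, d, hd, h1, h2, -, -, h3, h4⟩
    exact ⟨a, ha, b, hb, c, hc, d, hd, h1, h2, fun h => h3.1 h.le, fun h => h4.1 h.le⟩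
  · rintro ⟨a, ha, b, hb, c, hc, d, hd, h1, h2, h3, h4⟩
    refine ⟨a, ha, b, hb, c, hc, d, hd, h1, h2, ⟨fun h => h3 (h1.trans_le h),
      fun h => h4 (h2.trans_le h)⟩, ⟨fun h => h3 (h.trans_lt h2), fun h => h4 (h.trans_lt h1)⟩,
      ⟨fun h => ?_, fun h => h4 ((h2.trans_le h).trans h1)⟩,
      ⟨fun h => ?_, fun h => h3 ((h1.trans_le h).trans h2)⟩⟩
    · rcases h.lt_or_eq with h | rfl
      · exact h3 h
      · exact h4 (h2.trans h1)
    · rcases h.lt_or_eq with h | rfl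
      · exact h4 h
      · exact h3 (h1.trans h2)

theorem isTangle_iff (T : Set P × Set P) : IsTangle T ↔ IsTangleOf LT.lt T.1 T.2 := by
  rw [IsTangle, isTangleTop_iff, isTangleBot_iff, matched_iff]
  exact ⟨fun ⟨h1, h2, h3⟩ => ⟨h1, h2, h3⟩, fun ⟨h1, h2, h3⟩ => ⟨h1, h2, h3⟩⟩

theorem view_eq_iff {a b : P} :
    view a = view b ↔ (∀ z, z < a ↔ z < b) ∧ ∀ z, a < z ↔ b < z := by
  simp [view, Set.ext_iff]

/-- Otherwise `b` is incomparable to the whole chain `c < a < d`. In terms of views: if the downset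
of `a` is not contained in that of `b`, then the upset of `a` is contained in that of `b`. -/
theorem IsFree31.lt_of_lt (hP : IsFree31 P) {a b c d : P} (h1 : c < a) (h2 : ¬ c < b)
    (h3 : a < d) : b < d := by
  by_contra h4
  refine hP ⟨c, a, d, b, h1, h3, ⟨fun h => h4 (h.trans_lt (h1.trans h3)), fun h => ?_⟩,
    ⟨fun h => h4 (h.trans_lt h3), fun h => h2 (h1.trans_le h)⟩, ⟨fun h => ?_,
      fun h => h2 (h1.trans (h3.trans_le h))⟩⟩
  · rcases h.lt_or_eq with h | rfl
    · exact h2 h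
    · exact h4 (h1.trans h3)
  · rcases h.lt_or_eq with h | rfl
    · exact h4 h
    · exact h2 (h1.trans h3)

theorem IsFree31.gt_of_gt (hP : IsFree31 P) {a b c d : P} (h1 : a < c) (h2 : ¬ b < c)
    (h3 : d < a) : d < b :=
  by_contra fun h => h2 (hP.lt_of_lt h3 h h1)

theorem IsFree31.colAdj_up (hP : IsFree31 P) {a b : P} (h : ColAdj LT.lt a b) (z : P) :
    a < z ↔ b < z := by
  obtain ⟨⟨c, h1, h2⟩, d, h3, h4⟩ := h
  exact ⟨hP.lt_of_lt h1 h2, hP.lt_of_lt h3 h4⟩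

theorem IsFree31.rowAdj_down (hP : IsFree31 P) {a b : P} (h : ColAdj (flip LT.lt) a b) (z : P) :
    z < a ↔ z < b := by
  obtain ⟨⟨c, h1, h2⟩, d, h3, h4⟩ := h
  exact ⟨hP.gt_of_gt h1 h2, hP.gt_of_gt h3 h4⟩

/-- Row adjacency gives `e` the same downset as `a`, so `e` is column adjacent to `b` as well. Then
`a`, `b`, `e` have the same upset, against the row adjacency. -/
theorem IsFree31.not_row_of_col (hP : IsFree31 P) {a b e : P} (h : ColAdj LT.lt a b)
    (h' : ColAdj (flip LT.lt) a e) : False := by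
  have h1 := hP.rowAdj_down h'
  have h2 := hP.colAdj_up h
  have h3 : ColAdj LT.lt e b := by simpa only [ColAdj, h1] using h
  have h4 := hP.colAdj_up h3
  obtain ⟨⟨z, h5, h6⟩, -⟩ := h'
  exact h6 ((h4 z).2 ((h2 z).1 h5))

/-- A chain ending at or below `b` meets the level of `a` and the next two levels. If `a < b`
failed, `a` would be incomparable to its three vertices. -/
theorem IsFree31.lt_of_level [Finite P] (hP : IsFree31 P) {a b : P}
    (h : level a + 2 ≤ level b) : a < b := by
  by_contra hab
  obtain ⟨b', hb', hl⟩ : ∃ b' ≤ b, level b' = level a + 2 := by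
    rcases h.eq_or_lt with h | h
    · exact ⟨b, le_rfl, h.symm⟩
    · obtain ⟨b', h1, h2⟩ := exists_level_eq h
      exact ⟨b', h1.le, h2⟩
  have hab' : ¬ a < b' := fun h => hab (h.trans_le hb')
  obtain ⟨c, hc, hcl⟩ := exists_level_eq (a := b') (k := level a + 1) (by omega)
  obtain ⟨d, hd, hdl⟩ := exists_level_eq (a := c) (k := level a) (by omega)
  have key : ∀ {x y : P}, x ≤ y → x = y ∨ level x < level y := fun h =>
    h.eq_or_lt.imp id level_lt_level
  refine hP ⟨d, c, b', a, hd, hc, ⟨fun h => hab' (h.trans_lt (hd.trans hc)), fun h => ?_⟩,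
    ⟨fun h => hab' (h.trans_lt hc), fun h => ?_⟩, ⟨fun h => ?_, fun h => ?_⟩⟩
  · rcases key h with rfl | h
    · exact hab' (hd.trans hc)
    · omega
  · rcases key h with rfl | h <;> omega
  · exact hab' (lt_of_le_of_ne h (by rintro rfl; omega))
  · rcases key h with rfl | h <;> omega

/-- If the levels differed, a vertex below the lower one would be two levels below the other, hence
below it too. -/
theorem IsFree31.level_eq_of_colAdj [Finite P] (hP : IsFree31 P) {a b : P}
    (h : ColAdj LT.lt a b) : level a = level b := by
  rcases lt_trichotomy (level a) (level b) with hl | hl | hl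
  · obtain ⟨⟨c, h1, h2⟩, -⟩ := h
    have := level_lt_level h1
    exact absurd (hP.lt_of_level (by omega)) h2
  · exact hl
  · obtain ⟨-, c, h1, h2⟩ := h
    have := level_lt_level h1
    exact absurd (hP.lt_of_level (by omega)) h2

theorem IsFree31.level_eq_of_rowAdj [Finite P] (hP : IsFree31 P) {a b : P}
    (h : ColAdj (flip LT.lt) a b) : level a = level b := by
  rcases lt_trichotomy (level a) (level b) with hl | hl | hl
  · obtain ⟨-, c, h1, h2⟩ := h
    have := level_lt_level h1
    exact absurd (hP.lt_of_level (by omega)) h2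
  · exact hl
  · obtain ⟨⟨c, h1, h2⟩, -⟩ := h
    have := level_lt_level h1
    exact absurd (hP.lt_of_level (by omega)) h2

theorem level_eq_of_view_eq [Finite P] {a b : P} (h : view a = view b) : level a = level b := by
  have key : ∀ {a b : P}, (∀ z, z < a ↔ z < b) → ¬ level a < level b := by
    intro a b h hl
    obtain ⟨c, hc, hcl⟩ := exists_level_eq hl
    have := level_lt_level ((h c).2 hc)
    omega
  have h1 := (view_eq_iff.1 h).1
  have := key h1
  have := key fun z => (h1 z).symm
  omega

/-! ### Parts of a (3+1)-free poset and their levels -/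

section Parts

variable {T T' : Set P × Set P}

theorem IsTangle.level_col [Finite P] (hP : IsFree31 P) (hT : IsTangle T) {a b : P}
    (ha : a ∈ T.1) (hb : b ∈ T.1) : level a = level b :=
  ((isTangle_iff T).1 hT).col.cut.const (fun _ _ => hP.level_eq_of_colAdj) ha hb

theorem IsTangle.level_row [Finite P] (hP : IsFree31 P) (hT : IsTangle T) {a b : P}
    (ha : a ∈ T.2) (hb : b ∈ T.2) : level a = level b :=
  ((isTangle_iff T).1 hT).row.cut.const (fun _ _ => hP.level_eq_of_rowAdj) ha hb

theorem IsTangle.level_col_row [Finite P] (hP : IsFree31 P) (hT : IsTangle T) {a c : P}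
    (ha : a ∈ T.1) (hc : c ∈ T.2) : level a = level c + 1 := by
  obtain ⟨a', ha', b, hb, c', hc', d, hd, h1, h2, h3, h4⟩ := ((isTangle_iff T).1 hT).isMatch
  have e1 := hT.level_col hP ha ha'
  have e2 := hT.level_row hP hc hc'
  have e3 := hT.level_col hP ha' hb
  have := level_lt_level h1
  have : ¬ level c' + 2 ≤ level b := fun h => h3 (hP.lt_of_level h)
  omega

theorem IsTangle.up_iff (hP : IsFree31 P) (hT : IsTangle T) {a b : P}
    (ha : a ∈ T.1) (hb : b ∈ T.1) (z : P) : a < z ↔ b < z := by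
  have := ((isTangle_iff T).1 hT).col.cut.const (f := fun x => x < z)
    (fun _ _ h => propext (hP.colAdj_up h z)) ha hb
  exact this.to_iff

theorem IsTangle.down_iff (hP : IsFree31 P) (hT : IsTangle T) {a b : P}
    (ha : a ∈ T.2) (hb : b ∈ T.2) (z : P) : z < a ↔ z < b := by
  have := ((isTangle_iff T).1 hT).row.cut.const (f := fun x => z < x)
    (fun _ _ h => propext (hP.rowAdj_down h z)) ha hb
  exact this.to_iff

theorem not_mem_outsideTangles_of_colAdj {a b : P} (h : ColAdj LT.lt a b) :
    ∃ T, IsTangle T ∧ a ∈ T.1 := by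
  obtain ⟨A, hA, ha⟩ := exists_isBigComponent (colGraph LT.lt) h
  obtain ⟨B, hB⟩ := IsBigComponent.exists_isTangleOf hA
  exact ⟨(A, B), (isTangle_iff _).2 hB, ha⟩

theorem not_mem_outsideTangles_of_rowAdj {a b : P} (h : ColAdj (flip LT.lt) a b) :
    ∃ T, IsTangle T ∧ a ∈ T.2 := by
  obtain ⟨A, hA, ha⟩ := exists_isBigComponent (colGraph (flip LT.lt)) h
  obtain ⟨B, hB⟩ := IsBigComponent.exists_isTangleOf hA
  exact ⟨(B, A), (isTangle_iff _).2 hB.flip, ha⟩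

/-- Two tops or two bottoms that meet are one component; a top never meets a bottom, by
`IsFree31.not_row_of_col`. -/
theorem IsTangle.eq_of_mem (hP : IsFree31 P) (hT : IsTangle T) (hT' : IsTangle T') {a : P}
    (h : a ∈ T.1 ∪ T.2) (h' : a ∈ T'.1 ∪ T'.2) : T = T' := by
  rw [isTangle_iff] at hT hT'
  have cross : ∀ {T T' : Set P × Set P}, IsTangleOf LT.lt T.1 T.2 → IsTangleOf LT.lt T'.1 T'.2 →
      a ∈ T.1 → a ∈ T'.2 → False := fun hT hT' h h' => by
    obtain ⟨b, -, hb⟩ := hT.col.exists_adj h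
    obtain ⟨c, -, hc⟩ := hT'.row.exists_adj h'
    exact hP.not_row_of_col hb hc
  rcases h with h | h <;> rcases h' with h' | h'
  · have h1 := hT.col.eq hT'.col h h'
    exact Prod.ext h1 (hT.row_unique (h1 ▸ hT'))
  · exact (cross hT hT' h h').elim
  · exact (cross hT' hT h' h).elim
  · have h1 := hT.row.eq hT'.row h h'
    exact Prod.ext (hT.col_unique (h1 ▸ hT')) h1

theorem PosetPart.exists_mem (a : P) : ∃ X : PosetPart P, a ∈ X.verts := by
  by_cases h : a ∈ outsideTangles P
  · exact ⟨.inl ⟨_, a, h, rfl⟩, h, rfl⟩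
  · simp only [outsideTangles, Set.mem_ofPred_eq, not_forall, not_not] at h
    obtain ⟨T, hT, ha⟩ := h
    exact ⟨.inr ⟨T, hT⟩, ha⟩

theorem PosetPart.nonempty (X : PosetPart P) : X.verts.Nonempty := by
  rcases X with ⟨_, a, ha, rfl⟩ | ⟨T, hT⟩
  · exact ⟨a, ha, rfl⟩
  · exact hT.1.1.nonempty.mono Set.subset_union_left

theorem PosetPart.eq_of_mem (hP : IsFree31 P) {X Y : PosetPart P} {a : P} (hX : a ∈ X.verts)
    (hY : a ∈ Y.verts) : X = Y := by
  rcases X with ⟨_, x, hx, rfl⟩ | ⟨T, hT⟩ <;> rcases Y with ⟨_, y, hy, rfl⟩ | ⟨T', hT'⟩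
  · have : view x = view y := hX.2.symm.trans hY.2
    congr 2
    simp only [this]
  · exact absurd hY (hX.1 T' hT')
  · exact absurd hX (hY.1 T hT)
  · have := hT.eq_of_mem hP hT' hX hY
    subst this
    rfl

theorem PosetPart.mem_of_colAdj (hP : IsFree31 P) {X : PosetPart P} {a b : P} (ha : a ∈ X.verts)
    (h : ColAdj LT.lt a b) : b ∈ X.verts := by
  obtain ⟨T, hT, haT⟩ := not_mem_outsideTangles_of_colAdj h
  rw [PosetPart.eq_of_mem hP (Y := .inr ⟨T, hT⟩) ha (.inl haT)]
  exact .inl (((isTangle_iff T).1 hT).col.closed a haT b h)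

theorem PosetPart.mem_of_rowAdj (hP : IsFree31 P) {X : PosetPart P} {a b : P} (ha : a ∈ X.verts)
    (h : ColAdj (flip LT.lt) a b) : b ∈ X.verts := by
  obtain ⟨T, hT, haT⟩ := not_mem_outsideTangles_of_rowAdj h
  rw [PosetPart.eq_of_mem hP (Y := .inr ⟨T, hT⟩) ha (.inr haT)]
  exact .inr (((isTangle_iff T).1 hT).row.closed a haT b h)

/-- If one of the vertices lies in a tangle, it has a neighbour in one of the two graphs. Adjacency
depends only on the view, so the other vertex has the same neighbour and lies in the same component.
-/
theorem PosetPart.mem_of_view_eq (hP : IsFree31 P) {X : PosetPart P} {a b : P} (ha : a ∈ X.verts)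
    (h : view a = view b) : b ∈ X.verts := by
  obtain ⟨h1, h2⟩ := view_eq_iff.1 h
  have key : ∀ {a b : P}, a ∈ X.verts → (∀ z, z < a ↔ z < b) → (∀ z, a < z ↔ b < z) →
      a ∉ outsideTangles P → b ∈ X.verts := by
    intro a b ha h1 h2 hO
    simp only [outsideTangles, Set.mem_ofPred_eq, not_forall, not_not] at hO
    obtain ⟨T, hT, haT⟩ := hO
    rcases haT with haT | haT
    · obtain ⟨c, -, hc⟩ := ((isTangle_iff T).1 hT).col.exists_adj haT
      have hc' : ColAdj LT.lt b c := by simpa only [ColAdj, h1] using hc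
      exact PosetPart.mem_of_colAdj hP (PosetPart.mem_of_colAdj hP ha hc) hc'.symm
    · obtain ⟨c, -, hc⟩ := ((isTangle_iff T).1 hT).row.exists_adj haT
      have hc' : ColAdj (flip LT.lt) b c := by simpa only [ColAdj, h2, flip] using hc
      exact PosetPart.mem_of_rowAdj hP (PosetPart.mem_of_rowAdj hP ha hc) hc'.symm
  by_cases hO : a ∈ outsideTangles P
  · by_cases hO' : b ∈ outsideTangles P
    · rw [PosetPart.eq_of_mem hP (Y := .inl ⟨_, a, hO, rfl⟩) ha ⟨hO, rfl⟩]
      exact ⟨hO', h.symm⟩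
    · obtain ⟨Y, hY⟩ := PosetPart.exists_mem b
      simp only [outsideTangles, Set.mem_ofPred_eq, not_forall, not_not] at hO'
      obtain ⟨T, hT, hbT⟩ := hO'
      exfalso
      rcases hbT with hbT | hbT
      · obtain ⟨c, -, hc⟩ := ((isTangle_iff T).1 hT).col.exists_adj hbT
        have hc' : ColAdj LT.lt a c := by simpa only [ColAdj, h1] using hc
        obtain ⟨T', hT', haT'⟩ := not_mem_outsideTangles_of_colAdj hc'
        exact hO T' hT' (.inl haT')
      · obtain ⟨c, -, hc⟩ := ((isTangle_iff T).1 hT).row.exists_adj hbT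
        have hc' : ColAdj (flip LT.lt) a c := by simpa only [ColAdj, h2, flip] using hc
        obtain ⟨T', hT', haT'⟩ := not_mem_outsideTangles_of_rowAdj hc'
        exact hO T' hT' (.inr haT')
  · exact key ha h1 h2 hO

/-- Vertices of a part on one level are related in the same way to the vertices outside. -/
theorem PosetPart.uniform [Finite P] (hP : IsFree31 P) {X : PosetPart P} {a b z : P}
    (ha : a ∈ X.verts) (hb : b ∈ X.verts) (hl : level a = level b) (hz : z ∉ X.verts) :
    (z < a ↔ z < b) ∧ (a < z ↔ b < z) := by
  rcases X with ⟨_, x, hx, rfl⟩ | ⟨T, hT⟩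
  · have h : view a = view b := ha.2.trans hb.2.symm
    exact ⟨(view_eq_iff.1 h).1 z, (view_eq_iff.1 h).2 z⟩
  · have hT' := (isTangle_iff T).1 hT
    rcases ha with ha | ha <;> rcases hb with hb | hb
    · refine ⟨⟨fun h => ?_, fun h => ?_⟩, hT.up_iff hP ha hb z⟩
      · by_contra h'
        exact hz (.inr (hT'.mem_row ha hb h h'))
      · by_contra h'
        exact hz (.inr (hT'.mem_row hb ha h h'))
    · have := hT.level_col_row hP ha hb; omega
    · have := hT.level_col_row hP hb ha; omega
    · refine ⟨hT.down_iff hP ha hb z, ⟨fun h => ?_, fun h => ?_⟩⟩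
      · by_contra h'
        exact hz (.inl (hT'.mem_col ha hb h h'))
      · by_contra h'
        exact hz (.inl (hT'.mem_col hb ha h h'))

/-- The view of `a` is at most the view of `b`. -/
def Prec (a b : P) : Prop := (∀ z, z < a → z < b) ∧ ∀ z, b < z → a < z

/-- As `a` and `b` are adjacent in neither graph, their downsets are comparable, and so are their
upsets. A strict inclusion of downsets forces the right inclusion of upsets, by `IsFree31.lt_of_lt`.
-/
theorem PosetPart.prec_total (hP : IsFree31 P) {X : PosetPart P} {a b : P} (ha : a ∈ X.verts)
    (hb : b ∉ X.verts) : Prec a b ∨ Prec b a := by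
  have h1 : ¬ ColAdj LT.lt a b := fun h => hb (PosetPart.mem_of_colAdj hP ha h)
  have h2 : ¬ ColAdj (flip LT.lt) a b := fun h => hb (PosetPart.mem_of_rowAdj hP ha h)
  simp only [ColAdj, flip, not_and_or, not_exists, ← imp_iff_not_or, not_not] at h1 h2
  by_cases h3 : ∃ c, c < a ∧ ¬ c < b
  · obtain ⟨c, h3, h4⟩ := h3
    exact .inr ⟨h1.resolve_left fun h => h4 (h c h3), fun z => hP.lt_of_lt h3 h4⟩
  · push Not at h3
    by_cases h4 : ∃ c, c < b ∧ ¬ c < a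
    · obtain ⟨c, h4, h5⟩ := h4
      exact .inl ⟨h3, fun z => hP.lt_of_lt h4 h5⟩
    · push Not at h4
      rcases h2 with h2 | h2
      · exact .inr ⟨h4, h2⟩
      · exact .inl ⟨h3, h2⟩

theorem PosetPart.exists_hasLetter [Finite P] (hP : IsFree31 P) (X : PosetPart P) :
    ∃ x, HasLetter X x := by
  rcases X with ⟨C, a, ha, rfl⟩ | ⟨T, hT⟩
  · exact ⟨.c (level a), .c _ _ fun b hb => level_eq_of_view_eq hb.2⟩
  · obtain ⟨c, hc⟩ := hT.2.1.1.nonempty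
    exact ⟨.t (level c), .t _ _ (fun a ha => hT.level_col_row hP ha hc)
      fun b hb => hT.level_row hP hb hc⟩

/-- The levels occupied by a letter. -/
def Letter.Occ : Letter → ℕ → Prop
  | .c i, l => l = i
  | .t i, l => l = i ∨ l = i + 1

theorem HasLetter.occ_iff {X : PosetPart P} {x : Letter} (h : HasLetter X x) (l : ℕ) :
    x.Occ l ↔ ∃ a ∈ X.verts, level a = l := by
  rcases h with ⟨C, i, h⟩ | ⟨T, i, hA, hB⟩
  · obtain ⟨a, ha⟩ := PosetPart.nonempty (.inl C)
    constructor
    · rintro rfl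
      exact ⟨a, ha, h a ha⟩
    · rintro ⟨b, hb, rfl⟩
      exact h b hb
  · obtain ⟨a, ha⟩ := T.2.1.1.nonempty
    obtain ⟨b, hb⟩ := T.2.2.1.1.nonempty
    constructor
    · rintro (rfl | rfl)
      · exact ⟨b, .inr hb, hB b hb⟩
      · exact ⟨a, .inl ha, hA a ha⟩
    · rintro ⟨b, hb | hb, rfl⟩
      · exact .inr (hA b hb)
      · exact .inl (hB b hb)

theorem HasLetter.unique {X : PosetPart P} {x y : Letter} (h : HasLetter X x)
    (h' : HasLetter X y) : x = y := by
  rcases h with ⟨C, i, h⟩ | ⟨T, i, hA, hB⟩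
  · obtain ⟨a, ha⟩ := PosetPart.nonempty (.inl C)
    rcases h' with ⟨_, j, h'⟩
    rw [← h a ha, ← h' a ha]
  · obtain ⟨b, hb⟩ := T.2.2.1.1.nonempty
    rcases h' with _ | ⟨_, j, hA', hB'⟩
    rw [← hB b hb, ← hB' b hb]

instance [Finite P] : Finite (PosetPart P) := by
  unfold PosetPart
  infer_instance

end Parts

end Structure

end ThreePlusOne
end
noncomputable section
namespace ThreePlusOne

/-! ### Existence of compatible listings -/

/-- Topological sorting: remove a source and recurse. -/
theorem exists_list_of_sources {α : Type*} (B : α → α → Prop)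
    (h : ∀ T : Finset α, T.Nonempty → ∃ x ∈ T, ∀ y ∈ T, ¬ B y x) (S : Finset α) :
    ∃ L : List α, L.Nodup ∧ (∀ x, x ∈ L ↔ x ∈ S) ∧ L.Pairwise fun x y => ¬ B y x := by
  classical
  induction S using Finset.strongInduction with
  | H S ih =>
    rcases S.eq_empty_or_nonempty with rfl | hS
    · exact ⟨[], by simp⟩
    · obtain ⟨x, hx, hB⟩ := h S hS
      obtain ⟨L, h1, h2, h3⟩ := ih (S.erase x) (Finset.erase_ssubset hx)
      refine ⟨x :: L, ?_, fun y => ?_, ?_⟩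
      · simp [h1, h2]
      · simp only [List.mem_cons, h2, Finset.mem_erase]
        by_cases hyx : y = x
        · simp [hyx, hx]
        · simp [hyx]
      · refine List.pairwise_cons.2 ⟨fun y hy => hB y ?_, h3⟩
        exact Finset.mem_of_mem_erase ((h2 y).1 hy)

section Listing

variable {P : Type*} [PartialOrder P]

/-- The part `X` has to precede the part `Y` in a compatible listing. -/
def Bef (X Y : PosetPart P) : Prop :=
  X ≠ Y ∧ ∃ a ∈ X.verts, ∃ b ∈ Y.verts,
    (level a + 1 = level b ∧ a < b) ∨ (level a = level b + 1 ∧ ¬ b < a)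

/-- `Bef` records the constraints between adjacent levels. Levels further apart impose none, because
`IsFree31.lt_of_level` settles the comparison. -/
theorem IsFree31.isCompatibleListing [Finite P] (hP : IsFree31 P) {L : List (PosetPart P)}
    (h1 : L.Nodup) (h2 : ∀ X, X ∈ L) (h3 : L.Pairwise fun X Y => ¬ Bef Y X) :
    IsCompatibleListing L := by
  refine ⟨h1, h2, fun i j hij a ha b hb => ?_⟩
  have hne : ∀ {i j : Fin L.length}, i ≠ j → L.get i ≠ L.get j := fun h h' =>
    h (List.nodup_iff_injective_get.1 h1 h')
  constructor
  · intro hab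
    have hl := level_lt_level hab
    by_cases hl' : level a + 2 ≤ level b
    · exact .inl hl'
    · refine .inr ⟨by omega, lt_of_not_ge fun h => ?_⟩
      exact List.pairwise_iff_get.1 h3 j i (lt_of_le_of_ne h hij.symm)
        ⟨hne hij, a, ha, b, hb, .inl ⟨by omega, hab⟩⟩
  · rintro (h | ⟨h, hlt⟩)
    · exact hP.lt_of_level h
    · by_contra hab
      exact List.pairwise_iff_get.1 h3 i j hlt ⟨hne hij.symm, b, hb, a, ha, .inr ⟨h.symm, hab⟩⟩

theorem PosetPart.exists_tangle [Finite P] (hP : IsFree31 P) {X : PosetPart P} {x y : P}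
    (hx : x ∈ X.verts) (hy : y ∈ X.verts) (hl : level x + 1 = level y) :
    ∃ T : {T : Set P × Set P // IsTangle T}, X = .inr T ∧ x ∈ T.1.2 ∧ y ∈ T.1.1 := by
  rcases X with ⟨_, z, hz, rfl⟩ | T
  · have := level_eq_of_view_eq (hx.2.trans hy.2.symm)
    omega
  · refine ⟨T, rfl, ?_⟩
    rcases hx with hx | hx <;> rcases hy with hy | hy
    · have := T.2.level_col hP hx hy; omega
    · have := T.2.level_col_row hP hx hy; omega
    · exact ⟨hx, hy⟩
    · have := T.2.level_row hP hx hy; omega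

theorem PosetPart.exists_below [Finite P] (hP : IsFree31 P) {X : PosetPart P} {x y : P}
    (hx : x ∈ X.verts) (hy : y ∈ X.verts) (hl : level x + 1 = level y) :
    ∃ x' ∈ X.verts, level x = level x' ∧ x' < y := by
  obtain ⟨T, rfl, hx, hy⟩ := PosetPart.exists_tangle hP hx hy hl
  obtain ⟨c, hc, h⟩ := ((isTangle_iff _).1 T.2).exists_rel hy
  exact ⟨c, .inr hc, T.2.level_row hP hx hc, h⟩

theorem PosetPart.exists_above [Finite P] (hP : IsFree31 P) {X : PosetPart P} {x y : P}
    (hx : x ∈ X.verts) (hy : y ∈ X.verts) (hl : level x + 1 = level y) :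
    ∃ y' ∈ X.verts, level y = level y' ∧ x < y' := by
  obtain ⟨T, rfl, hx, hy⟩ := PosetPart.exists_tangle hP hx hy hl
  obtain ⟨c, hc, h⟩ := ((isTangle_iff _).1 T.2).exists_rel' hx
  exact ⟨c, .inl hc, T.2.level_col hP hy hc, h⟩

theorem PosetPart.exists_not_above [Finite P] (hP : IsFree31 P) {X : PosetPart P} {x y : P}
    (hx : x ∈ X.verts) (hy : y ∈ X.verts) (hl : level x + 1 = level y) :
    ∃ y' ∈ X.verts, level y = level y' ∧ ¬ x < y' := by
  obtain ⟨T, rfl, hx, hy⟩ := PosetPart.exists_tangle hP hx hy hl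
  obtain ⟨c, hc, h⟩ := ((isTangle_iff _).1 T.2).exists_not_rel' hx
  exact ⟨c, .inl hc, T.2.level_col hP hy hc, h⟩

/-- Among the vertices of the parts in `T` on its level, `x` in the part `X` has the least view. -/
structure IsFirst (T : Finset (PosetPart P)) (X : PosetPart P) (x : P) : Prop where
  part_mem : X ∈ T
  mem : x ∈ X.verts
  prec : ∀ Z ∈ T, Z ≠ X → ∀ z ∈ Z.verts, level z = level x → Prec x z

theorem exists_isFirst [Finite P] (hP : IsFree31 P) {T : Finset (PosetPart P)} {Y : PosetPart P}
    {y : P} (hY : Y ∈ T) (hy : y ∈ Y.verts) : ∃ X x, level x = level y ∧ IsFirst T X x := by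
  -- The least sum of the two sizes makes the view minimal; a vertex whose view precedes that of `x`
  -- then has the same view.
  let f : P → ℕ := fun y => (Set.Iio y).ncard + (Set.Ioi y)ᶜ.ncard
  obtain ⟨x, ⟨⟨X, hX, hx⟩, hl⟩, hmin⟩ := Set.exists_min_image
    {x | (∃ X ∈ T, x ∈ X.verts) ∧ level x = level y} f (Set.toFinite _) ⟨y, ⟨Y, hY, hy⟩, rfl⟩
  refine ⟨X, x, hl, hX, hx, fun Z hZ hne z hz hzl => ?_⟩
  have hzX : z ∉ X.verts := fun h => hne (PosetPart.eq_of_mem hP hz h)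
  rcases PosetPart.prec_total hP hx hzX with h | h
  · exact h
  · have h1 : Set.Iio z ⊆ Set.Iio x := fun w hw => h.1 w hw
    have h2 : (Set.Ioi z)ᶜ ⊆ (Set.Ioi x)ᶜ := fun w hw hw' => hw (h.2 w hw')
    have h3 := Set.ncard_le_ncard h1
    have h4 := Set.ncard_le_ncard h2
    have h5 : f x ≤ f z := hmin z ⟨⟨Z, hZ, hz⟩, hzl.trans hl⟩
    simp only [f] at h5
    have h6 := Set.eq_of_subset_of_ncard_le h1 (by omega)
    have h7 := Set.eq_of_subset_of_ncard_le h2 (by omega)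
    refine ⟨fun w hw => ?_, fun w hw => by_contra fun hw' => ?_⟩
    · exact (Set.ext_iff.1 h6 w).2 hw
    · exact (Set.ext_iff.1 h7 w).2 hw' hw

/-- Some first vertex on level `i` precedes all vertices of the parts in `T` on the level below. -/
def IsGoodLevel (T : Finset (PosetPart P)) (i : ℕ) : Prop :=
  ∃ X x, IsFirst T X x ∧ level x = i ∧
    ∀ Z ∈ T, ∀ z ∈ Z.verts, level z + 1 = i → Z ≠ X ∧ ¬ z < x

/-- The first vertex `y` on the level of `b` is not above `x` either. A vertex `z` of another part
on the level of `x` has a view after that of `x`, so `z < y` would give `x < y`; for `z` in `X`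
uniformity serves. -/
theorem IsFirst.isGoodLevel [Finite P] (hP : IsFree31 P) {T : Finset (PosetPart P)}
    {X Y : PosetPart P} {x b : P} (hx : IsFirst T X x) (hY : Y ∈ T) (hb : b ∈ Y.verts)
    (hYX : Y ≠ X) (hl : level x + 1 = level b) (hxb : ¬ x < b) : IsGoodLevel T (level b) := by
  obtain ⟨Y', y, hyl, hy⟩ := exists_isFirst hP hY hb
  have hmem : ∀ {Z Z' : PosetPart P} {z : P}, z ∈ Z.verts → Z ≠ Z' → z ∉ Z'.verts :=
    fun hz hne hz' => hne (PosetPart.eq_of_mem hP hz hz')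
  have hxy : ¬ x < y ∧ Y' ≠ X := by
    by_cases hYY : Y' = Y
    · subst hYY
      exact ⟨fun h => hxb (((PosetPart.uniform hP hy.mem hb hyl) (hmem hx.mem hYX.symm)).1.1 h),
        hYX⟩
    · have hyb := hy.prec Y hY (Ne.symm hYY) b hb hyl.symm
      refine ⟨fun h => hxb (hyb.1 x h), ?_⟩
      rintro rfl
      obtain ⟨x', hx', hlx', hlt⟩ := PosetPart.exists_below hP hx.mem hy.mem (by omega)
      exact hxb ((PosetPart.uniform hP hx.mem hx' hlx' (hmem hb hYX)).2.2 (hyb.1 x' hlt))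
  refine ⟨Y', y, hy, hyl, fun Z hZ z hz hzl => ?_⟩
  by_cases hZX : Z = X
  · subst hZX
    exact ⟨hxy.2.symm, fun h => hxy.1
      ((PosetPart.uniform hP hx.mem hz (by omega) (hmem hy.mem hxy.2)).2.2 h)⟩
  · have hxz := hx.prec Z hZ hZX z hz (by omega)
    refine ⟨?_, fun h => hxy.1 (hxz.2 y h)⟩
    rintro rfl
    obtain ⟨y', hy', hly', hlt⟩ := PosetPart.exists_above hP hz hy.mem (by omega)
    exact hxy.1 ((PosetPart.uniform hP hy.mem hy' hly' (hmem hx.mem (Ne.symm hZX))).1.2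
      (hxz.2 y' hlt))

theorem exists_source [Finite P] (hP : IsFree31 P) (T : Finset (PosetPart P)) (hT : T.Nonempty) :
    ∃ X ∈ T, ∀ Y ∈ T, ¬ Bef Y X := by
  classical
  have hmem : ∀ {Z Z' : PosetPart P} {z : P}, z ∈ Z.verts → Z ≠ Z' → z ∉ Z'.verts :=
    fun hz hne hz' => hne (PosetPart.eq_of_mem hP hz hz')
  -- The source is the part of a first vertex on the highest good level. The lowest level occupied
  -- by `T` is good because nothing lies below it.
  obtain ⟨i, hi, hmax⟩ : ∃ i, IsGoodLevel T i ∧ ∀ j, IsGoodLevel T j → j ≤ i := by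
    have hfin : {i | IsGoodLevel T i}.Finite := (Set.finite_range (level : P → ℕ)).subset
      fun i ⟨_, x, _, h, _⟩ => ⟨x, h⟩
    have hne : {i | IsGoodLevel T i}.Nonempty := by
      obtain ⟨X, hX⟩ := hT
      obtain ⟨a, ha⟩ := X.nonempty
      obtain ⟨b, ⟨Y, hY, hb⟩, hmin⟩ := Set.exists_min_image {a | ∃ X ∈ T, a ∈ X.verts} level
        (Set.toFinite _) ⟨a, X, hX, ha⟩
      obtain ⟨Y, y, hl, hy⟩ := exists_isFirst hP hY hb
      refine ⟨level b, Y, y, hy, hl, fun Z hZ z hz h => ?_⟩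
      have := hmin z ⟨Z, hZ, hz⟩
      omega
    obtain ⟨i, hi, hmax⟩ := Set.exists_max_image _ id hfin hne
    exact ⟨i, hi, hmax⟩
  obtain ⟨X, x, hx, rfl, hlow⟩ := hi
  -- If `x` were not below `b`, the level above would be good as well, against maximality.
  have hup : ∀ Y ∈ T, Y ≠ X → ∀ b ∈ Y.verts, level x + 1 = level b → x < b := by
    intro Y hY hYX b hb hl
    by_contra hxb
    have := hmax _ (hx.isGoodLevel hP hY hb hYX hl hxb)
    omega
  refine ⟨X, hx.part_mem, fun Y hY ⟨hYX, b, hb, a, ha, hba⟩ => ?_⟩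
  have hbX := hmem hb hYX
  -- By goodness, no vertex of `X` lies on the level below `x`.
  have hla : level a = level x ∨ level x + 1 = level a := by
    obtain ⟨l, hl⟩ := X.exists_hasLetter hP
    have h1 := (hl.occ_iff _).2 ⟨a, ha, rfl⟩
    have h2 := (hl.occ_iff _).2 ⟨x, hx.mem, rfl⟩
    by_cases h3 : level a + 1 = level x
    · exact absurd rfl (hlow X hx.part_mem a ha h3).1
    · cases l <;> simp only [Letter.Occ] at h1 h2 <;> omega
  rcases hla with hla | hla
  · have hu := X.uniform hP ha hx.mem hla hbX
    rcases hba with ⟨hl, hba⟩ | ⟨hl, hba⟩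
    · exact (hlow Y hY b hb (by omega)).2 (hu.1.1 hba)
    · exact hba (hu.2.2 (hup Y hY hYX b hb (by omega)))
  -- Here `X` is a tangle with `x` in its bottom and `a` in its top, and `x` misses some top vertex
  -- `a'`. A vertex `b` on the level of `x` with `b < a` would be below `a'` by uniformity, and then
  -- so would `x`, whose view precedes that of `b`.
  · obtain ⟨a', ha', hla', hxa'⟩ := X.exists_not_above hP hx.mem ha hla
    rcases hba with ⟨hl, hba⟩ | ⟨hl, hba⟩
    · have h1 := hx.prec Y hY hYX b hb (by omega)
      exact hxa' (h1.2 a' ((X.uniform hP ha ha' hla' hbX).1.1 hba))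
    · obtain ⟨Y', y, hyl, hy⟩ := exists_isFirst hP hY hb
      have hYX' : Y' ≠ X := by
        rintro rfl
        obtain ⟨l, hl'⟩ := Y'.exists_hasLetter hP
        have h1 := (hl'.occ_iff _).2 ⟨y, hy.mem, rfl⟩
        have h2 := (hl'.occ_iff _).2 ⟨x, hx.mem, rfl⟩
        cases l <;> simp only [Letter.Occ] at h1 h2 <;> omega
      have hay : ¬ a < y := by
        by_cases hYY : Y' = Y
        · subst hYY
          exact fun h => hba ((Y'.uniform hP hy.mem hb hyl (hmem ha hYX.symm)).1.1 h)
        · exact fun h => hba ((hy.prec Y hY (Ne.symm hYY) b hb hyl.symm).1 a h)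
      -- Now `b` is one level above `a` and `¬ a < b`. A vertex `z` of another part on the level of
      -- `a` is above `x` while `a'` is not, so its view follows that of `a'`, and `z < y` would
      -- give `a < y`. A good level higher than the maximal one results.
      have hgood : IsGoodLevel T (level b) := by
        refine ⟨Y', y, hy, hyl, fun Z hZ z hz hzl => ?_⟩
        by_cases hZX : Z = X
        · subst hZX
          exact ⟨hYX'.symm, fun h => hay ((Z.uniform hP ha hz (by omega)
            (hmem hy.mem hYX')).2.2 h)⟩
        · have hxz := hup Z hZ hZX z hz (by omega)
          have hzX := hmem hz hZX
          have haz : Prec a' z := (X.prec_total hP ha' hzX).resolve_right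
            fun h => hxa' (h.1 x hxz)
          have hu := fun {w : P} (hw : w ∉ X.verts) => (X.uniform hP ha ha' hla' hw).2
          refine ⟨?_, fun h => hay ((hu (hmem hy.mem hYX')).2 (haz.2 y h))⟩
          rintro rfl
          obtain ⟨y', hy', hly', hlt⟩ := Z.exists_above hP hz hy.mem (by omega)
          exact hay ((Z.uniform hP hy.mem hy' hly' (hmem ha (Ne.symm hZX))).1.2
            ((hu (hmem hy' hZX)).2 (haz.2 y' hlt)))
      have := hmax _ hgood
      omega

theorem IsFree31.exists_isCompatibleListing [Finite P] (hP : IsFree31 P) :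
    ∃ L : List (PosetPart P), IsCompatibleListing L := by
  have : Fintype (PosetPart P) := Fintype.ofFinite _
  obtain ⟨L, h1, h2, h3⟩ := exists_list_of_sources Bef (exists_source hP) Finset.univ
  exact ⟨L, hP.isCompatibleListing h1 (fun X => (h2 X).2 (Finset.mem_univ X)) h3⟩

end Listing

end ThreePlusOne
end
noncomputable section
namespace ThreePlusOne

/-! ### Uniqueness of compatible listings -/

/-- The letters `x` and `y` stand for parts on equal or adjacent levels. -/
def Letter.Dep (x y : Letter) : Prop :=
  ∃ l l', x.Occ l ∧ y.Occ l' ∧ l ≤ l' + 1 ∧ l' ≤ l + 1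

theorem Letter.Dep.symm {x y : Letter} : x.Dep y → y.Dep x :=
  fun ⟨l, l', h1, h2, h3, h4⟩ => ⟨l', l, h2, h1, h4, h3⟩

theorem Letter.dep_self (x : Letter) : x.Dep x := by
  cases x with
  | c i => exact ⟨i, i, rfl, rfl, by omega⟩
  | t i => exact ⟨i, i, .inl rfl, .inl rfl, by omega⟩

/-- The numerical conditions in `LetterComm` say exactly that no two levels of the letters are equal
or adjacent. -/
theorem LetterComm.exists_not_dep {u v : FreeMonoid Letter} (h : LetterComm u v) :
    ∃ x y : Letter, u = FreeMonoid.of x * FreeMonoid.of y ∧ v = FreeMonoid.of y * FreeMonoid.of x ∧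
      ¬ x.Dep y := by
  rcases h with ⟨i, j, h⟩ | ⟨i, j, h⟩ | ⟨i, j, h⟩ <;>
  · refine ⟨_, _, rfl, rfl, ?_⟩
    rintro ⟨l, l', h1, h2, h3, h4⟩
    simp only [Letter.Occ] at h1 h2
    omega

theorem commute_of_not_dep {x y : Letter} (h : ¬ x.Dep y) :
    PresentedMonoid.of LetterComm x * PresentedMonoid.of LetterComm y =
      PresentedMonoid.of LetterComm y * PresentedMonoid.of LetterComm x := by
  have key : ∀ {u v}, LetterComm u v →
      PresentedMonoid.mk LetterComm u = PresentedMonoid.mk LetterComm v := fun h =>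
    Quotient.sound (ConGen.Rel.of _ _ h)
  have hd : ∀ l l', x.Occ l → y.Occ l' → l + 2 ≤ l' ∨ l' + 2 ≤ l := by
    intro l l' h1 h2
    by_contra hh
    exact h ⟨l, l', h1, h2, by omega, by omega⟩
  have e : ∀ a b : Letter, PresentedMonoid.of LetterComm a * PresentedMonoid.of LetterComm b =
    PresentedMonoid.mk LetterComm (FreeMonoid.of a * FreeMonoid.of b) := fun a b => rfl
  rw [e, e]
  rcases x with i | i <;> rcases y with j | j
  · exact key (.cc i j (hd i j rfl rfl))
  · have h1 := hd i j rfl (.inl rfl)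
    have h2 := hd i (j + 1) rfl (.inr rfl)
    exact key (.ct i j (by omega))
  · have h1 := hd i j (.inl rfl) rfl
    have h2 := hd (i + 1) j (.inr rfl) rfl
    exact (key (.ct j i (by omega))).symm
  · have h1 := hd i j (.inl rfl) (.inl rfl)
    have h2 := hd (i + 1) j (.inr rfl) (.inl rfl)
    have h3 := hd i (j + 1) (.inl rfl) (.inr rfl)
    exact key (.tt i j (by omega))

/-- The class of a word in the free partially commuting monoid. -/
def trace (w : List Letter) : TraceMonoid := PresentedMonoid.mk LetterComm (FreeMonoid.ofList w)

theorem trace_cons (x : Letter) (w : List Letter) :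
    trace (x :: w) = PresentedMonoid.of LetterComm x * trace w := by
  rw [trace, FreeMonoid.ofList_cons, map_mul]
  rfl

theorem trace_append_cons {x : Letter} {w w' : List Letter} (h : ∀ y ∈ w, ¬ x.Dep y) :
    trace (w ++ x :: w') = trace (x :: (w ++ w')) := by
  induction w with
  | nil => rfl
  | cons y w ih =>
    rw [List.cons_append, trace_cons, ih fun z hz => h z (List.mem_cons_of_mem y hz), trace_cons,
      ← mul_assoc, ← commute_of_not_dep (h y List.mem_cons_self), mul_assoc, ← trace_cons,
      ← trace_cons, List.cons_append]

/-- Bring the first element of `L` to the front of `L'`: it jumps only over elements with which it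
is inverted, and their letters commute with its own. -/
theorem trace_eq_of_perm {α : Type*} (f : α → Letter) {L L' : List α} (hp : L.Perm L')
    (hn : L.Nodup)
    (h : ∀ x y, [x, y].Sublist L → [y, x].Sublist L' → ¬ (f x).Dep (f y)) :
    trace (L.map f) = trace (L'.map f) := by
  induction L generalizing L' with
  | nil => rw [List.nil_perm.1 hp]
  | cons x L ih =>
    obtain ⟨A, B, rfl⟩ := List.append_of_mem (hp.subset List.mem_cons_self)
    have hp' : L.Perm (A ++ B) := (hp.trans List.perm_middle).cons_inv
    have hA : ∀ a ∈ A, ¬ (f x).Dep (f a) := by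
      intro a ha
      refine h x a ?_ ?_
      · simpa using hp'.symm.subset (List.mem_append_left B ha)
      · exact (List.Sublist.append (List.singleton_sublist.2 ha)
          (List.singleton_sublist.2 List.mem_cons_self) : ([a] ++ [x]).Sublist _)
    rw [List.map_append, List.map_cons, List.map_cons, trace_append_cons (by simpa using hA),
      trace_cons, trace_cons, ← List.map_append, ih hp' (List.nodup_cons.1 hn).2]
    exact fun a b h1 h2 => h a b (h1.cons _)
      (h2.trans (List.Sublist.append_left (List.sublist_cons_self _ _) _))

/-- Elements with equal letters are never inverted, so two heads with equal letters coincide. -/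
theorem eq_of_perm_of_map_eq {α : Type*} (f : α → Letter) {L L' : List α} (hp : L.Perm L')
    (hn : L.Nodup)
    (h : ∀ x y, [x, y].Sublist L → [y, x].Sublist L' → f x ≠ f y) (hf : L.map f = L'.map f) :
    L = L' := by
  induction L generalizing L' with
  | nil => rw [List.nil_perm.1 hp]
  | cons x L ih =>
    rcases L' with _ | ⟨y, L'⟩
    · simp at hf
    simp only [List.map_cons, List.cons.injEq] at hf
    have hxy : x = y := by
      by_contra hne
      refine h x y ?_ ?_ hf.1
      · have : y ∈ x :: L := hp.symm.subset List.mem_cons_self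
        simpa [Ne.symm hne] using this
      · have : x ∈ y :: L' := hp.subset List.mem_cons_self
        simpa [hne] using this
    subst hxy
    rw [ih hp.cons_inv (List.nodup_cons.1 hn).2 (fun a b h1 h2 => h a b (h1.cons _) (h2.cons _))
      hf.2]

section Uniqueness

variable {P : Type*} [PartialOrder P]

/-- Encodes a listing by numbers attached to the parts, so that two listings can be compared by
linear arithmetic. -/
theorem IsCompatibleListing.exists_pos {L : List (PosetPart P)} (h : IsCompatibleListing L) :
    ∃ pos : PosetPart P → ℕ, (∀ X Y, [X, Y].Sublist L → pos X < pos Y) ∧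
      (∀ X Y, X ≠ Y → pos X ≠ pos Y) ∧
      ∀ X Y, X ≠ Y → ∀ a ∈ X.verts, ∀ b ∈ Y.verts,
        (a < b ↔ level a + 2 ≤ level b ∨ (level a + 1 = level b ∧ pos X < pos Y)) := by
  classical
  have hlt : ∀ X, L.idxOf X < L.length := fun X => List.idxOf_lt_length_of_mem (h.complete X)
  have hget : ∀ X, L.get ⟨L.idxOf X, hlt X⟩ = X := fun X => List.idxOf_get (hlt X)
  have hinj : ∀ X Y, X ≠ Y → L.idxOf X ≠ L.idxOf Y := fun X Y hne e => hne <| by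
    rw [← hget X, ← hget Y]
    simp only [e]
  refine ⟨fun X => L.idxOf X, fun X Y hXY => ?_, hinj, fun X Y hne a ha b hb => ?_⟩
  · obtain ⟨f, hf⟩ := List.sublist_iff_exists_fin_orderEmbedding_get_eq.1 hXY
    have h0 := hf 0
    have h1 := hf 1
    have h01 : f 0 < f 1 := f.lt_iff_lt.2 (by simp)
    have hinj := List.nodup_iff_injective_get.1 h.nodup
    have e0 : (⟨L.idxOf X, hlt X⟩ : Fin _) = f 0 := hinj (by rw [hget]; exact h0)
    have e1 : (⟨L.idxOf Y, hlt Y⟩ : Fin _) = f 1 := hinj (by rw [hget]; exact h1)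
    rw [← e0, ← e1] at h01
    exact h01
  · have := h.compatible ⟨_, hlt X⟩ ⟨_, hlt Y⟩ (fun e => hinj X Y hne (Fin.ext_iff.1 e)) a
      (by rw [hget]; exact ha) b (by rw [hget]; exact hb)
    simpa using this

theorem IsCompatibleListing.pairwise {L : List (PosetPart P)} (h : IsCompatibleListing L) :
    L.Pairwise fun X Y => ¬ Bef Y X := by
  refine List.pairwise_iff_get.2 fun i j hij ⟨hne, b, hb, a, ha, hab⟩ => ?_
  have h1 := h.compatible i j hij.ne a ha b hb
  have h2 := h.compatible j i hij.ne' b hb a ha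
  have h3 := hij.not_gt
  rcases hab with ⟨hl, hab⟩ | ⟨hl, hab⟩
  · rcases h2.1 hab with h | h
    · omega
    · exact h3 h.2
  · exact hab (h1.2 (.inr ⟨hl.symm, hij⟩))

/-- Vertices of `X` and `Y` on adjacent levels would fix the order of the two parts, the same in
both listings. A tangle sharing a level with the other part provides such vertices, since it also
occupies a neighbouring level. There remain two clone sets on one level. -/
theorem IsFree31.not_dep_of_swap [Finite P] (hP : IsFree31 P) {L L' : List (PosetPart P)}
    (hL : IsCompatibleListing L) (hL' : IsCompatibleListing L') {X Y : PosetPart P}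
    (h : [X, Y].Sublist L) (h' : [Y, X].Sublist L') {x y : Letter} (hx : HasLetter X x)
    (hy : HasLetter Y y) : ¬ x.Dep y := by
  obtain ⟨p, hp1, hp2, hp3⟩ := hL.exists_pos
  obtain ⟨q, hq1, hq2, hq3⟩ := hL'.exists_pos
  have hpXY := hp1 X Y h
  have hqYX := hq1 Y X h'
  have hne : X ≠ Y := by rintro rfl; omega
  have adj : ∀ a ∈ X.verts, ∀ b ∈ Y.verts, level a + 1 ≠ level b ∧ level b + 1 ≠ level a := by
    intro a ha b hb
    have h1 := hp3 X Y hne a ha b hb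
    have h2 := hq3 X Y hne a ha b hb
    have h3 := hp3 Y X hne.symm b hb a ha
    have h4 := hq3 Y X hne.symm b hb a ha
    constructor <;> intro hl
    · have := h2.1 (h1.2 (.inr ⟨hl, hpXY⟩))
      omega
    · have := h3.1 (h4.2 (.inr ⟨hl, hqYX⟩))
      omega
  rintro ⟨l, l', h1, h2, h3, h4⟩
  have adj' : ∀ l l', x.Occ l → y.Occ l' → l + 1 ≠ l' ∧ l' + 1 ≠ l := by
    intro l l' h1 h2
    obtain ⟨a, ha, rfl⟩ := (hx.occ_iff l).1 h1
    obtain ⟨b, hb, rfl⟩ := (hy.occ_iff l').1 h2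
    exact adj a ha b hb
  have h5 := adj' l l' h1 h2
  obtain rfl : l = l' := by omega
  rcases hx with ⟨C, i, hi⟩ | ⟨T, i, hA, hB⟩
  · rcases hy with ⟨C', j, hj⟩ | ⟨T, j, hA', hB'⟩
    · simp only [Letter.Occ] at h1 h2
      subst h1
      subst h2
      obtain ⟨a, ha⟩ := PosetPart.nonempty (.inl C)
      obtain ⟨b, hb⟩ := PosetPart.nonempty (.inl C')
      have hla := hi a ha
      have hlb := hj b hb
      -- Distinct clone sets are told apart by some `z` on an adjacent level. Its comparisons with
      -- `a` and `b` show that its part `Z` separates `X` from `Y` in the same direction in both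
      -- listings.
      have hv : ¬ view a = view b := fun hv =>
        hne (PosetPart.eq_of_mem hP (PosetPart.mem_of_view_eq hP ha hv) hb)
      rw [view_eq_iff, not_and_or, not_forall, not_forall] at hv
      rcases hv with ⟨z, hz⟩ | ⟨z, hz⟩ <;> obtain ⟨Z, hZ⟩ := PosetPart.exists_mem z
      · have hzl : level z < l := by
          by_cases hza : z < a
          · have := level_lt_level hza; omega
          · have : z < b := by tauto
            have := level_lt_level this; omega
        have hZX : Z ≠ .inl C := by rintro rfl; have := hi z hZ; omega
        have hZY : Z ≠ .inl C' := by rintro rfl; have := hj z hZ; omega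
        rw [hp3 Z _ hZX z hZ a ha, hp3 Z _ hZY z hZ b hb] at hz
        have h1 := hp3 Z _ hZX z hZ a ha
        have h2 := hp3 Z _ hZY z hZ b hb
        have h3 := hq3 Z _ hZX z hZ a ha
        have h4 := hq3 Z _ hZY z hZ b hb
        have := hp2 _ _ hZX
        have := hp2 _ _ hZY
        have := hq2 _ _ hZX
        have := hq2 _ _ hZY
        rw [h1] at h3
        rw [h2] at h4
        omega
      · have hzl : l < level z := by
          by_cases hza : a < z
          · have := level_lt_level hza; omega
          · have : b < z := by tauto
            have := level_lt_level this; omega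
        have hZX : Z ≠ .inl C := by rintro rfl; have := hi z hZ; omega
        have hZY : Z ≠ .inl C' := by rintro rfl; have := hj z hZ; omega
        rw [hp3 _ Z hZX.symm a ha z hZ, hp3 _ Z hZY.symm b hb z hZ] at hz
        have h1 := hp3 _ Z hZX.symm a ha z hZ
        have h2 := hp3 _ Z hZY.symm b hb z hZ
        have h3 := hq3 _ Z hZX.symm a ha z hZ
        have h4 := hq3 _ Z hZY.symm b hb z hZ
        have := hp2 _ _ hZX
        have := hp2 _ _ hZY
        have := hq2 _ _ hZX
        have := hq2 _ _ hZY
        rw [h1] at h3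
        rw [h2] at h4
        omega
    · simp only [Letter.Occ] at h2 adj'
      have := adj' l j h1 (.inl rfl)
      have := adj' l (j + 1) h1 (.inr rfl)
      omega
  · simp only [Letter.Occ] at h1 adj'
    have := adj' i l (.inl rfl) h2
    have := adj' (i + 1) l (.inr rfl) h2
    omega

/-- The letter of a part. -/
def PosetPart.letter (X : PosetPart P) : Letter :=
  -- The default is never taken when the poset is finite and (3+1)-free.
  open Classical in if h : ∃ x, HasLetter X x then h.choose else .c 0

theorem IsFree31.hasLetter_letter [Finite P] (hP : IsFree31 P) (X : PosetPart P) :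
    HasLetter X X.letter := by
  have h := PosetPart.exists_hasLetter hP X
  rw [PosetPart.letter, dif_pos h]
  exact h.choose_spec

theorem IsFree31.forall₂_hasLetter_iff [Finite P] (hP : IsFree31 P) {L : List (PosetPart P)}
    {w : List Letter} : List.Forall₂ HasLetter L w ↔ L.map PosetPart.letter = w := by
  rw [← List.forall₂_eq_eq_eq, List.forall₂_map_left_iff]
  refine ⟨List.Forall₂.imp fun X x h => (hP.hasLetter_letter X).unique h,
    List.Forall₂.imp fun X x h => h ▸ hP.hasLetter_letter X⟩

theorem IsCompatibleListing.perm {L L' : List (PosetPart P)} (h : IsCompatibleListing L)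
    (h' : IsCompatibleListing L') : L.Perm L' :=
  (List.perm_ext_iff_of_nodup h.nodup h'.nodup).2 fun X =>
    iff_of_true (h.complete X) (h'.complete X)

theorem IsFree31.trace_unique [Finite P] (hP : IsFree31 P) {L L' : List (PosetPart P)}
    (h : IsCompatibleListing L) (h' : IsCompatibleListing L') :
    trace (L.map PosetPart.letter) = trace (L'.map PosetPart.letter) :=
  trace_eq_of_perm _ (h.perm h') h.nodup fun X Y h1 h2 =>
    hP.not_dep_of_swap h h' h1 h2 (hP.hasLetter_letter X) (hP.hasLetter_letter Y)

/-- Parts with dependent letters are never exchanged, and a letter depends on itself. So a poset has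
at most one listing per word, which is why automorphisms do not enter the count. -/
theorem IsFree31.listing_unique [Finite P] (hP : IsFree31 P) {L L' : List (PosetPart P)}
    (h : IsCompatibleListing L) (h' : IsCompatibleListing L')
    (hw : L.map PosetPart.letter = L'.map PosetPart.letter) : L = L' :=
  eq_of_perm_of_map_eq _ (h.perm h') h.nodup (fun X Y h1 h2 e =>
    hP.not_dep_of_swap h h' h1 h2 (hP.hasLetter_letter X) (e ▸ hP.hasLetter_letter Y)
      (Letter.dep_self _)) hw

theorem Bef.dep {X Y : PosetPart P} (h : Bef X Y) {x y : Letter} (hx : HasLetter X x)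
    (hy : HasLetter Y y) : x.Dep y := by
  obtain ⟨-, a, ha, b, hb, h⟩ := h
  refine ⟨_, _, (hx.occ_iff _).2 ⟨a, ha, rfl⟩, (hy.occ_iff _).2 ⟨b, hb, rfl⟩, ?_⟩
  omega

/-- Exchanging two neighbours with independent letters keeps a listing compatible, because `Bef`
forces dependence. Hence every word of the skeleton, in particular a chosen representative, comes
from a listing. -/
theorem IsFree31.exists_listing_of_trace_eq [Finite P] (hP : IsFree31 P) {w w' : List Letter}
    (h : trace w = trace w')
    (hL : ∃ L : List (PosetPart P), IsCompatibleListing L ∧ L.map PosetPart.letter = w) :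
    ∃ L : List (PosetPart P), IsCompatibleListing L ∧ L.map PosetPart.letter = w' := by
  let Q : List Letter → Prop := fun w =>
    ∃ L : List (PosetPart P), IsCompatibleListing L ∧ L.map PosetPart.letter = w
  have swap : ∀ (x y : Letter), ¬ x.Dep y → ∀ u v : List Letter,
      Q (u ++ ([x, y] ++ v)) → Q (u ++ ([y, x] ++ v)) := by
    rintro x y hxy u v ⟨L, hL, hw⟩
    obtain ⟨A, L', rfl, rfl, hw'⟩ := List.map_eq_append_iff.1 hw
    obtain ⟨M, B, rfl, hM, rfl⟩ := List.map_eq_append_iff.1 hw'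
    obtain ⟨X, M', rfl, rfl, hM'⟩ := List.map_eq_cons_iff.1 hM
    obtain ⟨Y, M'', rfl, rfl, hM''⟩ := List.map_eq_cons_iff.1 hM'
    rw [List.map_eq_nil_iff] at hM''
    subst hM''
    have hp : (A ++ ([X, Y] ++ B)).Perm (A ++ ([Y, X] ++ B)) :=
      ((List.Perm.swap Y X []).append_right B).append_left A
    refine ⟨A ++ ([Y, X] ++ B), hP.isCompatibleListing (hp.nodup_iff.1 hL.nodup)
      (fun Z => hp.subset (hL.complete Z)) ?_, by simp⟩
    have hpw := hL.pairwise
    have hXY : ¬ Bef X Y := fun h =>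
      hxy (h.dep (hP.hasLetter_letter X) (hP.hasLetter_letter Y))
    simp only [List.pairwise_append, List.pairwise_cons, List.mem_append, List.mem_cons,
      List.not_mem_nil, or_false, List.Pairwise.nil] at hpw ⊢
    grind
  -- The arbitrary contexts `u`, `v` are what the product case of the generated congruence needs.
  have main : ∀ w w' : FreeMonoid Letter, ConGen.Rel LetterComm w w' → ∀ u v : FreeMonoid Letter,
      Q (u * (w * v)).toList ↔ Q (u * (w' * v)).toList := by
    intro w w' hr
    induction hr with
    | of w w' h =>
      intro u v
      obtain ⟨x, y, rfl, rfl, hxy⟩ := h.exists_not_dep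
      exact ⟨swap x y hxy u.toList v.toList, swap y x (fun h => hxy h.symm) u.toList v.toList⟩
    | refl w => exact fun u v => Iff.rfl
    | symm _ ih => exact fun u v => (ih u v).symm
    | trans _ _ ih ih' => exact fun u v => (ih u v).trans (ih' u v)
    | mul _ _ ih ih' =>
      intro u v
      rw [mul_assoc, mul_assoc, ih, ← mul_assoc u, ih', mul_assoc u]
  have hr : ConGen.Rel LetterComm (FreeMonoid.ofList w) (FreeMonoid.ofList w') :=
    Quotient.exact h
  simpa [Q] using (main _ _ hr 1 1).1 (by simpa [Q] using hL)

end Uniqueness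

end ThreePlusOne
end
noncomputable section
namespace ThreePlusOne

/-! ### Blocks: letters with an isomorphism class of parts -/

theorem IsTangleGraph.tangled {i j : ℕ} {R : Bicoloured i j} (h : IsTangleGraph R) :
    Tangled R := by
  obtain ⟨P, _, _, -, T, hT, β, α, h⟩ := h
  exact BIso.tangled (BIso.symm ⟨β, α, h⟩) ((isTangle_iff T).1 hT).tangled

/-- Isomorphism of tangles with `p` bottom and `q` top vertices. -/
abbrev tangleSetoid (p q : ℕ) : Setoid {R : Bicoloured p q // IsTangleGraph R} :=
  (bicolouredSetoid p q).comap Subtype.val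

/-- Unlabelled tangles with `p` bottom and `q` top vertices. -/
abbrev TangleClass (p q : ℕ) : Type := Quotient (tangleSetoid p q)

/-- A clone set with `k + 1` vertices on level `i`, or an unlabelled tangle with its bottom on
level `i`. -/
inductive Block : Type
  | c (i k : ℕ)
  | t (i p q : ℕ) (τ : TangleClass p q)

namespace Block

def letter : Block → Letter
  | c i _ => .c i
  | t i _ _ _ => .t i

def size : Block → ℕ
  | c _ k => k + 1
  | t _ p q _ => p + q

/-- The vertices of a block. -/
def V : Block → Type
  | c _ k => Fin (k + 1)
  | t _ p q _ => Fin p ⊕ Fin q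

/-- The levels of the vertices of a block. -/
def lev : (b : Block) → b.V → ℕ
  | c i _, _ => i
  | t i _ _ _, u => Sum.elim (fun _ => i) (fun _ => i + 1) u

/-- The strict order on the vertices of a block. -/
def E : (b : Block) → b.V → b.V → Prop
  | c _ _, _, _ => False
  | t _ _ _ τ, u, v => ∃ x y, u = Sum.inl x ∧ v = Sum.inr y ∧ τ.out.1 x y

theorem lev_of_E {b : Block} {u v : b.V} (h : b.E u v) : b.lev u + 1 = b.lev v := by
  rcases b with ⟨i, k⟩ | ⟨i, p, q, τ⟩
  · exact h.elim
  · obtain ⟨x, y, rfl, rfl, -⟩ := h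
    rfl

instance (b : Block) : Finite b.V := by
  rcases b with ⟨i, k⟩ | ⟨i, p, q, τ⟩
  · exact inferInstanceAs (Finite (Fin (k + 1)))
  · exact inferInstanceAs (Finite (Fin p ⊕ Fin q))

theorem card_V (b : Block) : Nat.card b.V = b.size := by
  rcases b with ⟨i, k⟩ | ⟨i, p, q, τ⟩
  · exact Nat.card_fin (k + 1)
  · exact (Nat.card_sum (α := Fin p) (β := Fin q)).trans (by simp [size])

theorem tangled {p q : ℕ} (τ : TangleClass p q) : Tangled τ.out.1 := τ.out.2.tangled

theorem occ_iff (b : Block) (l : ℕ) : b.letter.Occ l ↔ ∃ u, b.lev u = l := by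
  rcases b with ⟨i, k⟩ | ⟨i, p, q, τ⟩
  · exact ⟨fun h => ⟨(0 : Fin (k + 1)), h.symm⟩, fun ⟨_, h⟩ => h.symm⟩
  · obtain ⟨x, -⟩ := (tangled τ).row.nontrivial.nonempty
    obtain ⟨y, -⟩ := (tangled τ).col.nontrivial.nonempty
    constructor
    · rintro (rfl | rfl)
      · exact ⟨Sum.inl x, rfl⟩
      · exact ⟨Sum.inr y, rfl⟩
    · rintro ⟨u | u, rfl⟩
      · exact .inl rfl
      · exact .inr rfl

end Block

/-- The part `X` is isomorphic to the block `b`. -/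
def HasBlock {P : Type*} [PartialOrder P] (X : PosetPart P) (b : Block) : Prop :=
  HasLetter X b.letter ∧ ∃ φ : b.V → P, Function.Injective φ ∧ Set.range φ = X.verts ∧
    (∀ u, level (φ u) = b.lev u) ∧ ∀ u v, φ u < φ v ↔ b.E u v

section HasBlock

variable {P : Type*} [PartialOrder P]

theorem HasBlock.size {X : PosetPart P} {b : Block} (h : HasBlock X b) :
    Nat.card X.verts = b.size := by
  obtain ⟨-, φ, h1, h2, -⟩ := h
  rw [← h2, ← b.card_V]
  exact (Nat.card_congr (Equiv.ofInjective φ h1)).symm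

/-- The tangle of a part that is isomorphic to a tangle block. -/
theorem HasBlock.exists_equiv {X : PosetPart P} {i p q : ℕ} {τ : TangleClass p q}
    (h : HasBlock X (.t i p q τ)) :
    ∃ (σ : Fin p ≃ {a // a ∈ X.verts ∧ level a = i})
      (ρ : Fin q ≃ {a // a ∈ X.verts ∧ level a = i + 1}),
      ∀ x y, τ.out.1 x y ↔ (σ x : P) < ρ y := by
  obtain ⟨-, φ, h1, h2, h3, h4⟩ := h
  have hl : ∀ x : Fin p, level (φ (Sum.inl x)) = i := fun x => h3 _
  have hr : ∀ x : Fin q, level (φ (Sum.inr x)) = i + 1 := fun x => h3 _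
  have hm : ∀ u, φ u ∈ X.verts := fun u => h2 ▸ ⟨u, rfl⟩
  refine ⟨Equiv.ofBijective (fun x => ⟨φ (Sum.inl x), hm _, hl x⟩) ⟨fun x y e => ?_, ?_⟩,
    Equiv.ofBijective (fun x => ⟨φ (Sum.inr x), hm _, hr x⟩) ⟨fun x y e => ?_, ?_⟩, fun x y => ?_⟩
  · exact Sum.inl_injective (h1 (Subtype.ext_iff.1 e))
  · rintro ⟨a, ha, hal⟩
    rw [← h2] at ha
    obtain ⟨u | u, rfl⟩ := ha
    · exact ⟨u, rfl⟩
    · have := hr u; omega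
  · exact Sum.inr_injective (h1 (Subtype.ext_iff.1 e))
  · rintro ⟨a, ha, hal⟩
    rw [← h2] at ha
    obtain ⟨u | u, rfl⟩ := ha
    · have := hl u; omega
    · exact ⟨u, rfl⟩
  · refine Iff.trans ?_ (h4 _ _).symm
    constructor
    · exact fun h => ⟨x, y, rfl, rfl, h⟩
    · rintro ⟨x', y', e, e', h⟩
      cases Sum.inl_injective e
      cases Sum.inr_injective e'
      exact h

/-- Letter and size determine a clone block. For a tangle block the two levels recover the colour
classes inside `P`, so the bicoloured graphs are isomorphic. -/
theorem HasBlock.unique {X : PosetPart P} {b b' : Block} (h : HasBlock X b)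
    (h' : HasBlock X b') : b = b' := by
  have hl := h.1.unique h'.1
  have hs := h.size.symm.trans h'.size
  rcases b with ⟨i, k⟩ | ⟨i, p, q, τ⟩ <;> rcases b' with ⟨j, k'⟩ | ⟨j, p', q', τ'⟩ <;>
    simp only [Block.letter, Letter.c.injEq, Letter.t.injEq, reduceCtorEq] at hl
  · subst hl
    simp only [Block.size] at hs
    rw [show k = k' by omega]
  · subst hl
    obtain ⟨σ, ρ, h1⟩ := h.exists_equiv
    obtain ⟨σ', ρ', h2⟩ := h'.exists_equiv
    have hp : p = p' := by simpa using Fintype.card_congr (σ.trans σ'.symm)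
    have hq : q = q' := by simpa using Fintype.card_congr (ρ.trans ρ'.symm)
    subst hp
    subst hq
    have : τ = τ' := by
      rw [← Quotient.out_eq τ, ← Quotient.out_eq τ']
      refine Quotient.sound ⟨σ.trans σ'.symm, ρ.trans ρ'.symm, fun x y => ?_⟩
      rw [h1, h2]
      simp
    rw [this]

end HasBlock

section Block

variable {P : Type} [PartialOrder P]

theorem IsFree31.exists_hasBlock [Finite P] (hP : IsFree31 P) (X : PosetPart P) :
    ∃ b, HasBlock X b := by
  have hX := hP.hasLetter_letter X
  have hne : ∀ {x y : P}, level x = level y → ¬ x < y := fun h h' => by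
    have := level_lt_level h'
    omega
  generalize X.letter = x at hX
  rcases hX with ⟨C, i, hi⟩ | ⟨T, i, hA, hB⟩
  · obtain ⟨k, hk⟩ : ∃ k, Nat.card C.1 = k + 1 := Nat.exists_eq_succ_of_ne_zero <|
      (Nat.card_pos_iff.2 ⟨(PosetPart.nonempty (.inl C)).to_subtype, inferInstance⟩).ne'
    let e : Fin (k + 1) ≃ C.1 := (Finite.equivFinOfCardEq hk).symm
    refine ⟨.c i k, .c C i hi, fun x => e x, fun x y h => e.injective (Subtype.ext h), ?_,
      fun u => hi _ (e u).2, fun u v => iff_of_false (hne ?_) id⟩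
    · ext a
      exact ⟨by rintro ⟨u, rfl⟩; exact (e u).2, fun ha => ⟨e.symm ⟨a, ha⟩, by simp⟩⟩
    · rw [hi _ (e u).2, hi _ (e v).2]
  · let β : Fin (Nat.card T.1.2) ≃ T.1.2 := (Finite.equivFin _).symm
    let α : Fin (Nat.card T.1.1) ≃ T.1.1 := (Finite.equivFin _).symm
    let R : Bicoloured (Nat.card T.1.2) (Nat.card T.1.1) := fun b a => (β b : P) < α a
    have hR : IsTangleGraph R := ⟨P, inferInstance, inferInstance, hP, T.1, T.2, β, α,
      fun _ _ => Iff.rfl⟩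
    obtain ⟨σ, ρ, h⟩ := Quotient.mk_out (s := tangleSetoid _ _) ⟨R, hR⟩
    let φ : Fin (Nat.card T.1.2) ⊕ Fin (Nat.card T.1.1) → P :=
      Sum.elim (fun x => β (σ x)) (fun y => α (ρ y))
    refine ⟨.t i _ _ (Quotient.mk _ ⟨R, hR⟩), .t T i hA hB, φ, ?_, ?_, ?_, ?_⟩
    · rintro (x | x) (y | y) e <;> simp only [φ, Sum.elim_inl, Sum.elim_inr] at e
      · rw [σ.injective (β.injective (Subtype.ext e))]
      · have h1 := hB _ (β (σ x)).2
        have h2 := hA _ (α (ρ y)).2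
        rw [e] at h1
        omega
      · have h1 := hA _ (α (ρ x)).2
        have h2 := hB _ (β (σ y)).2
        rw [e] at h1
        omega
      · rw [ρ.injective (α.injective (Subtype.ext e))]
    · ext a
      constructor
      · rintro ⟨x | x, rfl⟩
        · exact .inr (β (σ x)).2
        · exact .inl (α (ρ x)).2
      · rintro (ha | ha)
        · exact ⟨Sum.inr (ρ.symm (α.symm ⟨a, ha⟩)),
            congrArg Subtype.val (Equiv.apply_symm_apply (ρ.trans α) ⟨a, ha⟩)⟩
        · exact ⟨Sum.inl (σ.symm (β.symm ⟨a, ha⟩)),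
            congrArg Subtype.val (Equiv.apply_symm_apply (σ.trans β) ⟨a, ha⟩)⟩
    · rintro (x | x)
      · exact hB _ (β (σ x)).2
      · exact hA _ (α (ρ x)).2
    · rintro (x | x) (y | y)
      · refine iff_of_false (hne ?_) (by rintro ⟨_, _, _, e, _⟩; cases e)
        exact (hB _ (β (σ x)).2).trans (hB _ (β (σ y)).2).symm
      · refine Iff.trans (h x y).symm ⟨fun h => ⟨x, y, rfl, rfl, h⟩, ?_⟩
        rintro ⟨x', y', e, e', h⟩
        cases Sum.inl_injective e
        cases Sum.inr_injective e'
        exact h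
      · refine iff_of_false (fun h => ?_) (by rintro ⟨_, _, e, _⟩; cases e)
        have h1 := level_lt_level h
        have h2 : level (φ (Sum.inr x)) = i + 1 := hA _ (α (ρ x)).2
        have h3 : level (φ (Sum.inl y)) = i := hB _ (β (σ y)).2
        omega
      · refine iff_of_false (hne ?_) (by rintro ⟨_, _, e, _⟩; cases e)
        exact (hA _ (α (ρ x)).2).trans (hA _ (α (ρ y)).2).symm

/-- The block of a part. -/
def PosetPart.block (X : PosetPart P) : Block :=
  open Classical in if h : ∃ b, HasBlock X b then h.choose else .c 0 0

theorem IsFree31.hasBlock_block [Finite P] (hP : IsFree31 P) (X : PosetPart P) :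
    HasBlock X X.block := by
  have h := hP.exists_hasBlock X
  rw [PosetPart.block, dif_pos h]
  exact h.choose_spec

theorem IsFree31.letter_block [Finite P] (hP : IsFree31 P) (X : PosetPart P) :
    X.block.letter = X.letter :=
  (hP.hasBlock_block X).1.unique (hP.hasLetter_letter X)

/-- The blocks `l` are those of a compatible listing of `P`. -/
def Realizes (P : Type) [PartialOrder P] (l : List Block) : Prop :=
  ∃ L : List (PosetPart P), IsCompatibleListing L ∧ L.map PosetPart.block = l

/-- The parts partition the vertex set. -/
theorem IsFree31.sum_size [Finite P] (hP : IsFree31 P) {l : List Block} (h : Realizes P l) :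
    (l.map Block.size).sum = Nat.card P := by
  classical
  have : Fintype (PosetPart P) := Fintype.ofFinite _
  obtain ⟨L, hL, rfl⟩ := h
  let f : (Σ X : PosetPart P, X.verts) → P := fun x => x.2
  have hf : Function.Bijective f := by
    constructor
    · rintro ⟨X, a, ha⟩ ⟨Y, b, hb⟩ h
      simp only [f] at h
      subst h
      cases PosetPart.eq_of_mem hP ha hb
      rfl
    · intro a
      obtain ⟨X, hX⟩ := PosetPart.exists_mem a
      exact ⟨⟨X, a, hX⟩, rfl⟩
  rw [← Nat.card_congr (Equiv.ofBijective f hf), Nat.card_sigma, List.map_map]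
  have hu : L.toFinset = Finset.univ := by
    ext X
    simp [hL.complete X]
  rw [← hu, List.sum_toFinset _ hL.nodup]
  congr 1
  exact List.map_congr_left fun X _ => (hP.hasBlock_block X).size.symm

end Block

end ThreePlusOne
end
noncomputable section
namespace ThreePlusOne

/-! ### The poset of a list of blocks -/

/-- The vertices of a list of blocks. -/
@[ext]
structure Word (l : List Block) : Type where
  /-- the position of the block of the vertex -/
  pos : Fin l.length
  /-- the vertex of the block -/
  vert : (l.get pos).V

namespace Word

variable {l : List Block}

/-- The level of a vertex as determined by its block. -/
def lev (x : Word l) : ℕ := (l.get x.1).lev x.2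

/-- The strict order: vertices of different blocks are compared as in a compatible listing. -/
def Lt (x y : Word l) : Prop :=
  x.lev + 2 ≤ y.lev ∨ (x.lev + 1 = y.lev ∧
    (x.1 < y.1 ∨ ∃ i u v, x = ⟨i, u⟩ ∧ y = ⟨i, v⟩ ∧ (l.get i).E u v))

theorem Lt.lev_lt {x y : Word l} (h : Lt x y) : x.lev < y.lev := by
  rcases h with h | h <;> omega

instance : PartialOrder (Word l) where
  le x y := x = y ∨ Lt x y
  lt := Lt
  le_refl x := .inl rfl
  le_trans x y z := by
    rintro (rfl | h1) (rfl | h2)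
    · exact .inl rfl
    · exact .inr h2
    · exact .inr h1
    · have := h1.lev_lt
      have := h2.lev_lt
      exact .inr (.inl (by omega))
  le_antisymm x y := by
    rintro (rfl | h1) (h | h2)
    · rfl
    · rfl
    · exact h.symm
    · have := h1.lev_lt
      have := h2.lev_lt
      omega
  lt_iff_le_not_ge x y := by
    refine ⟨fun h => ⟨.inr h, ?_⟩, ?_⟩
    · rintro (rfl | h')
      · have := h.lev_lt
        omega
      · have := h.lev_lt
        have := h'.lev_lt
        omega
    · rintro ⟨rfl | h, h'⟩
      · exact (h' (.inl rfl)).elim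
      · exact h

theorem lt_def {x y : Word l} : x < y ↔ Lt x y := Iff.rfl

theorem lev_lt {x y : Word l} (h : x < y) : x.lev < y.lev := Lt.lev_lt h

instance : Finite (Word l) :=
  Finite.of_surjective (fun x : Σ i : Fin l.length, (l.get i).V => (⟨x.1, x.2⟩ : Word l))
    fun x => ⟨⟨x.1, x.2⟩, rfl⟩

theorem _root_.ThreePlusOne.Block.lev_le (b : Block) (u v : b.V) : b.lev v ≤ b.lev u + 1 := by
  rcases b with ⟨i, k⟩ | ⟨i, p, q, τ⟩
  · simp [Block.lev]
  · rcases u with u | u <;> rcases v with v | v <;>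
      simp only [Block.lev, Sum.elim_inl, Sum.elim_inr] <;> omega

theorem lt_iff_of_ne {x y : Word l} (h : x.1 ≠ y.1) :
    x < y ↔ x.lev + 2 ≤ y.lev ∨ (x.lev + 1 = y.lev ∧ x.1 < y.1) := by
  rw [lt_def, Lt]
  refine or_congr Iff.rfl (and_congr Iff.rfl (or_iff_left ?_))
  rintro ⟨i, u, v, rfl, rfl, -⟩
  exact h rfl

theorem mk_lt_mk {i : Fin l.length} {u v : (l.get i).V} :
    ((⟨i, u⟩ : Word l) < (⟨i, v⟩ : Word l)) ↔ (l.get i).E u v := by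
  constructor
  · rintro (h | ⟨-, h | ⟨j, u', v', e, e', h⟩⟩)
    · have := (l.get i).lev_le u v
      change (l.get i).lev u + 2 ≤ (l.get i).lev v at h
      omega
    · exact absurd h (lt_irrefl _)
    · cases e
      cases e'
      exact h
  · exact fun h => .inr ⟨Block.lev_of_E h, .inr ⟨i, u, v, rfl, rfl, h⟩⟩

theorem lev_le_of_eq {x y : Word l} (h : x.1 = y.1) : y.lev ≤ x.lev + 1 := by
  obtain ⟨i, u⟩ := x
  obtain ⟨j, v⟩ := y
  simp only at h
  subst h
  exact (l.get i).lev_le u v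

theorem lt_of_lev {x y : Word l} (h : x.lev + 2 ≤ y.lev) : x < y := .inl h

theorem fst_le_of_lt {x y : Word l} (h : x < y) (hl : x.lev + 1 = y.lev) : x.1 ≤ y.1 := by
  by_cases hne : x.1 = y.1
  · exact hne.le
  · rw [lt_iff_of_ne hne] at h
    rcases h with h | h
    · omega
    · exact h.2.le

theorem fst_le_of_not_lt {x y : Word l} (h : ¬ x < y) (hl : x.lev + 1 = y.lev) : y.1 ≤ x.1 := by
  by_contra hlt
  have hlt := not_le.1 hlt
  exact h ((lt_iff_of_ne hlt.ne).2 (.inr ⟨hl, hlt⟩))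

/-- In a forbidden configuration `a < b < c`, `d`, the vertices `a`, `b`, `c` lie on consecutive
levels and `d` lies on the level of `b`. The positions then satisfy `a ≤ b ≤ c ≤ d ≤ a`, so `a` and
`c` share a block, but a block spans at most two levels. -/
theorem isFree31 (l : List Block) : IsFree31 (Word l) := by
  rintro ⟨a, b, c, d, hab, hbc, hda, hdb, hdc⟩
  have h1 := lev_lt hab
  have h2 := lev_lt hbc
  have h3 : ¬ d.lev + 2 ≤ c.lev := fun h => hdc.1 (lt_of_lev h).le
  have h4 : ¬ a.lev + 2 ≤ d.lev := fun h => hda.2 (lt_of_lev h).le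
  have h5 := fst_le_of_not_lt (fun h => hda.2 h.le) (show a.lev + 1 = d.lev by omega)
  have h6 := fst_le_of_not_lt (fun h => hdc.1 h.le) (show d.lev + 1 = c.lev by omega)
  have h7 := fst_le_of_lt hab (by omega)
  have h8 := fst_le_of_lt hbc (by omega)
  have := lev_le_of_eq (show a.1 = c.1 from le_antisymm (h7.trans h8) (h6.trans h5))
  omega

end Word

/-- The embeddings of the blocks glue: within a block both orders are that of the block, across
blocks both follow the rule for compatible listings. -/
theorem IsFree31.nonempty_orderIso {P : Type} [PartialOrder P] [Finite P] (hP : IsFree31 P)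
    {l : List Block} (h : Realizes P l) : Nonempty (Word l ≃o P) := by
  obtain ⟨L, hL, rfl⟩ := h
  set l := L.map PosetPart.block with hl
  have hlen : l.length = L.length := by simp [hl]
  have hb : ∀ i : Fin l.length, HasBlock (L.get (i.cast hlen)) (l.get i) := by
    intro i
    have : l.get i = (L.get (i.cast hlen)).block := by simp [hl]
    rw [this]
    exact hP.hasBlock_block _
  choose φ h1 h2 h3 h4 using fun i => (hb i).2
  have hm : ∀ i u, φ i u ∈ (L.get (i.cast hlen)).verts := fun i u => h2 i ▸ ⟨u, rfl⟩
  let f : Word l → P := fun x => φ x.1 x.2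
  have hf : Function.Bijective f := by
    constructor
    · rintro ⟨i, u⟩ ⟨j, v⟩ h
      simp only [f] at h
      have e := PosetPart.eq_of_mem hP (hm i u) (h ▸ hm j v)
      have e' := List.nodup_iff_injective_get.1 hL.nodup e
      obtain rfl : i = j := by simpa [Fin.ext_iff] using e'
      rw [h1 i h]
    · intro a
      obtain ⟨X, hX⟩ := PosetPart.exists_mem a
      obtain ⟨j, rfl⟩ := List.mem_iff_get.1 (hL.complete X)
      have := h2 (j.cast hlen.symm)
      obtain ⟨u, hu⟩ : a ∈ Set.range (φ (j.cast hlen.symm)) := by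
        rw [this]
        exact hX
      exact ⟨⟨_, u⟩, hu⟩
  have hlt : ∀ x y, f x < f y ↔ x < y := by
    rintro ⟨i, u⟩ ⟨j, v⟩
    by_cases hij : i = j
    · subst hij
      rw [Word.mk_lt_mk]
      exact h4 i u v
    · rw [Word.lt_iff_of_ne hij]
      have := hL.compatible (i.cast hlen) (j.cast hlen) (by simpa [Fin.ext_iff] using hij)
        (φ i u) (hm i u) (φ j v) (hm j v)
      rw [h3, h3] at this
      exact this
  exact ⟨⟨Equiv.ofBijective f hf, fun {x y} => by
    simp only [Equiv.ofBijective_apply, le_iff_lt_or_eq, hlt, hf.1.eq_iff]⟩⟩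

/-! ### Realization of lists of blocks -/

/-- The level of a clone set letter, and the bottom level of a tangle letter. -/
def Letter.base : Letter → ℕ
  | .c i => i
  | .t i => i

theorem Letter.occ_base (x : Letter) : x.Occ x.base := by
  cases x
  · exact rfl
  · exact .inl rfl

theorem Letter.base_le {x : Letter} {i : ℕ} (h : x.Occ i) : x.base ≤ i := by
  cases x
  · exact h.ge
  · rcases h with rfl | rfl <;> simp [base]

/-- The words that occur as skeleta: every letter above level `0` is preceded by a letter on the
level below, and between two clone set letters on one level there is a letter on an adjacent
level. -/
structure IsSkeletonWord (w : List Letter) : Prop where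
  below : ∀ (p : ℕ) (x : Letter) (i : ℕ), w[p]? = some x → x.base = i + 1 →
    ∃ q < p, ∃ y, w[q]? = some y ∧ y.Occ i
  between : ∀ (p q i : ℕ), p < q → w[p]? = some (.c i) → w[q]? = some (.c i) →
    ∃ r y k, p < r ∧ r < q ∧ w[r]? = some y ∧ y.Occ k ∧ (k + 1 = i ∨ k = i + 1)

/-- For `below`, a vertex on a positive base level is above some vertex one level down, and
compatibility places the part of the latter earlier. For `between`, two clone sets on one level have
different views, and a vertex that tells them apart lies in a part listed between them. -/
theorem IsFree31.isSkeletonWord {P : Type*} [PartialOrder P] [Finite P] (hP : IsFree31 P)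
    {L : List (PosetPart P)} (hL : IsCompatibleListing L) :
    IsSkeletonWord (L.map PosetPart.letter) := by
  have compat : ∀ {p q : ℕ} {X Y : PosetPart P}, L[p]? = some X → L[q]? = some Y → X ≠ Y →
      ∀ a ∈ X.verts, ∀ b ∈ Y.verts,
        (a < b ↔ level a + 2 ≤ level b ∨ (level a + 1 = level b ∧ p < q)) := by
    intro p q X Y hX hY hne a ha b hb
    obtain ⟨hp, rfl⟩ := List.getElem?_eq_some_iff.1 hX
    obtain ⟨hq, rfl⟩ := List.getElem?_eq_some_iff.1 hY
    refine hL.compatible ⟨p, hp⟩ ⟨q, hq⟩ ?_ a ha b hb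
    intro e
    simp only [Fin.mk.injEq] at e
    subst e
    exact hne rfl
  have hletter := hP.hasLetter_letter
  have letter_at : ∀ {p : ℕ} {x : Letter}, (L.map PosetPart.letter)[p]? = some x →
      ∃ X, L[p]? = some X ∧ X.letter = x := by
    intro p x h
    simpa using h
  have index : ∀ Z : PosetPart P, ∃ r, L[r]? = some Z := fun Z =>
    List.mem_iff_getElem?.1 (hL.complete Z)
  constructor
  · intro p x i hx hb
    obtain ⟨X, hX, rfl⟩ := letter_at hx
    obtain ⟨a, ha, hal⟩ := ((hletter X).occ_iff _).1 (Letter.occ_base _)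
    obtain ⟨b, hba, hbl⟩ := exists_level_eq (a := a) (k := i) (by omega)
    obtain ⟨Y, hY⟩ := PosetPart.exists_mem b
    have hYX : Y ≠ X := by
      rintro rfl
      have := Letter.base_le (((hletter Y).occ_iff _).2 ⟨b, hY, rfl⟩)
      omega
    obtain ⟨q, hq⟩ := index Y
    refine ⟨q, ?_, Y.letter, by simp [hq], ((hletter Y).occ_iff _).2 ⟨b, hY, hbl⟩⟩
    rcases (compat hq hX hYX b hY a ha).1 hba with h | h
    · omega
    · exact h.2
  · intro p q i hpq hp hq
    obtain ⟨X, hX, hXl⟩ := letter_at hp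
    obtain ⟨Y, hY, hYl⟩ := letter_at hq
    have lX := hletter X
    have lY := hletter Y
    rw [hXl] at lX
    rw [hYl] at lY
    have hXi : ∀ a ∈ X.verts, level a = i := fun a ha => (lX.occ_iff _).2 ⟨a, ha, rfl⟩
    have hYi : ∀ a ∈ Y.verts, level a = i := fun a ha => (lY.occ_iff _).2 ⟨a, ha, rfl⟩
    obtain ⟨a, ha⟩ := X.nonempty
    obtain ⟨b, hb⟩ := Y.nonempty
    have hla := hXi a ha
    have hlb := hYi b hb
    have hne : X ≠ Y := by
      rintro rfl
      obtain ⟨h1, h2⟩ := List.getElem?_eq_some_iff.1 hX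
      obtain ⟨h3, h4⟩ := List.getElem?_eq_some_iff.1 hY
      have := (List.Nodup.getElem_inj_iff hL.nodup (hi := h1) (hj := h3)).1 (h2.trans h4.symm)
      omega
    have hv : ¬ view a = view b := fun hv =>
      hne (PosetPart.eq_of_mem hP (PosetPart.mem_of_view_eq hP ha hv) hb)
    rw [view_eq_iff, not_and_or, not_forall, not_forall] at hv
    rcases hv with ⟨z, hz⟩ | ⟨z, hz⟩ <;> obtain ⟨Z, hZ⟩ := PosetPart.exists_mem z <;>
      obtain ⟨r, hr⟩ := index Z
    · have hzl : level z < i := by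
        by_cases hza : z < a
        · have := level_lt_level hza; omega
        · have : z < b := by tauto
          have := level_lt_level this; omega
      have hZX : Z ≠ X := by rintro rfl; have := hXi z hZ; omega
      have hZY : Z ≠ Y := by rintro rfl; have := hYi z hZ; omega
      have hrp : r ≠ p := by rintro rfl; rw [hX] at hr; exact hZX (Option.some.inj hr).symm
      have hrq : r ≠ q := by rintro rfl; rw [hY] at hr; exact hZY (Option.some.inj hr).symm
      rw [compat hr hX hZX z hZ a ha, compat hr hY hZY z hZ b hb, hla, hlb] at hz
      exact ⟨r, Z.letter, level z, by omega, by omega, by simp [hr],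
        ((hletter Z).occ_iff _).2 ⟨z, hZ, rfl⟩, by omega⟩
    · have hzl : i < level z := by
        by_cases hza : a < z
        · have := level_lt_level hza; omega
        · have : b < z := by tauto
          have := level_lt_level this; omega
      have hZX : Z ≠ X := by rintro rfl; have := hXi z hZ; omega
      have hZY : Z ≠ Y := by rintro rfl; have := hYi z hZ; omega
      have hrp : r ≠ p := by rintro rfl; rw [hX] at hr; exact hZX (Option.some.inj hr).symm
      have hrq : r ≠ q := by rintro rfl; rw [hY] at hr; exact hZY (Option.some.inj hr).symm
      rw [compat hX hr hZX.symm a ha z hZ, compat hY hr hZY.symm b hb z hZ, hla, hlb] at hz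
      exact ⟨r, Z.letter, level z, by omega, by omega, by simp [hr],
        ((hletter Z).occ_iff _).2 ⟨z, hZ, rfl⟩, by omega⟩

theorem isBigComponent_range {V W P Q : Type*} {S : P → Q → Prop} {R : V → W → Prop} {f : V → P}
    {g : W → Q} (h : ∀ v w, R v w ↔ S (f v) (g w))
    (hR : IsBigComponent (ColAdj R) Set.univ)
    (hc : ∀ a ∈ Set.range g, ∀ b, ColAdj S a b → b ∈ Set.range g) :
    IsBigComponent (ColAdj S) (Set.range g) := by
  have key : ∀ a b, ColAdj R a b → ColAdj S (g a) (g b) := by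
    rintro a b ⟨⟨c, h1, h2⟩, d, h3, h4⟩
    rw [h] at h1 h2 h3 h4
    exact ⟨⟨_, h1, h2⟩, _, h3, h4⟩
  refine ⟨?_, hc, fun U hU hne hne' => ?_⟩
  · obtain ⟨a, -⟩ := hR.nontrivial.nonempty
    obtain ⟨b, -, hab⟩ := hR.exists_adj (Set.mem_univ a)
    exact ⟨g a, ⟨a, rfl⟩, g b, ⟨b, rfl⟩, (colGraph S).ne_of_adj (key a b hab)⟩
  · obtain ⟨_, hx⟩ := hne
    obtain ⟨x, rfl⟩ := hU hx
    obtain ⟨_, ⟨y, rfl⟩, hy⟩ := hne'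
    obtain ⟨a, ha, b, hb, hab⟩ := hR.cut (g ⁻¹' U) (Set.subset_univ _) ⟨x, hx⟩ ⟨y, trivial, hy⟩
    exact ⟨g a, ha, g b, ⟨⟨b, rfl⟩, hb.2⟩, key a b hab⟩

/-- Matching and cuts carry over from `R`; only the closure of the images under adjacency in `S` has
to be checked. -/
theorem Tangled.isTangleOf_range {V W P Q : Type*} {S : P → Q → Prop} {R : V → W → Prop}
    {f : V → P} {g : W → Q} (hR : Tangled R) (h : ∀ v w, R v w ↔ S (f v) (g w))
    (hg : ∀ a ∈ Set.range g, ∀ b, ColAdj S a b → b ∈ Set.range g)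
    (hf : ∀ a ∈ Set.range f, ∀ b, ColAdj (_root_.flip S) a b → b ∈ Set.range f) :
    IsTangleOf S (Set.range g) (Set.range f) := by
  refine ⟨isBigComponent_range h hR.col hg,
    isBigComponent_range (R := _root_.flip R) (fun w v => h v w) hR.row hf, ?_⟩
  obtain ⟨a, -, b, -, c, -, d, -, h1⟩ := hR.isMatch
  simp only [h] at h1
  exact ⟨g a, ⟨a, rfl⟩, g b, ⟨b, rfl⟩, f c, ⟨c, rfl⟩, f d, ⟨d, rfl⟩, h1⟩

theorem Block.exists_tangled {b : Block} {i : ℕ} (hb : b.letter = .t i) :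
    ∃ (p q : ℕ) (R : Bicoloured p q) (f : Fin p → b.V) (g : Fin q → b.V), Tangled R ∧
      (∀ x y, R x y ↔ b.E (f x) (g y)) ∧ Set.range f = {u | b.lev u = i} ∧
      Set.range g = {u | b.lev u = i + 1} := by
  rcases b with ⟨i, k⟩ | ⟨j, p, q, τ⟩
  · cases hb
  · cases hb
    refine ⟨p, q, τ.out.1, Sum.inl, Sum.inr, Block.tangled τ, fun x y => ?_, ?_, ?_⟩
    · constructor
      · exact fun h => ⟨x, y, rfl, rfl, h⟩
      · rintro ⟨x', y', e, e', h⟩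
        cases Sum.inl_injective e
        cases Sum.inr_injective e'
        exact h
    · ext u
      rcases u with u | u
      · exact iff_of_true ⟨u, rfl⟩ rfl
      · refine iff_of_false (by rintro ⟨v, h⟩; cases h) fun (h : i + 1 = i) => ?_
        omega
    · ext u
      rcases u with u | u
      · refine iff_of_false (by rintro ⟨v, h⟩; cases h) fun (h : i = i + 1) => ?_
        omega
      · exact iff_of_true ⟨u, rfl⟩ rfl

theorem Block.letter_of_E {b : Block} {u v : b.V} (h : b.E u v) : ∃ i, b.letter = .t i := by
  rcases b with ⟨i, k⟩ | ⟨i, p, q, τ⟩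
  · exact h.elim
  · exact ⟨i, rfl⟩

namespace Word

variable {l : List Block}

theorem letter_getElem? (i : Fin l.length) :
    (l.map Block.letter)[(i : ℕ)]? = some (l.get i).letter := by
  simp

theorem exists_of_getElem? {i : ℕ} {y : Letter} (h : (l.map Block.letter)[i]? = some y) {k : ℕ}
    (hk : y.Occ k) : ∃ z : Word l, (z.1 : ℕ) = i ∧ z.lev = k := by
  simp only [List.getElem?_map, Option.map_eq_some_iff] at h
  obtain ⟨b, hb, rfl⟩ := h
  obtain ⟨hi, rfl⟩ := List.getElem?_eq_some_iff.1 hb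
  obtain ⟨u, hu⟩ := (Block.occ_iff _ _).1 hk
  exact ⟨⟨⟨i, hi⟩, u⟩, rfl, hu⟩

/-- On the base level of a block this is the condition `below`; the only other vertices are tops of
tangles, which have a neighbour in the bottom. -/
theorem exists_lt (h : IsSkeletonWord (l.map Block.letter)) {x : Word l} {i : ℕ}
    (hx : x.lev = i + 1) : ∃ y < x, y.lev = i := by
  have hocc := (Block.occ_iff _ _).2 ⟨x.2, hx⟩
  by_cases hb : (l.get x.1).letter.base = i + 1
  · obtain ⟨q, hq, y, hy, hyo⟩ := h.below x.1 _ i (letter_getElem? x.1) hb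
    obtain ⟨z, rfl, hzl⟩ := exists_of_getElem? hy hyo
    have hlt : z.1 < x.1 := hq
    exact ⟨z, (lt_iff_of_ne hlt.ne).2 (.inr ⟨by omega, hlt⟩), hzl⟩
  · obtain ⟨p, u⟩ := x
    have hl : (l.get p).letter = .t i := by
      generalize (l.get p).letter = y at hocc hb
      cases y <;> simp only [Letter.Occ, Letter.base, Letter.t.injEq] at * <;> omega
    obtain ⟨_, _, R, f, g, hR, hE, hf, hg⟩ := Block.exists_tangled hl
    have hu : u ∈ Set.range g := by
      rw [hg]
      exact hx
    obtain ⟨y, rfl⟩ := hu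
    obtain ⟨c, -, hc⟩ := IsTangleOf.exists_rel hR (Set.mem_univ y)
    have hfc : f c ∈ Set.range f := ⟨c, rfl⟩
    rw [hf] at hfc
    exact ⟨⟨p, f c⟩, mk_lt_mk.2 ((hE c y).1 hc), hfc⟩

theorem level_eq (h : IsSkeletonWord (l.map Block.letter)) (x : Word l) : level x = x.lev := by
  induction hn : x.lev using Nat.strong_induction_on generalizing x with
  | _ n ih =>
    subst hn
    apply le_antisymm
    · by_contra! hlt
      obtain ⟨b, hb, hbl⟩ := exists_level_eq hlt
      have := lev_lt hb
      have := ih b.lev this b rfl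
      omega
    · rcases hx : x.lev with _ | i
      · exact Nat.zero_le _
      · obtain ⟨y, hy, hyl⟩ := exists_lt h hx
        have := ih y.lev (lev_lt hy) y rfl
        have := level_lt_level hy
        omega

theorem letter_of_lt {x y : Word l} (h : x < y) (he : x.1 = y.1) :
    ∃ i, (l.get x.1).letter = .t i := by
  obtain ⟨p, u⟩ := x
  obtain ⟨q, v⟩ := y
  simp only at he
  subst he
  exact Block.letter_of_E (mk_lt_mk.1 h)

/-- The positions along `c < x`, `¬ c < y`, `d < y`, `¬ d < x` form a cycle of inequalities, so all
four vertices share a block. Adjacency thus never leaves a block, and occurs only in tangle blocks.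
-/
theorem of_colAdj (h : IsSkeletonWord (l.map Block.letter)) {x y : Word l}
    (hxy : ColAdj LT.lt x y) : x.1 = y.1 ∧ x.lev = y.lev ∧ ∃ i, (l.get x.1).letter = .t i := by
  have hl := (isFree31 l).level_eq_of_colAdj hxy
  rw [level_eq h, level_eq h] at hl
  obtain ⟨⟨c, h1, h2⟩, d, h3, h4⟩ := hxy
  have l1 := lev_lt h1
  have l3 := lev_lt h3
  have l2 : ¬ c.lev + 2 ≤ y.lev := fun h => h2 (lt_of_lev h)
  have l4 : ¬ d.lev + 2 ≤ x.lev := fun h => h4 (lt_of_lev h)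
  have p1 := fst_le_of_lt h1 (by omega)
  have p2 := fst_le_of_not_lt h2 (by omega)
  have p3 := fst_le_of_lt h3 (by omega)
  have p4 := fst_le_of_not_lt h4 (by omega)
  have hxy : x.1 = y.1 := by omega
  have hcx : c.1 = x.1 := by omega
  exact ⟨hxy, hl, hcx ▸ letter_of_lt h1 hcx⟩

theorem of_rowAdj (h : IsSkeletonWord (l.map Block.letter)) {x y : Word l}
    (hxy : ColAdj (flip LT.lt) x y) :
    x.1 = y.1 ∧ x.lev = y.lev ∧ ∃ i, (l.get x.1).letter = .t i := by
  have hl := (isFree31 l).level_eq_of_rowAdj hxy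
  rw [level_eq h, level_eq h] at hl
  obtain ⟨⟨c, h1, h2⟩, d, h3, h4⟩ := hxy
  simp only [flip] at h1 h2 h3 h4
  have l1 := lev_lt h1
  have l3 := lev_lt h3
  have l2 : ¬ y.lev + 2 ≤ c.lev := fun h => h2 (lt_of_lev h)
  have l4 : ¬ x.lev + 2 ≤ d.lev := fun h => h4 (lt_of_lev h)
  have p1 := fst_le_of_lt h1 (by omega)
  have p2 := fst_le_of_not_lt h2 (by omega)
  have p3 := fst_le_of_lt h3 (by omega)
  have p4 := fst_le_of_not_lt h4 (by omega)
  exact ⟨by omega, hl, letter_of_lt h1 (by omega)⟩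

theorem isTangle (h : IsSkeletonWord (l.map Block.letter)) {p : Fin l.length} {i : ℕ}
    (hp : (l.get p).letter = .t i) :
    IsTangle ({x : Word l | x.1 = p ∧ x.lev = i + 1}, {x : Word l | x.1 = p ∧ x.lev = i}) := by
  obtain ⟨_, _, R, f, g, hR, hE, hf, hg⟩ := Block.exists_tangled hp
  have hrange : ∀ {n k : ℕ} (f : Fin n → (l.get p).V), Set.range f = {u | (l.get p).lev u = k} →
      Set.range (fun x => (⟨p, f x⟩ : Word l)) = {x | x.1 = p ∧ x.lev = k} := by
    intro n k f hf
    ext x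
    constructor
    · rintro ⟨y, rfl⟩
      have : f y ∈ Set.range f := ⟨y, rfl⟩
      rw [hf] at this
      exact ⟨rfl, this⟩
    · obtain ⟨q, u⟩ := x
      rintro ⟨e, hu⟩
      obtain rfl : p = q := e.symm
      have hu' : u ∈ Set.range f := by
        rw [hf]
        exact hu
      obtain ⟨y, rfl⟩ := hu'
      exact ⟨y, rfl⟩
  rw [isTangle_iff, ← hrange f hf, ← hrange g hg]
  refine Tangled.isTangleOf_range hR (fun v w => (hE v w).trans mk_lt_mk.symm) ?_ ?_
  · rw [hrange g hg]
    rintro a ⟨ha, hal⟩ b hab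
    obtain ⟨h1, h2, -⟩ := of_colAdj h hab
    exact ⟨h1.symm.trans ha, h2.symm.trans hal⟩
  · rw [hrange f hf]
    rintro a ⟨ha, hal⟩ b hab
    obtain ⟨h1, h2, -⟩ := of_rowAdj h hab
    exact ⟨h1.symm.trans ha, h2.symm.trans hal⟩

theorem mem_outsideTangles_iff (h : IsSkeletonWord (l.map Block.letter)) (x : Word l) :
    x ∈ outsideTangles (Word l) ↔ ∃ i, (l.get x.1).letter = .c i := by
  constructor
  · intro hx
    rcases hl : (l.get x.1).letter with i | i
    · exact ⟨i, rfl⟩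
    · have hocc := (Block.occ_iff _ _).2 ⟨x.2, rfl⟩
      rw [hl] at hocc
      refine absurd ?_ (hx _ (isTangle h hl))
      rcases hocc with h | h
      · exact .inr ⟨rfl, h⟩
      · exact .inl ⟨rfl, h⟩
  · rintro ⟨i, hi⟩ T hT hxT
    rw [isTangle_iff] at hT
    rcases hxT with hxT | hxT
    · obtain ⟨y, -, hxy⟩ := hT.col.exists_adj hxT
      obtain ⟨-, -, j, hj⟩ := of_colAdj h hxy
      rw [hi] at hj
      cases hj
    · obtain ⟨y, -, hxy⟩ := hT.row.exists_adj hxT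
      obtain ⟨-, -, j, hj⟩ := of_rowAdj h hxy
      rw [hi] at hj
      cases hj

theorem lev_eq_of_letter {x : Word l} {i : ℕ} (hx : (l.get x.1).letter = .c i) : x.lev = i := by
  have hocc := (Block.occ_iff _ _).2 ⟨x.2, rfl⟩
  rw [hx] at hocc
  exact hocc

/-- The condition `between` supplies a vertex on an adjacent level in a block strictly between the
two; it compares differently with `x` and `y`. -/
theorem view_ne (h : IsSkeletonWord (l.map Block.letter)) {x y : Word l} {i : ℕ}
    (hx : (l.get x.1).letter = .c i) (hy : (l.get y.1).letter = .c i) (hlt : x.1 < y.1) :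
    view x ≠ view y := by
  intro hv
  rw [view_eq_iff] at hv
  have hxl := lev_eq_of_letter hx
  have hyl := lev_eq_of_letter hy
  obtain ⟨r, a, k, h1, h2, h3, h4, h5⟩ := h.between x.1 y.1 i hlt
    (by rw [letter_getElem?, hx]) (by rw [letter_getElem?, hy])
  obtain ⟨z, rfl, hzl⟩ := exists_of_getElem? h3 h4
  have h1 : x.1 < z.1 := h1
  have h2 : z.1 < y.1 := h2
  have e1 := hv.1 z
  have e2 := hv.2 z
  rw [lt_iff_of_ne h1.ne', lt_iff_of_ne h2.ne] at e1
  rw [lt_iff_of_ne h1.ne, lt_iff_of_ne h2.ne'] at e2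
  omega

theorem isCloneSet (h : IsSkeletonWord (l.map Block.letter)) {p : Fin l.length} {i : ℕ}
    (hp : (l.get p).letter = .c i) : IsCloneSet {x : Word l | x.1 = p} := by
  obtain ⟨u, -⟩ := (Block.occ_iff _ _).1 (show (l.get p).letter.Occ i by rw [hp]; rfl)
  refine ⟨⟨p, u⟩, (mem_outsideTangles_iff h _).2 ⟨i, hp⟩, ?_⟩
  ext x
  constructor
  · rintro hxp
    have hxp : x.1 = p := hxp
    have hx : (l.get x.1).letter = .c i := hxp ▸ hp
    refine ⟨(mem_outsideTangles_iff h x).2 ⟨i, hx⟩, view_eq_iff.2 ?_⟩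
    have hl : x.lev = (⟨p, u⟩ : Word l).lev := by
      rw [lev_eq_of_letter hx, lev_eq_of_letter (x := ⟨p, u⟩) hp]
    have hno : ∀ {z y : Word l}, z < y → z.1 = y.1 → z.1 ≠ p := by
      intro z y hzy he hz
      obtain ⟨j, hj⟩ := letter_of_lt hzy he
      rw [hz, hp] at hj
      cases hj
    refine ⟨fun z => ?_, fun z => ?_⟩
    · by_cases hz : z.1 = p
      · exact iff_of_false (fun h => hno h (hz.trans hxp.symm) hz) fun h => hno h hz hz
      · rw [lt_iff_of_ne (by rwa [hxp]), lt_iff_of_ne (by exact hz), hl, hxp]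
    · by_cases hz : z.1 = p
      · exact iff_of_false (fun h => hno h (hxp.trans hz.symm) hxp)
          fun h => hno h hz.symm rfl
      · rw [lt_iff_of_ne (by rw [hxp]; exact Ne.symm hz), lt_iff_of_ne (by exact Ne.symm hz), hl,
          hxp]
  · rintro ⟨hx, hv⟩
    obtain ⟨j, hj⟩ := (mem_outsideTangles_iff h x).1 hx
    have hl := level_eq_of_view_eq hv
    rw [level_eq h, level_eq h, lev_eq_of_letter hj, lev_eq_of_letter (x := ⟨p, u⟩) hp] at hl
    subst hl
    rcases lt_trichotomy x.1 p with hlt | he | hlt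
    · exact absurd hv (view_ne h hj hp hlt)
    · exact he
    · exact absurd hv.symm (view_ne h (x := ⟨p, u⟩) hp hj hlt)

theorem exists_part (h : IsSkeletonWord (l.map Block.letter)) (p : Fin l.length) :
    ∃ X : PosetPart (Word l), X.verts = {x | x.1 = p} ∧ HasBlock X (l.get p) := by
  obtain ⟨X, hX, hl⟩ : ∃ X : PosetPart (Word l), X.verts = {x | x.1 = p} ∧
      HasLetter X (l.get p).letter := by
    rcases hl : (l.get p).letter with i | i
    · refine ⟨.inl ⟨_, isCloneSet h hl⟩, rfl, .c _ i ?_⟩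
      intro a ha
      have ha : p = a.pos := ha.symm
      rw [level_eq h, lev_eq_of_letter (ha ▸ hl)]
    · refine ⟨.inr ⟨_, isTangle h hl⟩, ?_, .t _ i ?_ ?_⟩
      · ext x
        constructor
        · rintro (h | h)
          · exact h.1
          · exact h.1
        · rintro rfl
          have hocc := (Block.occ_iff _ _).2 ⟨x.2, rfl⟩
          rw [hl] at hocc
          rcases hocc with h | h
          · exact .inr ⟨rfl, h⟩
          · exact .inl ⟨rfl, h⟩
      · rintro a ⟨-, ha⟩
        rw [level_eq h, ha]
      · rintro a ⟨-, ha⟩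
        rw [level_eq h, ha]
  refine ⟨X, hX, hl, fun u => ⟨p, u⟩, fun u v e => ?_, ?_, fun u => level_eq h _,
    fun u v => mk_lt_mk⟩
  · exact eq_of_heq (Word.mk.inj e).2
  · rw [hX]
    ext ⟨q, u⟩
    constructor
    · rintro ⟨v, e⟩
      exact (congrArg Word.pos e).symm
    · rintro rfl
      exact ⟨u, rfl⟩

/-- The vertex sets of the blocks are exactly the parts of `Word l`. The hypothesis concerns the
letters only, so sizes and tangle shapes are free. -/
theorem realizes (h : IsSkeletonWord (l.map Block.letter)) : Realizes (Word l) l := by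
  have hfree := isFree31 l
  choose F hF hB using exists_part h
  have hne : ∀ p, ∃ x : Word l, x.1 = p := fun p => by
    obtain ⟨x, hx⟩ := (F p).nonempty
    rw [hF] at hx
    exact ⟨x, hx⟩
  have hinj : Function.Injective F := by
    intro p q e
    obtain ⟨x, rfl⟩ := hne p
    have : x ∈ (F q).verts := by
      rw [← e, hF]
      rfl
    rwa [hF] at this
  refine ⟨List.ofFn F, ⟨List.nodup_ofFn.2 hinj, fun X => ?_, fun i j hij a ha b hb => ?_⟩, ?_⟩
  · obtain ⟨x, hx⟩ := X.nonempty
    rw [List.mem_ofFn]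
    refine ⟨x.1, PosetPart.eq_of_mem hfree (a := x) ?_ hx⟩
    rw [hF]
    rfl
  · rw [List.get_ofFn, hF] at ha hb
    have ha : a.1 = i.cast (by simp) := ha
    have hb : b.1 = j.cast (by simp) := hb
    rw [level_eq h, level_eq h, lt_iff_of_ne, ha, hb]
    · rfl
    · rw [ha, hb]
      simpa [Fin.ext_iff] using hij
  · rw [List.map_ofFn]
    have : PosetPart.block ∘ F = l.get :=
      funext fun p => (hfree.hasBlock_block (F p)).unique (hB p)
    rw [this]
    exact List.ofFn_get l

end Word

end ThreePlusOne
end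
noncomputable section
namespace ThreePlusOne

/-! ### Tangle graphs -/

/-- A bicoloured graph, seen as a poset with two levels. -/
inductive TwoLevel {V W : Type*} (R : V → W → Prop)
  | bot (v : V)
  | top (w : W)

namespace TwoLevel

variable {V W : Type*} {R : V → W → Prop}

/-- A bottom vertex is below the top vertices adjacent to it. -/
inductive Lt : TwoLevel R → TwoLevel R → Prop
  | mk (v : V) (w : W) (h : R v w) : Lt (bot v) (top w)

instance : PartialOrder (TwoLevel R) where
  le x y := x = y ∨ Lt x y
  lt := Lt
  le_refl x := .inl rfl
  le_trans x y z := by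
    rintro (rfl | h1) (rfl | h2)
    · exact .inl rfl
    · exact .inr h2
    · exact .inr h1
    · cases h1
      cases h2
  le_antisymm x y := by
    rintro (rfl | h1) (h | h2)
    · rfl
    · rfl
    · exact h.symm
    · cases h1
      cases h2
  lt_iff_le_not_ge x y := by
    refine ⟨fun h => ⟨.inr h, ?_⟩, ?_⟩
    · cases h
      rintro (h' | h') <;> cases h'
    · rintro ⟨rfl | h, h'⟩
      · exact (h' (.inl rfl)).elim
      · exact h

theorem isFree31 (R : V → W → Prop) : IsFree31 (TwoLevel R) := by
  rintro ⟨a, b, c, d, hab, hbc, -⟩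
  cases hab
  cases hbc

theorem lt_iff (v : V) (w : W) : (bot v : TwoLevel R) < top w ↔ R v w :=
  ⟨fun h => by cases h; assumption, .mk v w⟩

instance [Finite V] [Finite W] : Finite (TwoLevel R) :=
  Finite.of_surjective (Sum.elim bot top : V ⊕ W → TwoLevel R) fun x => by
    rcases x with v | w
    · exact ⟨.inl v, rfl⟩
    · exact ⟨.inr w, rfl⟩

theorem isTangle (hR : Tangled R) : IsTangle (Set.range (top : W → TwoLevel R), Set.range bot) := by
  rw [isTangle_iff]
  refine hR.isTangleOf_range (fun v w => (lt_iff v w).symm) ?_ ?_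
  · rintro a - b ⟨-, c, h, -⟩
    cases h
    exact ⟨_, rfl⟩
  · rintro a - b ⟨-, c, h, -⟩
    cases h
    exact ⟨_, rfl⟩

end TwoLevel

/-- A tangled bicoloured graph is the tangle of its own two-level poset, which has no chain of three
vertices. Tangles can therefore be counted among all bicoloured graphs. -/
theorem isTangleGraph_iff {p q : ℕ} (R : Bicoloured p q) : IsTangleGraph R ↔ Tangled R := by
  refine ⟨IsTangleGraph.tangled, fun h => ⟨TwoLevel R, inferInstance, inferInstance,
    TwoLevel.isFree31 R, _, TwoLevel.isTangle h, Equiv.ofInjective TwoLevel.bot ?_,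
    Equiv.ofInjective TwoLevel.top ?_, fun v w => (TwoLevel.lt_iff v w).symm⟩⟩
  · intro v v' h
    cases h
    rfl
  · intro v v' h
    cases h
    rfl

/-! ### Decomposition of bicoloured graphs -/

section Decomposition

variable {V W V₁ V₂ W₁ W₂ V₁' V₂' W₁' W₂' : Type*}

/-- The disjoint union of two bicoloured graphs, where the bottom vertices of the first are joined
to the top vertices of the second. -/
def sumRel (A : V₁ → W₁ → Prop) (H : V₂ → W₂ → Prop) : V₁ ⊕ V₂ → W₁ ⊕ W₂ → Prop
  | .inl v, .inl w => A v w
  | .inl _, .inr _ => True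
  | .inr _, .inl _ => False
  | .inr v, .inr w => H v w

theorem BIso.map_sumRel {A : V₁ → W₁ → Prop} {H : V₂ → W₂ → Prop} {A' : V₁' → W₁' → Prop}
    {H' : V₂' → W₂' → Prop} : BIso A A' → BIso H H' → BIso (sumRel A H) (sumRel A' H') := by
  rintro ⟨σ, τ, h⟩ ⟨σ', τ', h'⟩
  refine ⟨Equiv.sumCongr σ σ', Equiv.sumCongr τ τ', ?_⟩
  rintro (v | v) (w | w)
  · exact h v w
  · exact Iff.rfl
  · exact Iff.rfl
  · exact h' v w

/-- Interchange of the colours and complementation. -/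
def dual (R : V → W → Prop) : W → V → Prop := fun w v => ¬ R v w

theorem BIso.map_dual {R : V₁ → W₁ → Prop} {R' : V₂ → W₂ → Prop} :
    BIso R R' → BIso (dual R) (dual R') :=
  fun ⟨σ, τ, h⟩ => ⟨τ, σ, fun w v => not_congr (h v w)⟩

theorem dual_dual (R : V → W → Prop) : dual (dual R) = R := by
  ext v w
  exact not_not

theorem BIso.of_dual {R : V₁ → W₁ → Prop} {R' : V₂ → W₂ → Prop} (h : BIso (dual R) (dual R')) :
    BIso R R' := by
  simpa only [dual_dual] using BIso.map_dual h

/-- Duality respects ordered sums, exchanges bottom and top vertices and preserves tangles, which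
shortens the case analysis. -/
theorem dual_sumRel (A : V₁ → W₁ → Prop) (H : V₂ → W₂ → Prop) :
    dual (sumRel A H) = sumRel (dual A) (dual H) := by
  ext (v | v) (w | w) <;> simp [dual, sumRel]

/-- Complementation reverses inclusions, so incomparability is unchanged. -/
theorem colAdj_dual (R : V → W → Prop) : ColAdj (dual R) = ColAdj (flip R) := by
  ext a b
  simp only [ColAdj, dual, flip, not_not]
  constructor
  · rintro ⟨⟨c, h1, h2⟩, d, h3, h4⟩
    exact ⟨⟨d, h4, h3⟩, c, h2, h1⟩
  · rintro ⟨⟨c, h1, h2⟩, d, h3, h4⟩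
    exact ⟨⟨d, h4, h3⟩, c, h2, h1⟩

theorem Tangled.dual {R : V → W → Prop} (h : Tangled R) : Tangled (dual R) := by
  refine ⟨colAdj_dual R ▸ h.row, ?_, ?_⟩
  · have : ColAdj (_root_.flip (ThreePlusOne.dual R)) = ColAdj R := colAdj_dual (_root_.flip R)
    rw [this]
    exact h.col
  · obtain ⟨a, -, b, -, c, -, d, -, h1, h2, h3, h4⟩ := h.isMatch
    exact ⟨c, trivial, d, trivial, b, trivial, a, trivial, h3, h4, not_not.2 h2, not_not.2 h1⟩

/-- A single vertex of the first colour. -/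
def IsBotVertex (_ : V → W → Prop) : Prop := Nat.card V = 1 ∧ Nat.card W = 0

/-- A single vertex of the second colour. -/
def IsTopVertex (_ : V → W → Prop) : Prop := Nat.card V = 0 ∧ Nat.card W = 1

/-- A single vertex or a tangle. -/
def IsAtom (R : V → W → Prop) : Prop := IsBotVertex R ∨ IsTopVertex R ∨ Tangled R

theorem IsAtom.dual {R : V → W → Prop} : IsAtom R → IsAtom (dual R)
  | .inl h => .inr (.inl h.symm)
  | .inr (.inl h) => .inl h.symm
  | .inr (.inr h) => .inr (.inr h.dual)

theorem BIso.isAtom {R : V₁ → W₁ → Prop} {R' : V₂ → W₂ → Prop} (h : BIso R R') (hR : IsAtom R) :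
    IsAtom R' := by
  obtain ⟨σ, τ, -⟩ := id h
  rcases hR with hR | hR | hR
  · exact .inl ⟨Nat.card_congr σ ▸ hR.1, Nat.card_congr τ ▸ hR.2⟩
  · exact .inr (.inl ⟨Nat.card_congr σ ▸ hR.1, Nat.card_congr τ ▸ hR.2⟩)
  · exact .inr (.inr (h.tangled hR))

/-- The vertices of `S` are joined to all those outside `S'`, the vertices outside `S` to none
in `S'`. -/
def IsPrefix (G : V → W → Prop) (S : Set V) (S' : Set W) : Prop :=
  (∀ v ∈ S, ∀ w ∉ S', G v w) ∧ ∀ v ∉ S, ∀ w ∈ S', ¬ G v w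

theorem IsPrefix.biso {G : V → W → Prop} {S : Set V} {S' : Set W} (h : IsPrefix G S S') :
    BIso (sumRel (fun (v : S) (w : S') => G v w)
      (fun (v : (Sᶜ : Set V)) (w : (S'ᶜ : Set W)) => G v w)) G := by
  classical
  refine ⟨Equiv.Set.sumCompl S, Equiv.Set.sumCompl S', ?_⟩
  rintro (v | v) (w | w)
  · exact Iff.rfl
  · exact iff_of_true trivial (h.1 v v.2 w w.2)
  · exact iff_of_false id (h.2 v v.2 w w.2)
  · exact Iff.rfl

/-- A column of the prefix is contained in `Set.range f`, whereas a column outside contains it, so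
they are comparable. Rows are similar. -/
theorem IsPrefix.isTangleOf {G : V → W → Prop} {R : V₁ → W₁ → Prop} {f : V₁ → V} {g : W₁ → W}
    (h : IsPrefix G (Set.range f) (Set.range g)) (hR : Tangled R)
    (hfg : ∀ v w, R v w ↔ G (f v) (g w)) : IsTangleOf G (Set.range g) (Set.range f) := by
  refine hR.isTangleOf_range hfg ?_ ?_
  · rintro a ha b ⟨⟨c, h1, h2⟩, -⟩
    by_contra hb
    have hc : c ∈ Set.range f := by_contra fun hc => h.2 c hc a ha h1
    exact h2 (h.1 c hc b hb)
  · rintro a ha b ⟨-, c, h1, h2⟩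
    by_contra hb
    have hc : c ∉ Set.range g := fun hc => h.2 b hb c hc h1
    exact h2 (h.1 a ha c hc)

/-- Take a top vertex `a` of the second tangle and a bottom vertex `b` of the first. If each lay
outside the other tangle, one prefix condition would join them and the other would not. So the
components meet. -/
theorem IsTangleOf.eq_of_isPrefix {G : V → W → Prop} {A A' : Set W} {B B' : Set V}
    (h : IsTangleOf G A B) (h' : IsTangleOf G A' B') (hp : IsPrefix G B A)
    (hp' : IsPrefix G B' A') : A = A' ∧ B = B' := by
  obtain ⟨a, ha⟩ := h'.col.nontrivial.nonempty
  obtain ⟨b, hb⟩ := h.row.nontrivial.nonempty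
  by_cases haA : a ∈ A
  · have e := h.col.eq h'.col haA ha
    exact ⟨e, h.row_unique (e ▸ h')⟩
  · by_cases hbB : b ∈ B'
    · have e := h.row.eq h'.row hb hbB
      exact ⟨h.col_unique (e ▸ h'), e⟩
    · exact absurd (hp.1 b hb a haA) (hp'.2 b hbB a ha)

theorem exists_sumCongr (σ : V₁ ⊕ V₂ ≃ V₁' ⊕ V₂')
    (h : Set.range (σ.symm ∘ Sum.inl) = Set.range Sum.inl) :
    ∃ (σ₁ : V₁ ≃ V₁') (σ₂ : V₂ ≃ V₂'), (∀ v, σ (.inl v) = .inl (σ₁ v)) ∧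
      ∀ v, σ (.inr v) = .inr (σ₂ v) := by
  have h1 : ∀ v, ∃ v', σ (.inl v) = .inl v' := by
    intro v
    have : (.inl v : V₁ ⊕ V₂) ∈ Set.range (σ.symm ∘ Sum.inl) := h ▸ ⟨v, rfl⟩
    obtain ⟨v', hv'⟩ := this
    exact ⟨v', by rw [← hv']; simp⟩
  have h2 : ∀ v', ∃ v, σ (.inl v) = .inl v' := by
    intro v'
    have : σ.symm (.inl v') ∈ Set.range (Sum.inl : V₁ → V₁ ⊕ V₂) := h ▸ ⟨v', rfl⟩
    obtain ⟨v, hv⟩ := this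
    exact ⟨v, by rw [hv]; simp⟩
  have h3 : ∀ v, ∃ v', σ (.inr v) = .inr v' := by
    intro v
    rcases hv : σ (.inr v) with v' | v'
    · obtain ⟨u, hu⟩ := h2 v'
      exact absurd (σ.injective (hu.trans hv.symm)) (by simp)
    · exact ⟨v', rfl⟩
  have h4 : ∀ v', ∃ v, σ (.inr v) = .inr v' := by
    intro v'
    rcases hv : σ.symm (.inr v') with v | v
    · obtain ⟨u, hu⟩ := h1 v
      rw [Equiv.symm_apply_eq, hu] at hv
      cases hv
    · exact ⟨v, by rw [← hv]; simp⟩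
  choose f hf using h1
  choose g hg using h3
  refine ⟨Equiv.ofBijective f ⟨fun a b e => ?_, fun v' => ?_⟩,
    Equiv.ofBijective g ⟨fun a b e => ?_, fun v' => ?_⟩, hf, hg⟩
  · exact Sum.inl_injective (σ.injective ((hf a).trans ((congrArg _ e).trans (hf b).symm)))
  · obtain ⟨v, hv⟩ := h2 v'
    exact ⟨v, Sum.inl_injective ((hf v).symm.trans hv)⟩
  · exact Sum.inr_injective (σ.injective ((hg a).trans ((congrArg _ e).trans (hg b).symm)))
  · obtain ⟨v, hv⟩ := h4 v'
    exact ⟨v, Sum.inr_injective ((hg v).symm.trans hv)⟩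

theorem isPrefix_sumRel (A : V₁ → W₁ → Prop) (H : V₂ → W₂ → Prop) :
    IsPrefix (sumRel A H) (Set.range Sum.inl) (Set.range Sum.inl) := by
  constructor
  · rintro _ ⟨v, rfl⟩ (w | w) hw
    · exact absurd ⟨w, rfl⟩ hw
    · trivial
  · rintro (v | v) hv _ ⟨w, rfl⟩ h
    · exact hv ⟨v, rfl⟩
    · exact h

/-- Pulling back the second sum yields two tangles of one graph that are both prefixes; they
coincide, so the isomorphism splits. -/
theorem BIso.cancel_tangled {A : V₁ → W₁ → Prop} {H : V₂ → W₂ → Prop} {A' : V₁' → W₁' → Prop}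
    {H' : V₂' → W₂' → Prop} (hA : Tangled A) (hA' : Tangled A') :
    BIso (ThreePlusOne.sumRel A H) (ThreePlusOne.sumRel A' H') → BIso A A' ∧ BIso H H' := by
  rintro ⟨σ, τ, h⟩
  have hp := isPrefix_sumRel A H
  have hp' : IsPrefix (ThreePlusOne.sumRel A H) (Set.range (σ.symm ∘ Sum.inl))
      (Set.range (τ.symm ∘ Sum.inl)) := by
    have hmem : ∀ v, v ∈ Set.range (σ.symm ∘ (Sum.inl : V₁' → V₁' ⊕ V₂')) ↔
        σ v ∈ Set.range (Sum.inl : V₁' → V₁' ⊕ V₂') := fun v => by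
      simp only [Set.mem_range, Function.comp_apply, Equiv.symm_apply_eq]
    have hmem' : ∀ v, v ∈ Set.range (τ.symm ∘ (Sum.inl : W₁' → W₁' ⊕ W₂')) ↔
        τ v ∈ Set.range (Sum.inl : W₁' → W₁' ⊕ W₂') := fun v => by
      simp only [Set.mem_range, Function.comp_apply, Equiv.symm_apply_eq]
    simp only [IsPrefix, hmem, hmem', h]
    exact ⟨fun v hv w hw => (isPrefix_sumRel A' H').1 _ hv _ hw,
      fun v hv w hw => (isPrefix_sumRel A' H').2 _ hv _ hw⟩
  have t := hp.isTangleOf hA fun v w => Iff.rfl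
  have t' := hp'.isTangleOf hA' fun v w => by
    rw [h]
    simp [ThreePlusOne.sumRel]
  obtain ⟨e1, e2⟩ := t.eq_of_isPrefix t' hp hp'
  obtain ⟨σ₁, σ₂, hσ₁, hσ₂⟩ := exists_sumCongr σ e2.symm
  obtain ⟨τ₁, τ₂, hτ₁, hτ₂⟩ := exists_sumCongr τ e1.symm
  refine ⟨⟨σ₁, τ₁, fun v w => ?_⟩, ⟨σ₂, τ₂, fun v w => ?_⟩⟩
  · have := h (.inl v) (.inl w)
    rwa [hσ₁, hτ₁] at this
  · have := h (.inr v) (.inr w)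
    rwa [hσ₂, hτ₂] at this

/-- The bicoloured graph `H` with a vertex of the first colour added that is joined to all
others. -/
def addBot (H : V → W → Prop) : Option V → W → Prop
  | none, _ => True
  | some v, w => H v w

/-- The isomorphism may move the added vertex, but only to another vertex with a full row;
`Equiv.removeNone` redirects between full rows. -/
theorem BIso.of_addBot {H : V₁ → W₁ → Prop} {H' : V₂ → W₂ → Prop} :
    BIso (addBot H) (addBot H') → BIso H H' := by
  rintro ⟨σ, τ, h⟩
  refine ⟨Equiv.removeNone σ, τ, fun v w => ?_⟩
  have h1 := h (some v) w
  rcases hv : σ (some v) with _ | v'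
  · have h2 := h none w
    rw [← Equiv.removeNone_none σ hv] at h2
    rw [hv] at h1
    exact iff_of_true (h1.2 trivial) (h2.1 trivial)
  · have := Equiv.removeNone_some σ ⟨v', hv⟩
    rw [← this] at h1
    exact h1

theorem IsBotVertex.biso_addBot {A : V₁ → W₁ → Prop} (hA : IsBotVertex A) [Finite W₁]
    (H : V₂ → W₂ → Prop) : BIso (sumRel A H) (addBot H) := by
  obtain ⟨hV, hW⟩ := hA
  obtain ⟨⟨a⟩, -⟩ := (Nat.card_eq_one_iff_unique.1 hV).symm
  have : Subsingleton V₁ := (Nat.card_eq_one_iff_unique.1 hV).1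
  have : IsEmpty W₁ := (Nat.card_eq_zero.1 hW).resolve_right (not_infinite_iff_finite.2 ‹_›)
  refine ⟨⟨Sum.elim (fun _ => none) some, fun x => x.elim (.inl a) .inr, ?_, ?_⟩,
    Equiv.emptySum W₁ W₂, ?_⟩
  · rintro (v | v)
    · exact congrArg Sum.inl (Subsingleton.elim _ _)
    · rfl
  · rintro (_ | v) <;> rfl
  · rintro (v | v) (w | w)
    · exact isEmptyElim w
    · exact Iff.rfl
    · exact isEmptyElim w
    · exact Iff.rfl

/-- A bottom vertex joined to every top vertex can neither lie in a tangle nor come after a tangle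
or a top vertex. -/
theorem IsBotVertex.of_biso {A : V₁ → W₁ → Prop} {H : V₂ → W₂ → Prop} {A' : V₁' → W₁' → Prop}
    {H' : V₂' → W₂' → Prop} (hA : IsBotVertex A) (hA' : IsAtom A') [Finite V₁'] [Finite W₁]
    (h : BIso (sumRel A H) (sumRel A' H')) : IsBotVertex A' := by
  obtain ⟨v, hv⟩ : ∃ v, ∀ w, sumRel A' H' v w := by
    obtain ⟨σ, τ, h⟩ := (hA.biso_addBot H).symm.trans h
    exact ⟨σ none, fun w => by simpa using (h none (τ.symm w)).1 trivial⟩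
  rcases hA' with hA' | hA' | hA'
  · exact hA'
  · obtain ⟨w⟩ := (Nat.card_eq_one_iff_unique.1 hA'.2).2
    have : IsEmpty V₁' := (Nat.card_eq_zero.1 hA'.1).resolve_right (not_infinite_iff_finite.2 ‹_›)
    rcases v with v | v
    · exact isEmptyElim v
    · exact (hv (.inl w)).elim
  · rcases v with v | v
    · obtain ⟨w, -, hw⟩ := IsTangleOf.exists_not_rel' hA' (Set.mem_univ v)
      exact absurd (hv (.inl w)) hw
    · obtain ⟨w, -⟩ := hA'.col.nontrivial.nonempty
      exact (hv (.inl w)).elim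

theorem IsBotVertex.cancel {A : V₁ → W₁ → Prop} {H : V₂ → W₂ → Prop} {A' : V₁' → W₁' → Prop}
    {H' : V₂' → W₂' → Prop} (hA : IsBotVertex A) (hA' : IsAtom A') [Finite V₁'] [Finite W₁]
    [Finite W₁'] (h : BIso (sumRel A H) (sumRel A' H')) : BIso A A' ∧ BIso H H' := by
  have hB := hA.of_biso hA' h
  refine ⟨?_, ((hA.biso_addBot H).symm.trans (h.trans (hB.biso_addBot H'))).of_addBot⟩
  have : Finite V₁ := Nat.finite_of_card_ne_zero (by rw [hA.1]; simp)
  have : IsEmpty W₁ := (Nat.card_eq_zero.1 hA.2).resolve_right (not_infinite_iff_finite.2 ‹_›)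
  exact ⟨(Finite.equivFinOfCardEq hA.1).trans (Finite.equivFinOfCardEq hB.1).symm,
    (Finite.equivFinOfCardEq hA.2).trans (Finite.equivFinOfCardEq hB.2).symm,
    fun _ w => isEmptyElim w⟩

/-- Uniqueness of the first atom and of the rest. Bottom vertices are treated directly, top vertices
by duality, two tangles by `BIso.cancel_tangled`. -/
theorem IsAtom.cancel {A : V₁ → W₁ → Prop} {H : V₂ → W₂ → Prop} {A' : V₁' → W₁' → Prop}
    {H' : V₂' → W₂' → Prop} (hA : IsAtom A) (hA' : IsAtom A') [Finite V₁] [Finite V₁']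
    [Finite W₁] [Finite W₁'] (h : BIso (sumRel A H) (sumRel A' H')) :
    BIso A A' ∧ BIso H H' := by
  have hd : BIso (sumRel (ThreePlusOne.dual A) (ThreePlusOne.dual H))
      (sumRel (ThreePlusOne.dual A') (ThreePlusOne.dual H')) := by
    rw [← dual_sumRel, ← dual_sumRel]
    exact BIso.map_dual h
  have undual : BIso (ThreePlusOne.dual A) (ThreePlusOne.dual A') ∧
      BIso (ThreePlusOne.dual H) (ThreePlusOne.dual H') → BIso A A' ∧ BIso H H' :=
    fun h => ⟨h.1.of_dual, h.2.of_dual⟩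
  have key : IsBotVertex A → BIso A A' ∧ BIso H H' := fun hA => hA.cancel hA' h
  rcases id hA with hB | hB | hB
  · exact hB.cancel hA' h
  · exact undual (IsBotVertex.cancel hB.symm hA'.dual hd)
  · rcases id hA' with hB' | hB' | hB'
    · exact (hB'.cancel hA h.symm).imp BIso.symm BIso.symm
    · exact undual ((IsBotVertex.cancel hB'.symm hA.dual hd.symm).imp BIso.symm BIso.symm)
    · exact BIso.cancel_tangled hB hB' h

/-- If no single vertex splits off, a column of least size is incomparable to another one, so it
lies in the top of a tangle. By minimality, the columns outside this top contain those inside. -/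
theorem exists_isPrefix_isAtom [Finite V] [Finite W] (G : V → W → Prop)
    (hne : Nonempty V ∨ Nonempty W) :
    ∃ (S : Set V) (S' : Set W), IsPrefix G S S' ∧ IsAtom fun (v : S) (w : S') => G v w := by
  by_cases h1 : ∃ v, ∀ w, G v w
  · obtain ⟨v, hv⟩ := h1
    refine ⟨{v}, ∅, ⟨?_, fun _ _ w hw => hw.elim⟩, .inl ⟨by simp, by simp⟩⟩
    rintro _ rfl w -
    exact hv w
  by_cases h2 : ∃ w, ∀ v, ¬ G v w
  · obtain ⟨w, hw⟩ := h2
    refine ⟨∅, {w}, ⟨fun v hv => hv.elim, ?_⟩, .inr (.inl ⟨by simp, by simp⟩)⟩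
    rintro v - _ rfl
    exact hw v
  push Not at h1 h2
  have hW : (Set.univ : Set W).Nonempty := by
    rcases hne with ⟨⟨v⟩⟩ | ⟨⟨w⟩⟩
    · obtain ⟨w, -⟩ := h1 v
      exact ⟨w, trivial⟩
    · exact ⟨w, trivial⟩
  obtain ⟨a, -, ha⟩ := Set.exists_min_image Set.univ (fun w => {v | G v w}.ncard)
    (Set.toFinite _) hW
  have hmin : ∀ b, (∀ z, G z b → G z a) → ∀ z, G z a → G z b := by
    intro b hb z hz
    have : {v | G v b} = {v | G v a} :=
      Set.eq_of_subset_of_ncard_le (fun v hv => hb v hv) (ha b trivial)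
    exact (Set.ext_iff.1 this z).2 hz
  -- The column `a` has an element `v`, and `v` misses some column `w`. Minimality excludes that `w`
  -- is contained in `a`.
  obtain ⟨b, hab⟩ : ∃ b, ColAdj G a b := by
    by_contra! hno
    obtain ⟨v, hv⟩ := h2 a
    obtain ⟨w, hw⟩ := h1 v
    refine hno w ⟨⟨v, hv, hw⟩, ?_⟩
    by_contra! hsub
    exact hw (hmin w hsub v hv)
  obtain ⟨C, hC, haC⟩ := exists_isBigComponent (colGraph G) hab
  have hC : IsBigComponent (ColAdj G) C := hC
  have hbC := hC.closed a haC b hab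
  have hle : ∀ y ∉ C, ∀ x ∈ C, ∀ z, G z x → G z y := by
    intro y hy
    rcases hC.comparable hy with h | h
    · obtain ⟨⟨z, hz, hz'⟩, -⟩ := hab
      exact absurd (h b hbC z (hmin y (h a haC) z hz)) hz'
    · exact h
  obtain ⟨B, hB⟩ := hC.exists_isTangleOf
  -- A vertex of `B` has a neighbour in `C`, hence is joined to everything outside `C`. A vertex
  -- outside `B` does not split `C`; were it joined to a vertex of `C`, it would be joined to all of
  -- `C` and so to everything, against `h1`.
  refine ⟨B, C, ⟨fun v hv w hw => ?_, fun v hv w hw hG => ?_⟩, .inr (.inr hB.tangled)⟩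
  · obtain ⟨x, hx, hvx⟩ := hB.exists_rel' hv
    exact hle w hw x hx v hvx
  · obtain ⟨w', hw'⟩ := h1 v
    by_cases hwC : w' ∈ C
    · exact hv (hB.mem_row hw hwC hG hw')
    · exact hw' (hle w' hwC w hw v hG)

theorem exists_bicoloured [Finite V] [Finite W] (R : V → W → Prop) {p q : ℕ}
    (hV : Nat.card V = p) (hW : Nat.card W = q) : ∃ R' : Bicoloured p q, BIso R R' := by
  let σ := Finite.equivFinOfCardEq hV
  let τ := Finite.equivFinOfCardEq hW
  exact ⟨fun b a => R (σ.symm b) (τ.symm a), σ, τ, fun b a => by simp⟩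

end Decomposition

end ThreePlusOne
end
noncomputable section
namespace ThreePlusOne

/-! ### Counting bicoloured graphs -/

/-- Isomorphism classes can thus be matched by a relation, without constructing maps on quotients.
-/
theorem card_eq_of_rel {α β : Type*} (r : α → β → Prop) (h : ∀ a, ∃! b, r a b)
    (h' : ∀ b, ∃! a, r a b) : Nat.card α = Nat.card β := by
  choose f hf hf' using h
  refine Nat.card_eq_of_bijective f ⟨fun a a' e => ?_, fun b => ?_⟩
  · exact (h' (f a)).unique (hf a) (e ▸ hf a')
  · obtain ⟨a, ha, -⟩ := h' b
    exact ⟨a, (hf' a b ha).symm⟩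

/-- Isomorphism classes of bicoloured graphs. -/
abbrev BicolouredClass (p q : ℕ) : Type := Quotient (bicolouredSetoid p q)

/-- Isomorphism classes of bicoloured graphs with the property `φ`. -/
abbrev ClassOf {p q : ℕ} (φ : Bicoloured p q → Prop) : Type :=
  Quotient ((bicolouredSetoid p q).comap (Subtype.val : {R // φ R} → _))

instance (p q : ℕ) : Finite (BicolouredClass p q) := Quotient.finite _

instance {p q : ℕ} (φ : Bicoloured p q → Prop) : Finite (ClassOf φ) := Quotient.finite _

instance (p q : ℕ) : Finite (TangleClass p q) := Quotient.finite _

theorem biso_out {p q : ℕ} (R : Bicoloured p q) :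
    BIso (Quotient.mk (bicolouredSetoid p q) R).out R :=
  Quotient.mk_out (s := bicolouredSetoid p q) R

theorem biso_class_out {p q : ℕ} {φ : Bicoloured p q → Prop} (R : {R // φ R}) :
    BIso (Quotient.mk ((bicolouredSetoid p q).comap (Subtype.val : {R // φ R} → _)) R).out.1 R.1 :=
  Quotient.mk_out (s := (bicolouredSetoid p q).comap Subtype.val) R

theorem class_eq {p q : ℕ} {A B : BicolouredClass p q} (h : BIso A.out B.out) : A = B := by
  rw [← Quotient.out_eq A, ← Quotient.out_eq B]
  exact Quotient.sound h

theorem classOf_eq {p q : ℕ} {φ : Bicoloured p q → Prop} {A B : ClassOf φ}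
    (h : BIso A.out.1 B.out.1) : A = B := by
  rw [← Quotient.out_eq A, ← Quotient.out_eq B]
  exact Quotient.sound h

theorem exists_finsupp (a b : ℕ) : ∃ e : Fin 2 →₀ ℕ, e 0 = a ∧ e 1 = b :=
  ⟨Finsupp.equivFunOnFinite.symm ![a, b], rfl, rfl⟩

theorem finsupp_ext {d e : Fin 2 →₀ ℕ} (h0 : d 0 = e 0) (h1 : d 1 = e 1) : d = e :=
  Finsupp.ext (Fin.forall_fin_two.2 ⟨h0, h1⟩)

theorem BIso.card {V W V' W' : Type*} {R : V → W → Prop} {R' : V' → W' → Prop} (h : BIso R R') :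
    Nat.card V = Nat.card V' ∧ Nat.card W = Nat.card W' := by
  obtain ⟨σ, τ, -⟩ := h
  exact ⟨Nat.card_congr σ, Nat.card_congr τ⟩

/-- A nonempty graph is a first atom followed by a graph: existence by `exists_isPrefix_isAtom`,
uniqueness by `IsAtom.cancel`. -/
theorem card_bicolouredClass {d : Fin 2 →₀ ℕ} (hd : d ≠ 0) :
    Nat.card (BicolouredClass (d 0) (d 1)) = ∑ x ∈ Finset.HasAntidiagonal.antidiagonal d,
      Nat.card (ClassOf (p := x.1 0) (q := x.1 1) IsAtom) *
        Nat.card (BicolouredClass (x.2 0) (x.2 1)) := by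
  have e : ∑ x ∈ Finset.HasAntidiagonal.antidiagonal d,
      Nat.card (ClassOf (p := x.1 0) (q := x.1 1) IsAtom) *
      Nat.card (BicolouredClass (x.2 0) (x.2 1)) =
      Nat.card (Σ x : Finset.HasAntidiagonal.antidiagonal d,
        ClassOf (p := x.1.1 0) (q := x.1.1 1) IsAtom ×
        BicolouredClass (x.1.2 0) (x.1.2 1)) := by
    rw [Nat.card_sigma, ← Finset.sum_coe_sort]
    simp only [Nat.card_prod]
  rw [e]
  refine card_eq_of_rel (fun G x => BIso G.out (sumRel x.2.1.out.1 x.2.2.out)) (fun G => ?_) ?_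
  · apply existsUnique_of_exists_of_unique
    · have hne : Nonempty (Fin (d 0)) ∨ Nonempty (Fin (d 1)) := by
        rcases Nat.eq_zero_or_pos (d 0) with h0 | h0
        · rcases Nat.eq_zero_or_pos (d 1) with h1 | h1
          · exact absurd (finsupp_ext h0 h1) hd
          · exact .inr ⟨⟨0, h1⟩⟩
        · exact .inl ⟨⟨0, h0⟩⟩
      obtain ⟨S, S', hp, ha⟩ := exists_isPrefix_isAtom G.out hne
      obtain ⟨e, he0, he1⟩ := exists_finsupp (Nat.card S) (Nat.card S')
      obtain ⟨e', he0', he1'⟩ := exists_finsupp (Nat.card (Sᶜ : Set _)) (Nat.card (S'ᶜ : Set _))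
      obtain ⟨A, hA⟩ := exists_bicoloured (fun (v : S) (w : S') => G.out v w) he0.symm he1.symm
      obtain ⟨H, hH⟩ := exists_bicoloured
        (fun (v : (Sᶜ : Set _)) (w : (S'ᶜ : Set _)) => G.out v w) he0'.symm he1'.symm
      have hde : e + e' = d := by
        obtain ⟨h1, h2⟩ := hp.biso.card
        simp only [Nat.card_sum, Nat.card_fin] at h1 h2
        refine finsupp_ext ?_ ?_
        · rw [Finsupp.add_apply, he0, he0', h1]
        · rw [Finsupp.add_apply, he1, he1', h2]
      refine ⟨⟨⟨(e, e'), Finset.HasAntidiagonal.mem_antidiagonal.2 hde⟩,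
        Quotient.mk _ ⟨A, hA.isAtom ha⟩,
        Quotient.mk _ H⟩, hp.biso.symm.trans (BIso.map_sumRel ?_ ?_)⟩
      · exact hA.trans (biso_class_out ⟨A, hA.isAtom ha⟩).symm
      · exact hH.trans (biso_out H).symm
    · rintro ⟨⟨⟨e, e'⟩, he⟩, A, H⟩ ⟨⟨⟨f, f'⟩, hf⟩, B, K⟩ h h'
      obtain ⟨h1, h2⟩ := IsAtom.cancel A.out.2 B.out.2 (h.symm.trans h')
      have hef : e = f := finsupp_ext (by simpa using h1.card.1) (by simpa using h1.card.2)
      have hef' : e' = f' := finsupp_ext (by simpa using h2.card.1) (by simpa using h2.card.2)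
      subst hef
      subst hef'
      cases classOf_eq h1
      cases class_eq h2
      rfl
  · rintro ⟨⟨⟨e, e'⟩, he⟩, A, H⟩
    have he : e + e' = d := Finset.HasAntidiagonal.mem_antidiagonal.1 he
    apply existsUnique_of_exists_of_unique
    · obtain ⟨G, hG⟩ := exists_bicoloured (p := d 0) (q := d 1) (sumRel A.out.1 H.out)
        (by simp [← he]) (by simp [← he])
      exact ⟨Quotient.mk _ G, (biso_out G).trans hG.symm⟩
    · intro G G' h h'
      exact class_eq (h.trans h'.symm)

/-- A tangle has at least two vertices of each colour, so the three kinds of atoms never share a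
bidegree. -/
theorem card_classOf_isAtom (e : Fin 2 →₀ ℕ) :
    (Nat.card (ClassOf (p := e 0) (q := e 1) IsAtom) : ℚ) = MvPowerSeries.coeff e
      (MvPowerSeries.X 0 + MvPowerSeries.X 1 + tangleSeries : MvPowerSeries (Fin 2) ℚ) := by
  have hT : MvPowerSeries.coeff e tangleSeries = (Nat.card (TangleClass (e 0) (e 1)) : ℚ) := rfl
  rw [map_add, map_add, hT, MvPowerSeries.coeff_X, MvPowerSeries.coeff_X]
  have tang : ∀ {R : Bicoloured (e 0) (e 1)}, Tangled R → 2 ≤ e 0 ∧ 2 ≤ e 1 := by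
    intro R hR
    have h1 := Set.nontrivial_univ_iff.1 hR.row.nontrivial
    have h2 := Set.nontrivial_univ_iff.1 hR.col.nontrivial
    exact ⟨Fin.nontrivial_iff_two_le.1 h1, Fin.nontrivial_iff_two_le.1 h2⟩
  by_cases h : 2 ≤ e 0 ∧ 2 ≤ e 1
  · have h1 : e ≠ Finsupp.single 0 1 := by rintro rfl; simp at h
    have h2 : e ≠ Finsupp.single 1 1 := by rintro rfl; simp at h
    have h3 : (IsAtom : Bicoloured (e 0) (e 1) → Prop) = IsTangleGraph := by
      funext R
      rw [isTangleGraph_iff, eq_iff_iff, IsAtom, IsBotVertex, IsTopVertex]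
      simp only [Nat.card_fin]
      refine ⟨fun h' => ?_, fun h' => .inr (.inr h')⟩
      rcases h' with h' | h' | h'
      · omega
      · omega
      · exact h'
    rw [if_neg h1, if_neg h2, h3]
    simp
  · have h4 : IsEmpty (TangleClass (e 0) (e 1)) :=
      ⟨fun τ => h (tang τ.out.2.tangled)⟩
    rw [Nat.card_of_isEmpty (α := TangleClass (e 0) (e 1))]
    have h5 : ∀ R : Bicoloured (e 0) (e 1), IsAtom R ↔
        (e 0 = 1 ∧ e 1 = 0) ∨ (e 0 = 0 ∧ e 1 = 1) := by
      intro R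
      rw [IsAtom, IsBotVertex, IsTopVertex, Nat.card_fin, Nat.card_fin]
      refine or_congr Iff.rfl (or_iff_left fun hR => h (tang hR))
    have key : ∀ R : Bicoloured (e 0) (e 1), IsAtom R → e 0 = 0 ∨ e 1 = 0 →
        Nat.card (ClassOf (p := e 0) (q := e 1) IsAtom) = 1 := by
      intro R hR h0
      have : Subsingleton (Bicoloured (e 0) (e 1)) := by
        refine ⟨fun R R' => ?_⟩
        funext x y
        rcases h0 with h0 | h0
        · exact absurd x.2 (by omega)
        · exact absurd y.2 (by omega)
      exact Nat.card_eq_one_iff_unique.2 ⟨inferInstance, ⟨Quotient.mk _ ⟨R, hR⟩⟩⟩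
    by_cases h1 : e = Finsupp.single 0 1
    · have e0 : e 0 = 1 := by simp [h1]
      have e1 : e 1 = 0 := by simp [h1]
      have h2 : e ≠ Finsupp.single 1 1 := by intro h; simp [h] at e0
      rw [if_pos h1, if_neg h2, key (fun _ _ => True) ((h5 _).2 (.inl ⟨e0, e1⟩)) (.inr e1)]
      simp
    · by_cases h2 : e = Finsupp.single 1 1
      · have e0 : e 0 = 0 := by simp [h2]
        have e1 : e 1 = 1 := by simp [h2]
        rw [if_neg h1, if_pos h2, key (fun _ _ => True) ((h5 _).2 (.inr ⟨e0, e1⟩)) (.inl e0)]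
        simp
      · have : IsEmpty (ClassOf (p := e 0) (q := e 1) IsAtom) := by
          refine ⟨fun A => ?_⟩
          rcases (h5 _).1 A.out.2 with h | h
          · exact h1 (finsupp_ext (by simp [h.1]) (by simp [h.2]))
          · exact h2 (finsupp_ext (by simp [h.1]) (by simp [h.2]))
        rw [if_neg h1, if_neg h2, Nat.card_of_isEmpty]
        simp

theorem coeff_bicolouredSeries (d : Fin 2 →₀ ℕ) : MvPowerSeries.coeff d bicolouredSeries =
    (Nat.card (BicolouredClass (d 0) (d 1)) : ℚ) := rfl

theorem constantCoeff_bicolouredSeries : MvPowerSeries.constantCoeff bicolouredSeries = 1 := by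
  rw [← MvPowerSeries.coeff_zero_eq_constantCoeff_apply, coeff_bicolouredSeries]
  have : Subsingleton (Bicoloured ((0 : Fin 2 →₀ ℕ) 0) ((0 : Fin 2 →₀ ℕ) 1)) :=
    ⟨fun R R' => by funext x; exact Fin.elim0 x⟩
  have h : Nat.card (BicolouredClass ((0 : Fin 2 →₀ ℕ) 0) ((0 : Fin 2 →₀ ℕ) 1)) = 1 :=
    Nat.card_eq_one_iff_unique.2 ⟨inferInstance, ⟨Quotient.mk _ fun _ _ => True⟩⟩
  rw [h, Nat.cast_one]

theorem constantCoeff_tangleSeries : MvPowerSeries.constantCoeff tangleSeries = 0 := by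
  rw [← MvPowerSeries.coeff_zero_eq_constantCoeff_apply]
  have hT : MvPowerSeries.coeff 0 tangleSeries =
    (Nat.card (TangleClass ((0 : Fin 2 →₀ ℕ) 0) ((0 : Fin 2 →₀ ℕ) 1)) : ℚ) := rfl
  have : IsEmpty (TangleClass ((0 : Fin 2 →₀ ℕ) 0) ((0 : Fin 2 →₀ ℕ) 1)) := by
    refine ⟨fun τ => ?_⟩
    obtain ⟨x, -⟩ := (Block.tangled τ).row.nontrivial.nonempty
    exact Fin.elim0 x
  rw [hT, Nat.card_of_isEmpty, Nat.cast_zero]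

/-- Bicoloured graphs are sequences of single vertices and tangles. -/
theorem bicolouredSeries_eq : bicolouredSeries =
    1 + (MvPowerSeries.X 0 + MvPowerSeries.X 1 + tangleSeries) * bicolouredSeries := by
  ext d
  by_cases hd : d = 0
  · subst hd
    simp only [MvPowerSeries.coeff_zero_eq_constantCoeff_apply, map_add, map_mul, map_one,
      constantCoeff_bicolouredSeries, constantCoeff_tangleSeries, MvPowerSeries.constantCoeff_X]
    norm_num
  · rw [map_add, MvPowerSeries.coeff_one, if_neg hd, zero_add, MvPowerSeries.coeff_mul,
      coeff_bicolouredSeries, card_bicolouredClass hd, Nat.cast_sum]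
    refine Finset.sum_congr rfl fun x _ => ?_
    rw [Nat.cast_mul, card_classOf_isAtom, coeff_bicolouredSeries]

/-! ### Specialization to the diagonal -/

theorem hasSubst_pair {f g : PowerSeries ℚ} (h : CanSubst₂ f g) :
    MvPowerSeries.HasSubst (![f, g] : Fin 2 → MvPowerSeries Unit ℚ) :=
  MvPowerSeries.hasSubst_of_constantCoeff_zero (Fin.forall_fin_two.2 h)

theorem canSubst_X : CanSubst₂ PowerSeries.X PowerSeries.X :=
  ⟨PowerSeries.constantCoeff_X, PowerSeries.constantCoeff_X⟩

theorem diag_bicolouredSeries_eq : diag bicolouredSeries =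
    1 + (2 * PowerSeries.X + diag tangleSeries) * diag bicolouredSeries := by
  have hs := hasSubst_pair canSubst_X
  have h := congrArg (MvPowerSeries.substAlgHom (R := ℚ) hs) bicolouredSeries_eq
  simp only [map_add, map_mul, map_one, MvPowerSeries.substAlgHom_apply,
    MvPowerSeries.subst_X hs] at h
  rw [two_mul]
  exact h

theorem constantCoeff_diag_tangleSeries : PowerSeries.constantCoeff (diag tangleSeries) = 0 :=
  MvPowerSeries.constantCoeff_subst_eq_zero (hasSubst_pair canSubst_X)
    (Fin.forall_fin_two.2 canSubst_X) constantCoeff_tangleSeries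

theorem diag_tangleSeries_eq :
    diag tangleSeries = 1 - 2 * PowerSeries.X - (diag bicolouredSeries)⁻¹ := by
  -- The constant term is 1, so the inverse is a true one.
  have hne : PowerSeries.constantCoeff (diag bicolouredSeries) ≠ 0 := by
    have h := congrArg PowerSeries.constantCoeff diag_bicolouredSeries_eq
    simp only [map_add, map_mul, map_one, PowerSeries.constantCoeff_X,
      constantCoeff_diag_tangleSeries, mul_zero, add_zero, zero_mul] at h
    rw [h]
    exact one_ne_zero
  have h := diag_bicolouredSeries_eq
  have h1 : (1 - 2 * PowerSeries.X - diag tangleSeries) * diag bicolouredSeries = 1 := by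
    linear_combination h
  rw [← (PowerSeries.eq_inv_iff_mul_eq_one hne).2 h1]
  ring

end ThreePlusOne
end
noncomputable section
namespace ThreePlusOne

/-! ### Invariance under isomorphism -/

section Transport

variable {P P' : Type} [PartialOrder P] [PartialOrder P']

theorem IsFree31.of_orderIso (hP : IsFree31 P) (e : P ≃o P') : IsFree31 P' := by
  rintro ⟨a, b, c, d, h1, h2, h3, h4, h5⟩
  refine hP ⟨e.symm a, e.symm b, e.symm c, e.symm d, by simpa, by simpa, ?_, ?_, ?_⟩ <;>
    simpa [IncompRel]

theorem level_orderIso (e : P ≃o P') (a : P) : level (e a) = level a := by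
  rw [level, level, Order.height_orderIso]

theorem IsBigComponent.image {α β : Type*} {adj : α → α → Prop} {adj' : β → β → Prop} (e : α ≃ β)
    (he : ∀ a b, adj a b ↔ adj' (e a) (e b)) {A : Set α} (h : IsBigComponent adj A) :
    IsBigComponent adj' (e '' A) := by
  refine ⟨h.nontrivial.image e.injective, ?_, fun U hU hne hne' => ?_⟩
  · rintro _ ⟨a, ha, rfl⟩ b hab
    obtain ⟨b, rfl⟩ := e.surjective b
    exact ⟨b, h.closed a ha b ((he a b).2 hab), rfl⟩
  · obtain ⟨_, hx⟩ := hne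
    obtain ⟨x, hxA, rfl⟩ := hU hx
    obtain ⟨_, ⟨y, hyA, rfl⟩, hy⟩ := hne'
    obtain ⟨a, ha, b, hb, hab⟩ := h.cut {a ∈ A | e a ∈ U} (fun a ha => ha.1) ⟨x, hxA, hx⟩
      ⟨y, hyA, fun h => hy h.2⟩
    exact ⟨e a, ha.2, e b, ⟨⟨b, hb.1, rfl⟩, fun h => hb.2 ⟨hb.1, h⟩⟩, (he a b).1 hab⟩

theorem colAdj_orderIso (e : P ≃o P') (a b : P) :
    ColAdj LT.lt a b ↔ ColAdj LT.lt (e a) (e b) :=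
  colAdj_equiv e.toEquiv e.toEquiv (fun _ _ => e.lt_iff_lt.symm) a b

theorem rowAdj_orderIso (e : P ≃o P') (a b : P) :
    ColAdj (flip LT.lt) a b ↔ ColAdj (flip LT.lt) (e a) (e b) :=
  colAdj_equiv (R := flip LT.lt) (R' := flip LT.lt) e.toEquiv e.toEquiv
    (fun _ _ => e.lt_iff_lt.symm) a b

theorem IsTangle.image (e : P ≃o P') {T : Set P × Set P} (hT : IsTangle T) :
    IsTangle (e '' T.1, e '' T.2) := by
  rw [isTangle_iff] at hT ⊢
  refine ⟨hT.col.image e.toEquiv (colAdj_orderIso e), hT.row.image e.toEquiv (rowAdj_orderIso e),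
    ?_⟩
  obtain ⟨a, ha, b, hb, c, hc, d, hd, h1, h2, h3, h4⟩ := hT.isMatch
  exact ⟨e a, ⟨a, ha, rfl⟩, e b, ⟨b, hb, rfl⟩, e c, ⟨c, hc, rfl⟩, e d, ⟨d, hd, rfl⟩,
    by simpa, by simpa, by simpa, by simpa⟩

/-- Lying in no tangle means being isolated in both graphs, a description that isomorphisms
preserve. -/
theorem mem_outsideTangles_iff (x : P) : x ∈ outsideTangles P ↔
    (∀ b, ¬ ColAdj LT.lt x b) ∧ ∀ b, ¬ ColAdj (flip LT.lt) x b := by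
  constructor
  · refine fun hx => ⟨fun b hb => ?_, fun b hb => ?_⟩
    · obtain ⟨T, hT, h⟩ := not_mem_outsideTangles_of_colAdj hb
      exact hx T hT (.inl h)
    · obtain ⟨T, hT, h⟩ := not_mem_outsideTangles_of_rowAdj hb
      exact hx T hT (.inr h)
  · rintro ⟨h1, h2⟩ T hT hx
    rw [isTangle_iff] at hT
    rcases hx with hx | hx
    · obtain ⟨b, -, hb⟩ := hT.col.exists_adj hx
      exact h1 b hb
    · obtain ⟨b, -, hb⟩ := hT.row.exists_adj hx
      exact h2 b hb

theorem IsCloneSet.image (e : P ≃o P') {C : Set P} (hC : IsCloneSet C) : IsCloneSet (e '' C) := by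
  have ho : ∀ x, x ∈ outsideTangles P ↔ e x ∈ outsideTangles P' := by
    intro x
    rw [mem_outsideTangles_iff, mem_outsideTangles_iff]
    exact and_congr (e.surjective.forall.trans (by simp [← colAdj_orderIso])).symm
      (e.surjective.forall.trans (by simp [← rowAdj_orderIso])).symm
  have hv : ∀ x y : P, view x = view y ↔ view (e x) = view (e y) := by
    intro x y
    rw [view_eq_iff, view_eq_iff]
    exact and_congr (e.surjective.forall.trans (by simp)).symm
      (e.surjective.forall.trans (by simp)).symm
  obtain ⟨x, hx, rfl⟩ := hC
  refine ⟨e x, (ho x).1 hx, ?_⟩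
  ext y
  obtain ⟨y, rfl⟩ := e.surjective y
  simp only [Set.mem_image, EmbeddingLike.apply_eq_iff_eq, exists_eq_right]
  exact and_congr (ho y) (hv y x)

/-- The image of a part under an isomorphism. -/
def PosetPart.image (e : P ≃o P') : PosetPart P → PosetPart P'
  | .inl C => .inl ⟨_, C.2.image e⟩
  | .inr T => .inr ⟨_, T.2.image e⟩

theorem PosetPart.verts_image (e : P ≃o P') (X : PosetPart P) :
    (X.image e).verts = e '' X.verts := by
  rcases X with C | T
  · rfl
  · exact (Set.image_union _ _ _).symm

theorem HasBlock.image (e : P ≃o P') {X : PosetPart P} {b : Block} (h : HasBlock X b) :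
    HasBlock (X.image e) b := by
  obtain ⟨hl, φ, h1, h2, h3, h4⟩ := h
  refine ⟨?_, e ∘ φ, e.injective.comp h1, ?_, fun u => (level_orderIso e _).trans (h3 u),
    fun u v => e.lt_iff_lt.trans (h4 u v)⟩
  · generalize b.letter = x at hl
    rcases hl with ⟨C, i, h⟩ | ⟨T, i, hA, hB⟩
    · refine .c _ i ?_
      rintro _ ⟨a, ha, rfl⟩
      rw [level_orderIso, h a ha]
    · refine .t _ i ?_ ?_
      · rintro _ ⟨a, ha, rfl⟩
        rw [level_orderIso, hA a ha]
      · rintro _ ⟨a, ha, rfl⟩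
        rw [level_orderIso, hB a ha]
  · rw [Set.range_comp, h2, PosetPart.verts_image]

/-- Serves to replace the poset of a list of blocks by the chosen order on `Fin n` in its class. -/
theorem Realizes.of_orderIso [Finite P] [Finite P'] (hP : IsFree31 P) (e : P ≃o P')
    {l : List Block} (h : Realizes P l) : Realizes P' l := by
  have hP' := hP.of_orderIso e
  obtain ⟨L, hL, rfl⟩ := h
  refine ⟨L.map (PosetPart.image e), ⟨?_, fun X => ?_, fun i j hij a ha b hb => ?_⟩, ?_⟩
  · refine hL.nodup.map fun X Y hXY => ?_
    obtain ⟨a, ha⟩ := X.nonempty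
    have : e a ∈ (Y.image e).verts := hXY ▸ (X.verts_image e ▸ ⟨a, ha, rfl⟩)
    rw [PosetPart.verts_image] at this
    obtain ⟨b, hb, hab⟩ := this
    cases e.injective hab
    exact PosetPart.eq_of_mem hP ha hb
  · obtain ⟨x, hx⟩ := X.nonempty
    obtain ⟨Y, hY⟩ := PosetPart.exists_mem (e.symm x)
    refine List.mem_map.2 ⟨Y, hL.complete Y, PosetPart.eq_of_mem hP' (a := x) ?_ hx⟩
    rw [PosetPart.verts_image]
    exact ⟨_, hY, e.apply_symm_apply x⟩
  · simp only [List.get_eq_getElem, List.getElem_map, PosetPart.verts_image] at ha hb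
    obtain ⟨a, ha, rfl⟩ := ha
    obtain ⟨b, hb, rfl⟩ := hb
    rw [level_orderIso, level_orderIso, e.lt_iff_lt]
    exact hL.compatible (i.cast (by simp)) (j.cast (by simp)) (by simpa [Fin.ext_iff] using hij)
      a ha b hb
  · rw [List.map_map]
    exact List.map_congr_left fun X _ =>
      (hP'.hasBlock_block _).unique ((hP.hasBlock_block X).image e)

end Transport

/-! ### Skeleta -/

/-- A word that represents a given element of the free partially commuting monoid. -/
def rep (m : TraceMonoid) : List Letter :=
  (PresentedMonoid.surjective_mk m).choose.toList

theorem trace_rep (m : TraceMonoid) : trace (rep m) = m :=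
  (PresentedMonoid.surjective_mk m).choose_spec

/-- Whether a letter stands for a clone set. -/
def Letter.isC : Letter → Bool
  | .c _ => true
  | .t _ => false

theorem countP_isLeft {A B : Type*} [Finite A] [Finite B] {L : List (A ⊕ B)} (hn : L.Nodup)
    (hc : ∀ x, x ∈ L) :
    L.countP Sum.isLeft = Nat.card A ∧ L.countP Sum.isRight = Nat.card B := by
  classical
  have := Fintype.ofFinite A
  have := Fintype.ofFinite B
  have key : ∀ p : A ⊕ B → Bool, L.countP p = (Finset.univ.filter fun x => p x = true).card := by
    intro p
    rw [List.countP_eq_length_filter, ← List.toFinset_card_of_nodup (hn.filter p)]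
    congr 1
    ext x
    simp [hc]
  constructor
  · rw [key, Nat.card_eq_fintype_card, ← Finset.card_univ,
      ← Finset.card_map (Function.Embedding.inl : A ↪ A ⊕ B)]
    congr 1
    ext (x | x) <;> simp
  · rw [key, Nat.card_eq_fintype_card, ← Finset.card_univ,
      ← Finset.card_map (Function.Embedding.inr : B ↪ A ⊕ B)]
    congr 1
    ext (x | x) <;> simp

theorem IsFree31.countP_isC {P : Type*} [PartialOrder P] [Finite P] (hP : IsFree31 P)
    {L : List (PosetPart P)} (hL : IsCompatibleListing L) :
    (L.map PosetPart.letter).countP Letter.isC = Nat.card {C : Set P // IsCloneSet C} ∧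
      (L.map PosetPart.letter).countP (fun x => !x.isC) =
        Nat.card {T : Set P × Set P // IsTangle T} := by
  have h : ∀ X : PosetPart P, X.letter.isC = Sum.isLeft X := by
    intro X
    have h := hP.hasLetter_letter X
    generalize X.letter = x at h
    cases h <;> rfl
  obtain ⟨h1, h2⟩ := countP_isLeft hL.nodup hL.complete
  rw [List.countP_map, List.countP_map, ← h1, ← h2]
  constructor
  · exact List.countP_congr fun X _ => by rw [Function.comp_apply, h]
  · exact List.countP_congr fun X _ => by
      rw [Function.comp_apply, h]
      rcases X with X | X <;> simp

/-- The chosen representative is itself the word of a listing. Its letter counts also show that the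
skeleton determines `r` and `s`. -/
theorem exists_of_mem_skeleta {r s : ℕ} {m : TraceMonoid} (h : m ∈ skeleta r s) :
    IsSkeletonWord (rep m) ∧ (rep m).countP Letter.isC = r ∧
      (rep m).countP (fun x => !x.isC) = s := by
  obtain ⟨P, _, _, hP, ⟨L, w, hL, hw, hm⟩, rfl, rfl⟩ := h
  rw [hP.forall₂_hasLetter_iff] at hw
  obtain ⟨L', hL', hw'⟩ := hP.exists_listing_of_trace_eq (w := w) (w' := rep m)
    (by rw [trace_rep, hm]; rfl) ⟨L, hL, hw⟩
  rw [← hw']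
  exact ⟨hP.isSkeletonWord hL', hP.countP_isC hL'⟩

theorem IsSkeletonWord.exists_occ {w : List Letter} (h : IsSkeletonWord w) {x : Letter}
    (hx : x ∈ w) {i : ℕ} (hi : i ≤ x.base) : ∃ y ∈ w, y.Occ i := by
  induction hn : x.base - i generalizing i with
  | zero => exact ⟨x, hx, by rw [show i = x.base by omega]; exact x.occ_base⟩
  | succ n ih =>
    obtain ⟨y, hy, hyo⟩ := ih (i := i + 1) (by omega) (by omega)
    by_cases hb : y.base = i + 1
    · obtain ⟨p, hp⟩ := List.mem_iff_getElem?.1 hy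
      obtain ⟨q, -, z, hz, hzo⟩ := h.below p y i hp hb
      exact ⟨z, List.mem_of_getElem? hz, hzo⟩
    · refine ⟨y, hy, ?_⟩
      cases y <;> simp only [Letter.Occ, Letter.base] at * <;> omega

/-- All levels up to the base of a letter are occupied, and each letter occupies at most two. This
bounds the alphabet, hence the number of skeleta with given `r` and `s`. -/
theorem IsSkeletonWord.base_lt {w : List Letter} (h : IsSkeletonWord w) {x : Letter}
    (hx : x ∈ w) : x.base < 2 * w.length := by
  classical
  have hsub : Finset.range (x.base + 1) ⊆ w.toFinset.biUnion fun y => {y.base, y.base + 1} := by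
    intro i hi
    rw [Finset.mem_range] at hi
    obtain ⟨y, hy, hyo⟩ := h.exists_occ hx (Nat.lt_succ_iff.1 hi)
    simp only [Finset.mem_biUnion, List.mem_toFinset, Finset.mem_insert, Finset.mem_singleton]
    refine ⟨y, hy, ?_⟩
    cases y <;> simp only [Letter.Occ, Letter.base] at * <;> omega
  have h1 := Finset.card_le_card hsub
  have h2 : (w.toFinset.biUnion fun y => ({y.base, y.base + 1} : Finset ℕ)).card ≤
      w.toFinset.card * 2 :=
    Finset.card_biUnion_le_card_mul _ _ _ fun y _ => Finset.card_le_two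
  have h3 := List.toFinset_card_le w
  rw [Finset.card_range] at h1
  omega

theorem length_eq_of_countP (w : List Letter) :
    w.length = w.countP Letter.isC + w.countP (fun x => !x.isC) := by
  rw [List.length_eq_countP_add_countP Letter.isC]
  congr 1
  exact List.countP_congr fun x _ => by simp

theorem skeleta_finite (r s : ℕ) : (skeleta r s).Finite := by
  have hfin : {x : Letter | x.base < 2 * (r + s)}.Finite := by
    refine ((Set.finite_lt_nat (2 * (r + s))).image Letter.c |>.union
      ((Set.finite_lt_nat (2 * (r + s))).image Letter.t)).subset ?_
    rintro (i | i) hi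
    · exact .inl ⟨i, hi, rfl⟩
    · exact .inr ⟨i, hi, rfl⟩
  have := hfin.to_subtype
  refine ((List.finite_length_eq {x : Letter | x.base < 2 * (r + s)} (r + s)).image
    fun l => trace (l.map Subtype.val)).subset fun m hm => ?_
  obtain ⟨hw, h1, h2⟩ := exists_of_mem_skeleta hm
  have hlen := length_eq_of_countP (rep m)
  rw [h1, h2] at hlen
  have hb : ∀ x ∈ rep m, x.base < 2 * (r + s) := fun x hx => hlen ▸ hw.base_lt hx
  lift rep m to List {x : Letter | x.base < 2 * (r + s)} using hb with l hl
  refine ⟨l, by simpa using hlen, ?_⟩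
  rw [← trace_rep m, ← hl]

end ThreePlusOne
end
noncomputable section
namespace ThreePlusOne

/-! ### Generating functions -/

theorem coeff_subst₂ (F : MvPowerSeries (Fin 2) ℚ) {f g : PowerSeries ℚ} (h : CanSubst₂ f g)
    (n : ℕ) : PowerSeries.coeff n (subst₂ F f g) =
      ∑ᶠ d : Fin 2 →₀ ℕ, MvPowerSeries.coeff d F * PowerSeries.coeff n (f ^ d 0 * g ^ d 1) := by
  rw [PowerSeries.coeff, subst₂, MvPowerSeries.coeff_subst (hasSubst_pair h)]
  refine finsum_congr fun d => ?_
  rw [Finsupp.prod_fintype _ _ fun i => pow_zero _, Fin.prod_univ_two, smul_eq_mul]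
  rfl

theorem finsum_card {ι : Type*} (A : ι → Type*) [Finite (Σ i, A i)] :
    ∑ᶠ i, (Nat.card (A i) : ℚ) = Nat.card (Σ i, A i) := by
  classical
  have := Fintype.ofFinite (Σ i, A i)
  have hf : ∀ i, Finite (A i) := fun i =>
    Finite.of_injective (Sigma.mk i : A i → Σ i, A i) sigma_mk_injective
  have hcard : ∀ i, Nat.card (A i) =
      (Finset.univ.filter fun x : Σ i, A i => x.1 = i).card := by
    intro i
    rw [← Fintype.card_subtype, ← Nat.card_eq_fintype_card]
    refine Nat.card_congr ⟨fun a => ⟨⟨i, a⟩, rfl⟩, fun x => x.2 ▸ x.1.2, fun a => rfl, ?_⟩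
    rintro ⟨⟨j, a⟩, rfl⟩
    rfl
  rw [finsum_eq_sum_of_support_subset (s := Finset.univ.image (Sigma.fst : (Σ i, A i) → ι)),
    Nat.card_eq_fintype_card, ← Finset.card_univ, Finset.card_eq_sum_card_image Sigma.fst,
    Nat.cast_sum]
  · exact Finset.sum_congr rfl fun i _ => by rw [hcard]
  · intro i hi
    rw [Function.mem_support, Nat.cast_ne_zero] at hi
    obtain ⟨a⟩ := (Nat.card_pos_iff.1 (Nat.pos_of_ne_zero hi)).1
    simp only [Finset.coe_image, Finset.coe_univ, Set.image_univ, Set.mem_range]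
    exact ⟨⟨i, a⟩, rfl⟩

/-- The generating function for the blocks with a given letter. -/
def blockSeries : Letter → PowerSeries ℚ
  | .c _ => PowerSeries.X * (1 - PowerSeries.X)⁻¹
  | .t _ => diag tangleSeries

theorem Block.size_pos (b : Block) : 0 < b.size := by
  rcases b with ⟨i, k⟩ | ⟨i, p, q, τ⟩
  · exact Nat.succ_pos k
  · obtain ⟨x, -⟩ := (Block.tangled τ).row.nontrivial.nonempty
    have := x.pos
    simp only [Block.size]
    omega

theorem inv_one_sub_X : (1 - PowerSeries.X : PowerSeries ℚ)⁻¹ = PowerSeries.mk fun _ => 1 := by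
  symm
  rw [PowerSeries.eq_inv_iff_mul_eq_one (by simp)]
  exact PowerSeries.mk_one_mul_one_sub_eq_one ℚ

/-- There is one clone block of each positive size. Tangle blocks of size `n` are sorted by
bidegree, which is what the substitution `T(x, x)` collects. -/
theorem coeff_blockSeries (x : Letter) (n : ℕ) :
    Finite {b : Block // b.letter = x ∧ b.size = n} ∧
    PowerSeries.coeff n (blockSeries x) =
      (Nat.card {b : Block // b.letter = x ∧ b.size = n} : ℚ) := by
  rcases x with i | i
  · rcases n with _ | k
    · have : IsEmpty {b : Block // b.letter = .c i ∧ b.size = 0} :=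
        ⟨fun b => b.1.size_pos.ne' b.2.2⟩
      refine ⟨inferInstance, ?_⟩
      rw [Nat.card_of_isEmpty, blockSeries]
      simp
    · have hu : ∀ b : {b : Block // b.letter = .c i ∧ b.size = k + 1}, b = ⟨.c i k, rfl, rfl⟩ := by
        rintro ⟨b, h1, h2⟩
        rcases b with ⟨j, k'⟩ | ⟨j, p, q, τ⟩
        · cases h1
          cases h2
          rfl
        · cases h1
      have : Unique {b : Block // b.letter = .c i ∧ b.size = k + 1} := ⟨⟨_⟩, hu⟩
      refine ⟨inferInstance, ?_⟩
      rw [Nat.card_unique, blockSeries, inv_one_sub_X, PowerSeries.coeff_succ_X_mul,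
        PowerSeries.coeff_mk, Nat.cast_one]
  · let A : (Fin 2 →₀ ℕ) → Type := fun d => {_τ : TangleClass (d 0) (d 1) // d 0 + d 1 = n}
    let f : (Σ d, A d) → {b : Block // b.letter = .t i ∧ b.size = n} :=
      fun x => ⟨.t i _ _ x.2.1, rfl, x.2.2⟩
    have hf : Function.Bijective f := by
      constructor
      · rintro ⟨d, τ, h⟩ ⟨d', τ', h'⟩ e
        simp only [f, Subtype.mk.injEq, Block.t.injEq, true_and] at e
        obtain ⟨e0, e1, e2⟩ := e
        cases finsupp_ext e0 e1
        cases e2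
        rfl
      · rintro ⟨b, h1, h2⟩
        rcases b with ⟨j, k'⟩ | ⟨j, p, q, τ⟩
        · cases h1
        · cases h1
          obtain ⟨e, rfl, rfl⟩ := exists_finsupp p q
          exact ⟨⟨e, τ, h2⟩, rfl⟩
    -- Bidegrees of total `n` are at most `(n, n)`, so there are finitely many.
    obtain ⟨e, he0, he1⟩ := exists_finsupp n n
    have hle : ∀ {d : Fin 2 →₀ ℕ}, d 0 + d 1 = n → d ≤ e := fun {d} h =>
      Finsupp.le_def.2 (Fin.forall_fin_two.2 ⟨by omega, by omega⟩)
    have hfin : Finite (Σ d, A d) := by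
      refine Finite.of_injective (β := Σ d : Set.Iic e, TangleClass (d.1 0) (d.1 1))
        (fun x => ⟨⟨x.1, hle x.2.2⟩, x.2.1⟩) ?_
      rintro ⟨d, τ, h⟩ ⟨d', τ', h'⟩ e
      rw [Sigma.mk.injEq] at e
      obtain ⟨hd, e⟩ := e
      obtain rfl : d = d' := congrArg Subtype.val hd
      cases e
      rfl
    refine ⟨Finite.of_surjective f hf.2, ?_⟩
    rw [← Nat.card_eq_of_bijective f hf, ← finsum_card, blockSeries, diag,
      coeff_subst₂ _ canSubst_X]
    refine finsum_congr fun d => ?_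
    rw [← pow_add, PowerSeries.coeff_X_pow]
    have hc : MvPowerSeries.coeff d tangleSeries = (Nat.card (TangleClass (d 0) (d 1)) : ℚ) := rfl
    by_cases h : d 0 + d 1 = n
    · rw [if_pos h.symm, mul_one, hc]
      exact congrArg _ (Nat.card_congr (Equiv.subtypeUnivEquiv fun _ => h).symm)
    · have : IsEmpty (A d) := ⟨fun τ => h τ.2⟩
      rw [if_neg (Ne.symm h), mul_zero, Nat.card_of_isEmpty, Nat.cast_zero]

/-- The lists of blocks with the letters `w` and `n` vertices. -/
abbrev Labelling (w : List Letter) (n : ℕ) : Type :=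
  {l : List Block // l.map Block.letter = w ∧ (l.map Block.size).sum = n}

theorem coeff_prod_blockSeries (w : List Letter) (n : ℕ) : Finite (Labelling w n) ∧
    PowerSeries.coeff n (w.map blockSeries).prod = (Nat.card (Labelling w n) : ℚ) := by
  induction w generalizing n with
  | nil =>
    by_cases hn : n = 0
    · subst hn
      have : Unique (Labelling [] 0) :=
        ⟨⟨[], rfl, rfl⟩, fun l => Subtype.ext (List.map_eq_nil_iff.1 l.2.1)⟩
      refine ⟨inferInstance, ?_⟩
      rw [Nat.card_unique]
      simp
    · have : IsEmpty (Labelling [] n) := by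
        refine ⟨fun ⟨l, h1, h2⟩ => hn ?_⟩
        rw [List.map_eq_nil_iff] at h1
        subst h1
        exact h2.symm
      refine ⟨inferInstance, ?_⟩
      rw [Nat.card_of_isEmpty]
      simp [PowerSeries.coeff_one, hn]
  | cons x w ih =>
    let B : Finset.HasAntidiagonal.antidiagonal n → Type := fun p =>
      {b : Block // b.letter = x ∧ b.size = p.1.1} × Labelling w p.1.2
    let f : (Σ p, B p) → Labelling (x :: w) n := fun y =>
      ⟨y.2.1.1 :: y.2.2.1, by simp [y.2.1.2.1, y.2.2.2.1], by
        simp only [List.map_cons, List.sum_cons, y.2.1.2.2, y.2.2.2.2]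
        exact Finset.HasAntidiagonal.mem_antidiagonal.1 y.1.2⟩
    have hf : Function.Bijective f := by
      constructor
      · rintro ⟨⟨⟨p, q⟩, h⟩, ⟨b, h1, hs⟩, ⟨l, h2, hn⟩⟩
          ⟨⟨⟨p', q'⟩, h'⟩, ⟨b', h1', hs'⟩, ⟨l', h2', hn'⟩⟩ e
        simp only [f, Subtype.mk.injEq, List.cons.injEq] at e
        obtain ⟨rfl, rfl⟩ := e
        obtain rfl : p = p' := hs.symm.trans hs'
        obtain rfl : q = q' := hn.symm.trans hn'
        rfl
      · rintro ⟨l, h1, h2⟩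
        obtain ⟨b, l, rfl, hb, hl⟩ := List.map_eq_cons_iff.1 h1
        exact ⟨⟨⟨(b.size, (l.map Block.size).sum),
          Finset.HasAntidiagonal.mem_antidiagonal.2 (by simpa using h2)⟩, ⟨b, hb, rfl⟩,
          ⟨l, hl, rfl⟩⟩, rfl⟩
    have h1 := fun p : Finset.HasAntidiagonal.antidiagonal n => (coeff_blockSeries x p.1.1).1
    have h2 := fun p : Finset.HasAntidiagonal.antidiagonal n => (ih p.1.2).1
    have h3 : ∀ p, Finite (B p) := fun p => inferInstance
    refine ⟨Finite.of_surjective f hf.2, ?_⟩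
    rw [← Nat.card_eq_of_bijective f hf, Nat.card_sigma, List.map_cons, List.prod_cons,
      PowerSeries.coeff_mul, ← Finset.sum_coe_sort, Nat.cast_sum]
    refine Finset.sum_congr rfl fun p _ => ?_
    rw [Nat.card_prod, Nat.cast_mul, (coeff_blockSeries x _).2, (ih _).2]

theorem prod_blockSeries (w : List Letter) : (w.map blockSeries).prod =
    (PowerSeries.X * (1 - PowerSeries.X)⁻¹) ^ w.countP Letter.isC *
      diag tangleSeries ^ w.countP (fun x => !x.isC) := by
  induction w with
  | nil => simp
  | cons x w ih =>
    rw [List.map_cons, List.prod_cons, ih]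
    rcases x with i | i
    · rw [List.countP_cons_of_pos rfl, List.countP_cons_of_neg (by simp [Letter.isC]), pow_succ]
      simp only [blockSeries]
      ring
    · rw [List.countP_cons_of_neg (by simp [Letter.isC]), List.countP_cons_of_pos rfl, pow_succ]
      simp only [blockSeries]
      ring

/-! ### Counting posets -/

/-- `Fin n` with the order `p`. -/
def OrderOn {n : ℕ} (_ : PartialOrder (Fin n)) : Type := Fin n

/-- The synonym keeps `p` apart from the standard order on `Fin n`. -/
instance {n : ℕ} (p : PartialOrder (Fin n)) : PartialOrder (OrderOn p) := p

instance {n : ℕ} (p : PartialOrder (Fin n)) : Finite (OrderOn p) :=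
  inferInstanceAs (Finite (Fin n))

/-- The lists of blocks over the representatives of the skeleta with given numbers of clone sets
and tangles. -/
abbrev SkeletonLabelling (n : ℕ) (d : Fin 2 →₀ ℕ) : Type :=
  Σ m : skeleta (d 0) (d 1), Labelling (rep m.1) n

theorem length_le_of_labelling {w : List Letter} {n : ℕ} (l : Labelling w n) : w.length ≤ n := by
  obtain ⟨l, rfl, rfl⟩ := l
  induction l with
  | nil => simp
  | cons b l ih =>
    have := b.size_pos
    simp only [List.map_cons, List.length_cons, List.sum_cons]
    omega

/-- Blocks are nonempty, so a word labelled with `n` vertices has at most `n` letters. -/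
instance (n : ℕ) : Finite (Σ d, SkeletonLabelling n d) := by
  obtain ⟨e, he0, he1⟩ := exists_finsupp n n
  have hle : ∀ {d : Fin 2 →₀ ℕ}, SkeletonLabelling n d → d ≤ e := by
    rintro d ⟨⟨m, hm⟩, l⟩
    have h := length_le_of_labelling l
    obtain ⟨-, h1, h2⟩ := exists_of_mem_skeleta hm
    rw [length_eq_of_countP, h1, h2] at h
    exact Finsupp.le_def.2 (Fin.forall_fin_two.2 ⟨by omega, by omega⟩)
  have := fun r s => (skeleta_finite r s).to_subtype
  have := fun w n => (coeff_prod_blockSeries w n).1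
  refine Finite.of_injective (β := Σ d : Set.Iic e, SkeletonLabelling n d.1)
    (fun x => ⟨⟨x.1, hle x.2⟩, x.2⟩) ?_
  rintro ⟨d, x⟩ ⟨d', x'⟩ e
  rw [Sigma.mk.injEq] at e
  obtain ⟨hd, e⟩ := e
  obtain rfl : d = d' := congrArg Subtype.val hd
  cases e
  rfl

theorem card_orderOn {n : ℕ} (p : PartialOrder (Fin n)) : Nat.card (OrderOn p) = n := Nat.card_fin n

/-- A poset is related to the list of blocks of its listing over the chosen word of its skeleton;
this listing exists and is unique. Conversely a list of blocks is realized by `Word`, and by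
`IsFree31.nonempty_orderIso` by no other poset up to isomorphism. -/
theorem pUnl_eq (n : ℕ) : pUnl n = Nat.card (Σ d, SkeletonLabelling n d) := by
  refine card_eq_of_rel (fun (q : Quotient (posetSetoid n)) x =>
    Realizes (OrderOn q.out.1) x.2.2.1) (fun q => ?_) ?_
  · have hP : IsFree31 (OrderOn q.out.1) := q.out.2
    apply existsUnique_of_exists_of_unique
    · obtain ⟨L, hL⟩ := hP.exists_isCompatibleListing
      obtain ⟨d, hd0, hd1⟩ := exists_finsupp (Nat.card {C : Set (OrderOn q.out.1) // IsCloneSet C})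
        (Nat.card {T : Set (OrderOn q.out.1) × Set (OrderOn q.out.1) // IsTangle T})
      have hm : trace (L.map PosetPart.letter) ∈ skeleta (d 0) (d 1) :=
        ⟨OrderOn q.out.1, inferInstance, inferInstance, hP,
          ⟨L, _, hL, hP.forall₂_hasLetter_iff.2 rfl, rfl⟩, hd0.symm, hd1.symm⟩
      -- Passes from an arbitrary listing to the one whose word is the chosen representative.
      obtain ⟨L', hL', hw⟩ := hP.exists_listing_of_trace_eq (trace_rep _).symm ⟨L, hL, rfl⟩
      refine ⟨⟨d, ⟨_, hm⟩, L'.map PosetPart.block, ?_, ?_⟩, L', hL', rfl⟩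
      · rw [← hw, List.map_map]
        exact List.map_congr_left fun X _ => hP.letter_block X
      · exact (hP.sum_size ⟨L', hL', rfl⟩).trans (card_orderOn _)
    · rintro ⟨d, ⟨m, hm⟩, l, hl, hn⟩ ⟨d', ⟨m', hm'⟩, l', hl', hn'⟩ ⟨L, hL, h⟩ ⟨L', hL', h'⟩
      simp only at h h' hl hl'
      have hw : L.map PosetPart.letter = rep m := by
        rw [← hl, ← h, List.map_map]
        exact List.map_congr_left fun X _ => (hP.letter_block X).symm
      have hw' : L'.map PosetPart.letter = rep m' := by
        rw [← hl', ← h', List.map_map]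
        exact List.map_congr_left fun X _ => (hP.letter_block X).symm
      have hmm : m = m' := by
        rw [← trace_rep m, ← trace_rep m', ← hw, ← hw']
        exact hP.trace_unique hL hL'
      subst hmm
      obtain ⟨-, h1, h2⟩ := exists_of_mem_skeleta hm
      obtain ⟨-, h1', h2'⟩ := exists_of_mem_skeleta hm'
      cases finsupp_ext (h1.symm.trans h1') (h2.symm.trans h2')
      cases hP.listing_unique hL hL' (hw.trans hw'.symm)
      subst h
      subst h'
      rfl
  · rintro ⟨d, ⟨m, hm⟩, l, hl, hn⟩
    simp only
    have hs : IsSkeletonWord (l.map Block.letter) := hl ▸ (exists_of_mem_skeleta hm).1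
    have hreal := Word.realizes hs
    have hfree := Word.isFree31 l
    have iso : ∀ {p q : {p : PartialOrder (Fin n) // @IsFree31 (Fin n) p}},
        Nonempty (OrderOn p.1 ≃o OrderOn q.1) → (posetSetoid n).r p q :=
      fun ⟨e⟩ => ⟨e.toEquiv, fun a b => e.le_iff_le.symm⟩
    have iso' : ∀ {p q : {p : PartialOrder (Fin n) // @IsFree31 (Fin n) p}},
        (posetSetoid n).r p q → Nonempty (OrderOn p.1 ≃o OrderOn q.1) :=
      fun ⟨σ, h⟩ => ⟨⟨σ, fun {a b} => (h a b).symm⟩⟩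
    apply existsUnique_of_exists_of_unique
    · have hcard : Nat.card (Word l) = n := (hfree.sum_size hreal).symm.trans hn
      let σ : Word l ≃ Fin n := Finite.equivFinOfCardEq hcard
      let p : PartialOrder (Fin n) := PartialOrder.lift σ.symm σ.symm.injective
      let e : Word l ≃o OrderOn p := ⟨σ, fun {a b} => by
        change σ.symm (σ a) ≤ σ.symm (σ b) ↔ a ≤ b
        simp⟩
      have hp : @IsFree31 (Fin n) p := hfree.of_orderIso e
      obtain ⟨e'⟩ := iso' ((posetSetoid n).symm (Quotient.mk_out (s := posetSetoid n) ⟨p, hp⟩))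
      exact ⟨Quotient.mk _ ⟨p, hp⟩, hreal.of_orderIso hfree (e.trans e')⟩
    · intro q q' h h'
      obtain ⟨e⟩ := IsFree31.nonempty_orderIso (P := OrderOn q.out.1) q.out.2 h
      obtain ⟨e'⟩ := IsFree31.nonempty_orderIso (P := OrderOn q'.out.1) q'.out.2 h'
      rw [← Quotient.out_eq q, ← Quotient.out_eq q']
      exact Quotient.sound (iso ⟨e.symm.trans e'⟩)

/-- By `prod_blockSeries` the number of labellings depends only on the numbers of clone set and
tangle letters, so all skeleta counted by one coefficient contribute equally. -/
theorem card_skeletonLabelling (n : ℕ) (d : Fin 2 →₀ ℕ) :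
    (Nat.card (SkeletonLabelling n d) : ℚ) = MvPowerSeries.coeff d skeletonSeries *
      PowerSeries.coeff n ((PowerSeries.X * (1 - PowerSeries.X)⁻¹) ^ d 0 *
        diag tangleSeries ^ d 1) := by
  have := (skeleta_finite (d 0) (d 1)).fintype
  have := fun w n => (coeff_prod_blockSeries w n).1
  have hc : MvPowerSeries.coeff d skeletonSeries = ((skeleta (d 0) (d 1)).ncard : ℚ) := rfl
  have h : ∀ m : skeleta (d 0) (d 1), (Nat.card (Labelling (rep m.1) n) : ℚ) =
      PowerSeries.coeff n ((PowerSeries.X * (1 - PowerSeries.X)⁻¹) ^ d 0 *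
        diag tangleSeries ^ d 1) := by
    intro m
    obtain ⟨-, h1, h2⟩ := exists_of_mem_skeleta m.2
    rw [← (coeff_prod_blockSeries _ n).2, prod_blockSeries, h1, h2]
  rw [Nat.card_sigma, Nat.cast_sum, Finset.sum_congr rfl fun m _ => h m, Finset.sum_const, hc,
    nsmul_eq_mul, Finset.card_univ, ← Nat.card_eq_fintype_card, Nat.card_coe_set_eq]

theorem canSubst_series :
    CanSubst₂ (PowerSeries.X * (1 - PowerSeries.X)⁻¹) (diag tangleSeries) :=
  ⟨by simp, constantCoeff_diag_tangleSeries⟩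

theorem mk_pUnl_eq : PowerSeries.mk (fun n => (pUnl n : ℚ)) =
    subst₂ skeletonSeries (PowerSeries.X * (1 - PowerSeries.X)⁻¹) (diag tangleSeries) := by
  ext n
  rw [PowerSeries.coeff_mk, coeff_subst₂ _ canSubst_series, pUnl_eq, ← finsum_card]
  exact finsum_congr fun d => card_skeletonLabelling n d

end ThreePlusOne
end

/-! ### The main theorem -/

open ThreePlusOne PowerSeries in
theorem mainTheorem1 :
    (∀ r s : ℕ, (skeleta r s).Finite) ∧
    CanSubst₂ (X * (1 - X)⁻¹) (diag tangleSeries) ∧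
    PowerSeries.mk (fun n => (pUnl n : ℚ)) =
      subst₂ skeletonSeries (X * (1 - X)⁻¹) (diag tangleSeries) ∧
    CanSubst₂ (X * (1 - X)⁻¹) (1 - 2 * X - (diag bicolouredSeries)⁻¹) ∧
    PowerSeries.mk (fun n => (pUnl n : ℚ)) =
      subst₂ skeletonSeries (X * (1 - X)⁻¹) (1 - 2 * X - (diag bicolouredSeries)⁻¹) := by
  rw [← diag_tangleSeries_eq]
  exact ⟨skeleta_finite, canSubst_series, mk_pUnl_eq, canSubst_series, mk_pUnl_eq⟩
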